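/- **Theorem S4 (completeness).** *Setting.* Let $n\ge 2$. Let $\mathcal D$ be a probability distribution on $\{X,Y,Z\}^n$, $\omega(\vec b|\vec P)\in\mathbb R$ weights with $|\omega|\le W$, $W>1$, and $$L=\mathbb E_{\vec P\leftarrow\mathcal D}\Big[\sum_{\vec b\in\{0,1\}^n}\omega(\vec b|\vec P)\bigotimes_{l=0}^{n-1}\tfrac{\mathbb I+(-1)^{b_l}P_l}{2}\Big].$$ *Reference experiment.* For $0\le l<n$, main party $A_l$ holds qubits $T_l,S_l$, a qubit $R_l^{\triangleright}$ if $l<n-1$, and a qubit $R_l^{\triangleleft}$ if $l>0$; auxiliary party $B_l$ holds one qubit. The state is $\tau_T\otimes\Phi^+$, where $\tau_T$ is an $n$-qubit state on $T=T_0\cdots T_{n-1}$ and $\Phi^+$ consists of Bell states $\phi^+=(|00\rangle+|11\rangle)/\sqrt2$ on each $S_lB_l$ and each $R_l^{\triangleright}R_{l+1}^{\triangleleft}$. The inputs of $A_l$ are $0,\dots,5,\triangleright,\triangleleft,\diamond$. Input $x\in\{0,\dots,5\}$ measures on $S_l$ the observable $(\sigma_x+(-1)^x\sigma_z)/\sqrt2$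 for $x\in\{0,1\}$, $(\sigma_x+(-1)^x\sigma_y)/\sqrt2$ for $x\in\{2,3\}$, $(\sigma_z+(-1)^x\sigma_y)/\sqrt2$ for $x\in\{4,5\}$, with outcome $a\in\{0,1\}$. Inputs $\triangleright,\triangleleft,\diamond$ are Bell measurements on $R_l^{\triangleright}S_l$, $R_l^{\triangleleft}S_l$, $T_lS_l$, with outcome $\vec a\in\{0,1\}^2$ for the projection onto $(U_{\vec a}\otimes\mathbb I)|\phi^+\rangle$, $U_{\vec a}=X^{a_0}Z^{a_1}$. Inputs $y=0,1,2$ of $B_l$ are identified with $X,Y,Z$ and measure $\sigma_x,\sigma_y,\sigma_z$ with outcome $b\in\{0,1\}$. There is no reference measurement for $\triangleleft$ at $A_0$ nor for $\triangleright$ at $A_{n-1}$. *Physical experiment.* An arbitrary state $\rho$ on a tensor product of finite-dimensional spaces of the $2n$ parties, and for each party and input an arbitrary POVM with the outcome set above; outcomes follow Born's rule. The rounds are i.i.d. The reference experiment is embedded in the physical one: each local reference space is a subspace of the local physical space (via an isometry), and each ideal measurement is a POVM on the physical space that extends the reference measurement block-diagonally. Let $D$ be the trace distance, $\epsilon_{\mathrm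 S}=\min_{\tau_T}D(\rho,\tau_T\otimes\Phi^+)$, and let $\epsilon_{\mathrm M}$ be the maximal diamond-norm distance between an implemented measurement channel $\rho\mapsto\sum_o\mathrm{tr}(\rho M_o)|o\rangle\langle o|$ and its ideal counterpart, over all parties and all inputs having a reference measurement. *Protocols.* Let $f(b|P,\vec a)=b\oplus\mathbf 1[\{P,U_{\vec a}\}=0]$, applied componentwise to vectors, and let $(x(0,k),x(1,k),y(0,k),y(1,k))$ be $(0,1,0,2),(3,2,0,1),(5,4,2,1)$ for $k=0,1,2$. In each of $N$ rounds settings are drawn and measured: - Protocol 1 (local randomness, for $\mathcal D=\bigotimes_l\mathcal D^{(l)}$, $\mathcal D^{(l)}=(p_X^{(l)},p_Y^{(l)},p_Z^{(l)})$): all parties choose independently; $A_l$ takes $\diamond$ with probability $1-\frac1n$ and each other input with probability $\frac1{8n}$; $B_l$ takes $P$ with probability $p_P^{(l)}$. - Protocol 2 (shared randomness): with probability $\frac13$ each, (I) for each $l$ independently, uniformly random $k,i,j$ and $x_l=x(i,k)$, $y_l=y(j,k)$; (II) uniformly random $s\in\{0,1\}$ and $y\in\{0,1,2\}$, and for every $l\le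 n-2$ with $l\equiv s \pmod 2$: $x_l=\triangleright$, $x_{l+1}=\triangleleft$, $y_l=y_{l+1}=y$, the remaining parties not measuring; (III) $\vec P\leftarrow\mathcal D$, and $x_l=\diamond$, $y_l=P_l$ for all $l$. Then, with all ratios having denominator zero set to zero: $\hat C_{ij}(l,k)$ is the average of $(-1)^{a_l+b_l}$ over the rounds with $(x_l,y_l)=(x(i,k),y(j,k))$; $\hat K(l)$ is the average of $-(-1)^{\mathbf 1[P=Y]}(-1)^{f(b_l|P,\vec a_l)+f(b_{l+1}|P,\vec a_{l+1})}$ over the rounds with $x_l=\triangleright$, $x_{l+1}=\triangleleft$, $y_l=y_{l+1}=P$, in Protocol 1 each such round being kept only with probability $\min_Q(p_Q^{(l)}p_Q^{(l+1)})/(p_P^{(l)}p_P^{(l+1)})$; $\hat v_{\mathrm{III}}$ is the average of $\omega(f(\vec b|\vec P,\vec a)|\vec P)$ over the rounds with all $x_l=\diamond$, where $\vec P$ corresponds to $\vec y$. Put $$\hat v_{\mathrm I}=2\sqrt2-\frac1{3n}\sum_{l,k,i,j}(-1)^{ij}\hat C_{ij}(l,k),\qquad \hat v_{\mathrm{II}}=1+\frac1{n-1}\sum_{l=0}^{n-2}\hat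 K(l).$$ The output is FAILED if $\hat v_{\mathrm I}>\frac{\varepsilon^2}{n^2W^2}$ or $\hat v_{\mathrm{II}}>\frac{\varepsilon}{nW}$, and otherwise CERTIFIED together with $\hat v_{\mathrm{III}}$. *Claim.* There are absolute constants $c,C>0$ such that the following holds for all $\varepsilon>0$ and $0<\delta<1$ whenever $\epsilon_{\mathrm S},\epsilon_{\mathrm M}\le c\,\frac{\varepsilon^2}{n^2W^2}$. 1. For every $p_0>0$ there is $K=K(p_0)$ such that, if $\mathcal D=\bigotimes_l\mathcal D^{(l)}$ with $p_X^{(l)},p_Y^{(l)},p_Z^{(l)}\ge p_0$ for all $l$, $\varepsilon\le\sqrt n\,W$ and $N\ge K\,W^4n^5\log(n/\delta)/\varepsilon^4$, then with probability at least $1-\delta$ Protocol 1 outputs CERTIFIED and a value $\hat v_{\mathrm{III}}$ that satisfies, for every $n$-qubit state $\tilde\tau_T$, $$|\hat v_{\mathrm{III}}-\mathrm{tr}(L\tilde\tau_T)|\le C\big(\varepsilon+W\,D(\rho,\tilde\tau_T\otimes\Phi^+)\big).$$ 2. There is an absolute constant $K$ such that, for arbitrary $\mathcal D$ and $N\ge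 K\,W^4n^4\log(n/\delta)/\varepsilon^4$, the same conclusion holds for Protocol 2. -/

import Mathlib

open scoped Matrix Kronecker ComplexOrder

namespace DISelfTest

noncomputable section

/-! ### Matrices, states, trace distance, diamond norm -/

section LinearAlgebra

/-- Tensor product of a finite family of (rectangular) matrices. -/
def tensorMat {I : Type*} [Fintype I] {κ ι : I → Type*}
    (A : ∀ l, Matrix (κ l) (ι l) ℂ) : Matrix (∀ l, κ l) (∀ l, ι l) ℂ :=
  Matrix.of fun i j => ∏ l, A l (i l) (j l)

/-- Trace norm `‖A‖₁ = tr √(Aᴴ A)`: the sum of the singular values of `A`. -/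
def traceNorm {ι κ : Type*} [Fintype ι] [Fintype κ] [DecidableEq κ]
    (A : Matrix ι κ ℂ) : ℝ :=
  ∑ i, Real.sqrt ((Matrix.isHermitian_conjTranspose_mul_self A).eigenvalues i)

/-- Trace distance `D(ρ, σ) = ½ ‖ρ - σ‖₁`. -/
def traceDist {ι : Type*} [Fintype ι] [DecidableEq ι] (ρ σ : Matrix ι ι ℂ) : ℝ :=
  traceNorm (ρ - σ) / 2

/-- Density matrices on `ℂ^ι`. -/
def QState (ι : Type*) [Fintype ι] : Type _ :=
  {ρ : Matrix ι ι ℂ // ρ.PosSemidef ∧ ρ.trace = 1}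

/-- POVMs with outcome set `O` on `ℂ^ι`. -/
structure POVM (O ι : Type*) [Fintype O] [Fintype ι] [DecidableEq ι] where
  elem : O → Matrix ι ι ℂ
  posSemidef : ∀ o, (elem o).PosSemidef
  sum_eq_one : ∑ o, elem o = 1

/-- The measurement channel `ρ ↦ ∑ₒ tr(ρ Mₒ) |o⟩⟨o|`. -/
def measChannel {O ι : Type*} [Fintype ι] [DecidableEq O] (M : O → Matrix ι ι ℂ) :
    Matrix ι ι ℂ →ₗ[ℂ] Matrix O O ℂ where
  toFun ρ := Matrix.diagonal fun o => (ρ * M o).trace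
  map_add' ρ σ := by
    ext i j
    by_cases h : i = j <;> simp [Matrix.diagonal, h, Matrix.add_mul]
  map_smul' c ρ := by
    ext i j
    by_cases h : i = j <;> simp [Matrix.diagonal, h]

/-- The map `Φ ⊗ id` with a `k`-dimensional ancilla. -/
def ampliation {ι κ : Type*} (Φ : Matrix ι ι ℂ →ₗ[ℂ] Matrix κ κ ℂ) (k : ℕ)
    (X : Matrix (ι × Fin k) (ι × Fin k) ℂ) : Matrix (κ × Fin k) (κ × Fin k) ℂ :=
  Matrix.of fun p q => Φ (Matrix.of fun i j => X (i, p.2) (j, q.2)) p.1 q.1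

/-- Diamond norm `‖Φ‖⋄ = sup_k sup_{‖X‖₁ ≤ 1} ‖(Φ ⊗ id_k)(X)‖₁`. -/
def diamondNorm {ι κ : Type*} [Fintype ι] [DecidableEq ι] [Fintype κ] [DecidableEq κ]
    (Φ : Matrix ι ι ℂ →ₗ[ℂ] Matrix κ κ ℂ) : ENNReal :=
  ⨆ (k : ℕ) (X : Matrix (ι × Fin k) (ι × Fin k) ℂ) (_ : traceNorm X ≤ 1),
    ENNReal.ofReal (traceNorm (ampliation Φ k X))

end LinearAlgebra

/-! ### Pauli matrices and the observable `L` -/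

inductive Pauli
  | X
  | Y
  | Z
  deriving DecidableEq

instance : Fintype Pauli := ⟨{.X, .Y, .Z}, by intro P; cases P <;> simp⟩

/-- The Pauli matrices `σ_x`, `σ_y`, `σ_z`. -/
def Pauli.mat : Pauli → Matrix (Fin 2) (Fin 2) ℂ
  | .X => !![0, 1; 1, 0]
  | .Y => !![0, -Complex.I; Complex.I, 0]
  | .Z => !![1, 0; 0, -1]

/-- The element `(1 + (-1)^b O) / 2` of the binary measurement of an observable `O`. -/
def binElem (O : Matrix (Fin 2) (Fin 2) ℂ) (b : Fin 2) : Matrix (Fin 2) (Fin 2) ℂ :=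
  (1 / 2 : ℂ) • (1 + (-1 : ℂ) ^ b.val • O)

/-- `L = E_{P ← 𝒟} [∑_b ω(b|P) ⊗_l (1 + (-1)^{b_l} P_l)/2]`. -/
def obsL {n : ℕ} (𝒟 : (Fin n → Pauli) → ℝ) (ω : (Fin n → Fin 2) → (Fin n → Pauli) → ℝ) :
    Matrix (Fin n → Fin 2) (Fin n → Fin 2) ℂ :=
  ∑ P, (𝒟 P : ℂ) • ∑ b, (ω b P : ℂ) • tensorMat fun l => binElem (P l).mat (b l)

/-- The teleportation correction `U_a = X^{a₀} Z^{a₁}`. -/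
def corrU (a : Fin 2 × Fin 2) : Matrix (Fin 2) (Fin 2) ℂ :=
  Pauli.X.mat ^ a.1.val * Pauli.Z.mat ^ a.2.val

open Classical in
/-- The corrected outcome `f(b|P,a)`: `b` is flipped iff `P` and `U_a` anticommute. -/
def corrOut (b : Fin 2) (P : Pauli) (a : Fin 2 × Fin 2) : Fin 2 :=
  b + if P.mat * corrU a + corrU a * P.mat = 0 then 1 else 0

/-! ### Settings, outcomes and links -/

/-- The inputs of a main party: `0, …, 5`, `▷`, `◁` and `⋄`. -/
inductive ASetting
  | chsh (i : Fin 6)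
  | right
  | left
  | tele
  deriving DecidableEq, Fintype

/-- Outcomes of a main party for each input. -/
abbrev ASetting.Out : ASetting → Type
  | .chsh _ => Fin 2
  | .right => Fin 2 × Fin 2
  | .left => Fin 2 × Fin 2
  | .tele => Fin 2 × Fin 2

instance : ∀ x : ASetting, Fintype x.Out
  | .chsh _ => inferInstanceAs (Fintype (Fin 2))
  | .right => inferInstanceAs (Fintype (Fin 2 × Fin 2))
  | .left => inferInstanceAs (Fintype (Fin 2 × Fin 2))
  | .tele => inferInstanceAs (Fintype (Fin 2 × Fin 2))

instance : ∀ x : ASetting, DecidableEq x.Out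
  | .chsh _ => inferInstanceAs (DecidableEq (Fin 2))
  | .right => inferInstanceAs (DecidableEq (Fin 2 × Fin 2))
  | .left => inferInstanceAs (DecidableEq (Fin 2 × Fin 2))
  | .tele => inferInstanceAs (DecidableEq (Fin 2 × Fin 2))

/-- Outcomes of a main party; `none` stands for a party that is not asked to measure in a
round and then has a single trivial outcome. -/
abbrev AOut : Option ASetting → Type
  | none => Unit
  | some x => x.Out

instance : ∀ x : Option ASetting, Fintype (AOut x)
  | none => inferInstanceAs (Fintype Unit)
  | some x => inferInstanceAs (Fintype x.Out)

/-- Outcomes of an auxiliary party; its inputs `0, 1, 2` are identified with `X, Y, Z`. -/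
abbrev BOut : Option Pauli → Type
  | none => Unit
  | some _ => Fin 2

instance : ∀ y : Option Pauli, Fintype (BOut y)
  | none => inferInstanceAs (Fintype Unit)
  | some _ => inferInstanceAs (Fintype (Fin 2))

/-- The sign `(-1)^a` of a binary outcome of a main party (used for CHSH inputs only). -/
def signA : ∀ x : Option ASetting, AOut x → ℝ
  | some (.chsh _), a => (-1) ^ (show Fin 2 from a).val
  | some .right, _ => 1
  | some .left, _ => 1
  | some .tele, _ => 1
  | none, _ => 1

/-- The two-bit outcome of a main party (used for the inputs `▷`, `◁`, `⋄` only). -/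
def pairA : ∀ x : Option ASetting, AOut x → Fin 2 × Fin 2
  | some .right, a => a
  | some .left, a => a
  | some .tele, a => a
  | some (.chsh _), _ => (0, 0)
  | none, _ => (0, 0)

/-- The outcome bit of an auxiliary party (used only when it measures). -/
def bitB : ∀ y : Option Pauli, BOut y → Fin 2
  | some _, b => b
  | none, _ => 0

/-- The links `(l, l+1)` between neighbouring main parties. -/
abbrev Link (n : ℕ) : Type := {l : Fin n // l.val + 1 < n}

def Link.next {n : ℕ} (e : Link n) : Fin n := ⟨e.1.val + 1, e.2⟩

/-- The CHSH inputs `x(i,k)` of the main parties. -/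
def chshX (i : Fin 2) (k : Fin 3) : Fin 6 :=
  (![![0, 1], ![3, 2], ![5, 4]] : Fin 3 → Fin 2 → Fin 6) k i

/-- The CHSH inputs `y(j,k)` of the auxiliary parties. -/
def chshY (j : Fin 2) (k : Fin 3) : Pauli :=
  (![![.X, .Z], ![.X, .Y], ![.Z, .Y]] : Fin 3 → Fin 2 → Pauli) k j

/-! ### The reference experiment -/

/-- Names of the qubits of a main party: `T`, `S`, `R^▷` and `R^◁`. -/
inductive Reg
  | T
  | S
  | Rright
  | Rleft
  deriving DecidableEq

instance : Fintype Reg := ⟨{.T, .S, .Rright, .Rleft}, by intro r; cases r <;> simp⟩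

/-- The last party has no `R^▷` and the first party has no `R^◁`. -/
def Reg.Present {n : ℕ} (l : Fin n) : Reg → Prop
  | .T => True
  | .S => True
  | .Rright => l.val + 1 < n
  | .Rleft => 0 < l.val

instance {n : ℕ} (l : Fin n) : DecidablePred (Reg.Present l)
  | .T => inferInstanceAs (Decidable True)
  | .S => inferInstanceAs (Decidable True)
  | .Rright => inferInstanceAs (Decidable (l.val + 1 < n))
  | .Rleft => inferInstanceAs (Decidable (0 < l.val))

abbrev Regs {n : ℕ} (l : Fin n) : Type := {r : Reg // Reg.Present l r}

def regT {n : ℕ} (l : Fin n) : Regs l := ⟨.T, trivial⟩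

def regS {n : ℕ} (l : Fin n) : Regs l := ⟨.S, trivial⟩

/-- Computational basis of the qubits of main party `A_l` in the reference experiment. -/
abbrev RefA {n : ℕ} (l : Fin n) : Type := Regs l → Fin 2

/-- Computational basis of the whole reference experiment; each `B_l` is one qubit. -/
abbrev RefIdx (n : ℕ) : Type := (∀ l : Fin n, RefA l) × (Fin n → Fin 2)

/-- A one-qubit operator acting on register `r`. -/
def onReg {R : Type*} [Fintype R] [DecidableEq R] (r : R) (U : Matrix (Fin 2) (Fin 2) ℂ) :
    Matrix (R → Fin 2) (R → Fin 2) ℂ :=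
  Matrix.of fun i j => if ∀ q, q ≠ r → i q = j q then U (i r) (j r) else 0

/-- A two-qubit operator acting on registers `r`, `s`. -/
def onRegs {R : Type*} [Fintype R] [DecidableEq R] (r s : R)
    (U : Matrix (Fin 2 × Fin 2) (Fin 2 × Fin 2) ℂ) : Matrix (R → Fin 2) (R → Fin 2) ℂ :=
  Matrix.of fun i j =>
    if ∀ q, q ≠ r → q ≠ s → i q = j q then U (i r, i s) (j r, j s) else 0

/-- Amplitudes of the Bell state `(|00⟩ + |11⟩)/√2`. -/
def bell (a b : Fin 2) : ℂ := if a = b then ((Real.sqrt 2)⁻¹ : ℝ) else 0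

/-- The Bell projector onto `(U_a ⊗ 1)|φ⁺⟩`. -/
def bellProj (a : Fin 2 × Fin 2) : Matrix (Fin 2 × Fin 2) (Fin 2 × Fin 2) ℂ :=
  let v : Fin 2 × Fin 2 → ℂ := fun p => ∑ k, corrU a p.1 k * bell k p.2
  Matrix.vecMulVec v (star v)

/-- The reference observables for the inputs `0, …, 5`. -/
def chshObs (x : Fin 6) : Matrix (Fin 2) (Fin 2) ℂ :=
  let PQ : Pauli × Pauli :=
    (![(.X, .Z), (.X, .Z), (.X, .Y), (.X, .Y), (.Z, .Y), (.Z, .Y)] : Fin 6 → Pauli × Pauli) x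
  ((Real.sqrt 2)⁻¹ : ℂ) • (PQ.1.mat + (-1 : ℂ) ^ x.val • PQ.2.mat)

/-- The inputs for which party `A_l` has a reference measurement: `▷` (`◁`) requires the
register `R^▷` (`R^◁`). -/
def Relevant {n : ℕ} (l : Fin n) : ASetting → Prop
  | .chsh _ => True
  | .right => l.val + 1 < n
  | .left => 0 < l.val
  | .tele => True

/-- The reference measurements of the main parties: CHSH observables on `S`, and Bell state
measurements on `R^▷ S`, `R^◁ S`, `T S`. -/
def refMeasA {n : ℕ} (l : Fin n) :
    ∀ x : ASetting, Relevant l x → x.Out → Matrix (RefA l) (RefA l) ℂ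
  | .chsh i, _, a => onReg (regS l) (binElem (chshObs i) a)
  | .right, h, a => onRegs (⟨.Rright, h⟩ : Regs l) (regS l) (bellProj a)
  | .left, h, a => onRegs (⟨.Rleft, h⟩ : Regs l) (regS l) (bellProj a)
  | .tele, _, a => onRegs (regT l) (regS l) (bellProj a)

/-- The reference measurements of the auxiliary parties: Pauli measurements. -/
def refMeasB (y : Pauli) (b : Fin 2) : Matrix (Fin 2) (Fin 2) ℂ := binElem y.mat b

/-- Amplitudes of `Φ⁺`: Bell states on `S_l B_l` for all `l` and on `R_l^▷ R_{l+1}^◁` for all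
links. -/
def bellVec {n : ℕ} (i : RefIdx n) : ℂ :=
  (∏ l, bell (i.1 l (regS l)) (i.2 l)) *
    ∏ e : Link n, bell (i.1 e.1 (⟨.Rright, e.2⟩ : Regs e.1))
      (i.1 e.next (⟨.Rleft, Nat.succ_pos _⟩ : Regs e.next))

/-- The reference state `τ_T ⊗ Φ⁺`. -/
def refState {n : ℕ} (τ : Matrix (Fin n → Fin 2) (Fin n → Fin 2) ℂ) :
    Matrix (RefIdx n) (RefIdx n) ℂ :=
  Matrix.of fun i j =>
    τ (fun l => i.1 l (regT l)) (fun l => j.1 l (regT l)) * (bellVec i * star (bellVec j))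

/-! ### The physical experiment and its imperfections -/

section Physical

variable {n : ℕ} (HA HB : Fin n → Type) [∀ l, Fintype (HA l)] [∀ l, DecidableEq (HA l)]
  [∀ l, Fintype (HB l)] [∀ l, DecidableEq (HB l)]

/-- Computational basis of the physical experiment. -/
abbrev PhysIdx : Type := (∀ l, HA l) × (∀ l, HB l)

/-- A physical experiment: a state on `⊗_l ℂ^(HA l) ⊗ ⊗_l ℂ^(HB l)` and local POVMs. -/
structure Experiment where
  ρ : QState (PhysIdx HA HB)
  M : ∀ (l : Fin n) (x : ASetting), POVM x.Out (HA l)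
  N : ∀ (l : Fin n) (_ : Pauli), POVM (Fin 2) (HB l)

/-- An embedding of the reference experiment into the physical Hilbert space: local isometries,
and ideal measurements on the physical spaces that extend the reference measurements
block-diagonally. -/
structure Embedding where
  VA : ∀ l, Matrix (HA l) (RefA l) ℂ
  VB : ∀ l, Matrix (HB l) (Fin 2) ℂ
  VA_isometry : ∀ l, (VA l)ᴴ * VA l = 1
  VB_isometry : ∀ l, (VB l)ᴴ * VB l = 1
  M : ∀ (l : Fin n) (x : ASetting), Relevant l x → POVM x.Out (HA l)
  N : ∀ (l : Fin n) (_ : Pauli), POVM (Fin 2) (HB l)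
  M_extends : ∀ l x (h : Relevant l x) a, (M l x h).elem a * VA l = VA l * refMeasA l x h a
  N_extends : ∀ l y b, (N l y).elem b * VB l = VB l * refMeasB y b

variable {HA HB}

/-- The embedded reference state `τ_T ⊗ Φ⁺`. -/
def Embedding.state (R : Embedding HA HB) (τ : QState (Fin n → Fin 2)) :
    Matrix (PhysIdx HA HB) (PhysIdx HA HB) ℂ :=
  (tensorMat R.VA ⊗ₖ tensorMat R.VB) * refState τ.1 * (tensorMat R.VA ⊗ₖ tensorMat R.VB)ᴴ

/-- The state imperfection `ε_S = min_τ D(ρ, τ_T ⊗ Φ⁺)`. -/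
def stateError (E : Experiment HA HB) (R : Embedding HA HB) : ℝ :=
  ⨅ τ : QState (Fin n → Fin 2), traceDist E.ρ.1 (R.state τ)

/-- The measurement imperfection `ε_M`: the largest diamond distance between an implemented
measurement channel and its ideal counterpart. -/
def measError (E : Experiment HA HB) (R : Embedding HA HB) : ENNReal :=
  max
    (⨆ (l : Fin n) (x : ASetting) (h : Relevant l x),
      diamondNorm (measChannel (E.M l x).elem - measChannel (R.M l x h).elem))
    (⨆ (l : Fin n) (y : Pauli),
      diamondNorm (measChannel (E.N l y).elem - measChannel (R.N l y).elem))

/-- The measurement operators of a main party, trivial if it does not measure. -/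
def Experiment.elemA (E : Experiment HA HB) (l : Fin n) :
    ∀ x : Option ASetting, AOut x → Matrix (HA l) (HA l) ℂ
  | some x, a => (E.M l x).elem a
  | none, _ => 1

/-- The measurement operators of an auxiliary party, trivial if it does not measure. -/
def Experiment.elemB (E : Experiment HA HB) (l : Fin n) :
    ∀ y : Option Pauli, BOut y → Matrix (HB l) (HB l) ℂ
  | some y, b => (E.N l y).elem b
  | none, _ => 1

end Physical

/-! ### One round, and repeated rounds -/

/-- The settings of all parties in one round. -/
abbrev Settings (n : ℕ) : Type := (Fin n → Option ASetting) × (Fin n → Option Pauli)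

/-- The outcomes of all parties in one round. -/
abbrev Outcomes {n : ℕ} (s : Settings n) : Type := (∀ l, AOut (s.1 l)) × (∀ l, BOut (s.2 l))

/-- The record of a round: settings, outcomes, and for each link the result of the acceptance
coin of the rejection sampling. -/
abbrev Round (n : ℕ) : Type := Σ s : Settings n, Outcomes s × (Link n → Bool)

/-- Born's rule: the probability of the outcomes given the settings. -/
def Experiment.born {n : ℕ} {HA HB : Fin n → Type} [∀ l, Fintype (HA l)]
    [∀ l, DecidableEq (HA l)] [∀ l, Fintype (HB l)] [∀ l, DecidableEq (HB l)]
    (E : Experiment HA HB) (s : Settings n) (o : Outcomes s) : ℝ :=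
  ((((tensorMat fun l => E.elemA l (s.1 l) (o.1 l)) ⊗ₖ
      (tensorMat fun l => E.elemB l (s.2 l) (o.2 l))) * E.ρ.1).trace).re

/-- How a protocol chooses settings, and with which probability it accepts a round for the
estimation of `v_II` on a link. -/
structure Sampling (n : ℕ) where
  settingProb : Settings n → ℝ
  accept : Settings n → Link n → ℝ

/-- The probability of the record of a round. -/
def roundProb {n : ℕ} {HA HB : Fin n → Type} [∀ l, Fintype (HA l)]
    [∀ l, DecidableEq (HA l)] [∀ l, Fintype (HB l)] [∀ l, DecidableEq (HB l)]
    (Q : Sampling n) (E : Experiment HA HB) (r : Round n) : ℝ :=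
  Q.settingProb r.1 * E.born r.1 r.2.1 *
    ∏ e : Link n, if r.2.2 e then Q.accept r.1 e else 1 - Q.accept r.1 e

/-- The probability of an event of the transcript of `N` i.i.d. rounds. -/
def protProb {n : ℕ} {HA HB : Fin n → Type} [∀ l, Fintype (HA l)]
    [∀ l, DecidableEq (HA l)] [∀ l, Fintype (HB l)] [∀ l, DecidableEq (HB l)]
    (Q : Sampling n) (E : Experiment HA HB) (N : ℕ) (ev : Set (Fin N → Round n)) : ℝ :=
  ∑ t : Fin N → Round n, ev.indicator (fun t => ∏ m, roundProb Q E (t m)) t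

/-! ### The two protocols -/

/-- Local randomness, setting of a main party: `⋄` with probability `1 - 1/n`, each other input
with probability `1/(8n)`. -/
def localProbA (n : ℕ) : Option ASetting → ℝ
  | some .tele => 1 - 1 / n
  | some .right => 1 / (8 * n)
  | some .left => 1 / (8 * n)
  | some (.chsh _) => 1 / (8 * n)
  | none => 0

/-- Local randomness, setting of an auxiliary party: `P` with probability `p P`. -/
def localProbB (p : Pauli → ℝ) : Option Pauli → ℝ
  | some P => p P
  | none => 0

/-- The product distribution `𝒟 = ⊗_l 𝒟^(l)`. -/
def prodDist {n : ℕ} (p : Fin n → Pauli → ℝ) (P : Fin n → Pauli) : ℝ := ∏ l, p l (P l)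

/-- The smallest of the numbers `p_Q^(l) p_Q^(l+1)`, `Q ∈ {X, Y, Z}`. -/
def minPair {n : ℕ} (p : Fin n → Pauli → ℝ) (e : Link n) : ℝ :=
  ⨅ Q : Pauli, p e.1 Q * p e.next Q

/-- Sampling with local randomness. The acceptance probability matters only in rounds with
`y_l = y_{l+1}`. -/
def localSampling {n : ℕ} (p : Fin n → Pauli → ℝ) : Sampling n where
  settingProb s := (∏ l, localProbA n (s.1 l)) * ∏ l, localProbB (p l) (s.2 l)
  accept s e :=
    match s.2 e.1 with
    | some P => minPair p e / (p e.1 P * p e.next P)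
    | none => 1

/-- Shared randomness, test type I: each pair `(A_l, B_l)` gets uniformly random CHSH inputs. -/
def sharedProbI {n : ℕ} (s : Settings n) : ℝ :=
  ∏ l, ∑ k : Fin 3, ∑ i : Fin 2, ∑ j : Fin 2,
    if s.1 l = some (.chsh (chshX i k)) ∧ s.2 l = some (chshY j k) then (1 / 12 : ℝ) else 0

/-- Shared randomness, test type II with parity `par` and Pauli `P`: for each link `(l, l+1)`
with `l ≡ par mod 2`, party `A_l` gets `▷`, party `A_{l+1}` gets `◁`, and `B_l`, `B_{l+1}` get
`P`. Parties on no such link do not measure. -/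
def linkSettings {n : ℕ} (par : Fin 2) (P : Pauli) : Settings n :=
  (fun l =>
      if l.val % 2 = par.val ∧ l.val + 1 < n then some .right
      else if l.val % 2 ≠ par.val ∧ 0 < l.val then some .left
      else none,
    fun l =>
      if (l.val % 2 = par.val ∧ l.val + 1 < n) ∨ (l.val % 2 ≠ par.val ∧ 0 < l.val) then some P
      else none)

/-- Shared randomness, test type II: parity and Pauli are uniformly random. -/
def sharedProbII {n : ℕ} (s : Settings n) : ℝ :=
  ∑ par : Fin 2, ∑ P : Pauli, if s = linkSettings par P then (1 / 6 : ℝ) else 0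

/-- Shared randomness, test type III: all main parties get `⋄`, the auxiliary parties get
`P ← 𝒟`. -/
def sharedProbIII {n : ℕ} (𝒟 : (Fin n → Pauli) → ℝ) (s : Settings n) : ℝ :=
  ∑ P : Fin n → Pauli,
    if s = ((fun _ => some .tele), fun l => some (P l)) then 𝒟 P else 0

/-- Sampling with shared randomness: a uniformly random test type, no rejection sampling. -/
def sharedSampling {n : ℕ} (𝒟 : (Fin n → Pauli) → ℝ) : Sampling n where
  settingProb s := (sharedProbI s + sharedProbII s + sharedProbIII 𝒟 s) / 3
  accept _ _ := 1

section Estimators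

variable {n N : ℕ} (t : Fin N → Round n)

/-- The round uses the CHSH inputs `x(i,k)`, `y(j,k)` at `l`. -/
def hitI (l : Fin n) (k : Fin 3) (i j : Fin 2) (r : Round n) : Prop :=
  r.1.1 l = some (.chsh (chshX i k)) ∧ r.1.2 l = some (chshY j k)

/-- The round uses `▷`, `◁` and the common Pauli input `P` on the link, and is accepted. -/
def hitII (e : Link n) (P : Pauli) (r : Round n) : Prop :=
  r.1.1 e.1 = some .right ∧ r.1.1 e.next = some .left ∧
    r.1.2 e.1 = some P ∧ r.1.2 e.next = some P ∧ r.2.2 e = true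

/-- The round uses `⋄` everywhere and Pauli inputs `P`. -/
def hitIII (P : Fin n → Pauli) (r : Round n) : Prop :=
  (∀ l, r.1.1 l = some .tele) ∧ ∀ l, r.1.2 l = some (P l)

/-- The corrected outcome at `l` for the Pauli input `P`. -/
def corrAt (l : Fin n) (P : Pauli) (r : Round n) : Fin 2 :=
  corrOut (bitB (r.1.2 l) (r.2.1.2 l)) P (pairA (r.1.1 l) (r.2.1.1 l))

open Classical in
def countI (l : Fin n) (k : Fin 3) (i j : Fin 2) : ℝ :=
  ∑ m, if hitI l k i j (t m) then 1 else 0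

open Classical in
def sumI (l : Fin n) (k : Fin 3) (i j : Fin 2) : ℝ :=
  ∑ m, if hitI l k i j (t m) then
    signA ((t m).1.1 l) ((t m).2.1.1 l) * (-1) ^ (bitB ((t m).1.2 l) ((t m).2.1.2 l)).val else 0

open Classical in
def countII (e : Link n) : ℝ :=
  ∑ m, ∑ P : Pauli, if hitII e P (t m) then 1 else 0

open Classical in
def sumII (e : Link n) : ℝ :=
  ∑ m, ∑ P : Pauli, if hitII e P (t m) then
    -((if P = .Y then -1 else 1) *
      (-1) ^ ((corrAt e.1 P (t m)).val + (corrAt e.next P (t m)).val)) else 0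

open Classical in
def countIII : ℝ :=
  ∑ m, ∑ P : Fin n → Pauli, if hitIII P (t m) then 1 else 0

open Classical in
def sumIII (ω : (Fin n → Fin 2) → (Fin n → Pauli) → ℝ) : ℝ :=
  ∑ m, ∑ P : Fin n → Pauli, if hitIII P (t m) then
    ω (fun l => corrAt l (P l) (t m)) P else 0

/-- `v̂_I = 2√2 - (1/3n) ∑_{l,k} ∑_{i,j} (-1)^{ij} Ĉ_{ij}(l,k)`; here and below a ratio with
denominator zero is zero, as the protocols prescribe. -/
def estI : ℝ :=
  2 * Real.sqrt 2 - 1 / (3 * n) * ∑ l : Fin n, ∑ k : Fin 3, ∑ i : Fin 2, ∑ j : Fin 2,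
    (-1) ^ (i.val * j.val) * (sumI t l k i j / countI t l k i j)

/-- `v̂_II = 1 + (1/(n-1)) ∑_l e_II(l,l+1) / n_II(l,l+1)`. -/
def estII : ℝ :=
  1 + 1 / ((n : ℝ) - 1) * ∑ e : Link n, sumII t e / countII t e

/-- `v̂_III = e_III / n_III`. -/
def estIII (ω : (Fin n → Fin 2) → (Fin n → Pauli) → ℝ) : ℝ := sumIII t ω / countIII t

/-- The output of a protocol. -/
inductive Verdict
  | failed
  | certified (v : ℝ)

open Classical in
/-- The certification check and the output of the protocols. -/
def output (ω : (Fin n → Fin 2) → (Fin n → Pauli) → ℝ) (W ε : ℝ) : Verdict :=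
  if estI t > ε ^ 2 / (n ^ 2 * W ^ 2) ∨ estII t > ε / (n * W) then .failed
  else .certified (estIII t ω)

end Estimators

/-- The successful transcripts: the output is `CERTIFIED` with a value `v̂_III` such that
`|v̂_III - tr(L τ̃)| ≤ C (ε + W D(ρ, τ̃_T ⊗ Φ⁺))` for every `n`-qubit state `τ̃`. -/
def goodEvent {n : ℕ} {HA HB : Fin n → Type} [∀ l, Fintype (HA l)]
    [∀ l, DecidableEq (HA l)] [∀ l, Fintype (HB l)] [∀ l, DecidableEq (HB l)]
    (E : Experiment HA HB) (R : Embedding HA HB) (𝒟 : (Fin n → Pauli) → ℝ)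
    (ω : (Fin n → Fin 2) → (Fin n → Pauli) → ℝ) (W ε C : ℝ) (N : ℕ) :
    Set (Fin N → Round n) :=
  {t | ∃ v : ℝ, output t ω W ε = .certified v ∧
    ∀ τ : QState (Fin n → Fin 2),
      ‖(v : ℂ) - (obsL 𝒟 ω * τ.1).trace‖ ≤ C * (ε + W * traceDist E.ρ.1 (R.state τ))}

end

end DISelfTest

open DISelfTest

/-!
An honest implementation passes the self-test because each of the three estimates is an empirical
mean whose expectation is close to its value in the reference experiment.

*Reference values.* Every reference measurement, with its outcomes suitably weighted by signs, is a
product of one-qubit operators, and the expectation value of such a product in `τ_T ⊗ Φ⁺` factorizes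
over the Bell pairs (`trace_product_mul_refState`). Each signed CHSH correlator equals `1 / √2`
(`chsh_reference_value`). The Pauli-corrected outcomes of a Bell measurement realize `P ⊗ Pᵀ`, so
that on a link the corrected correlation is the stabilizer value of `P ⊗ P` on `φ⁺`, which is `1`
for `X`, `Z` and `-1` for `Y` (`link_reference_value`). Measurements of all `T_l S_l` teleport `τ_T` to
the auxiliary parties up to Pauli corrections, so that the corrected outcomes have the distribution
of a Pauli measurement on `τ_T` (`tele_reference_value`).

*Robustness.* A bound on the diamond norm distance of two measurement channels gives an operator
inequality (`posSemidef_of_diamondNorm_le`). A hybrid argument then replaces the measurements one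
party at a time (`sum_abs_tensor_sub_le`), at a cost of one `measError` for each party whose outcome
matters: two parties for a CHSH correlator, four for a link, and `2 n` for the third test. Replacing
the state costs twice the trace distance, by duality of the trace norm
(`abs_born_sub_reference_le`).
For the first two tests a nearly optimal `τ_T` is used. For the third test any `τ̃_T` can be used:
its mean does not depend on `τ̃_T`, so one concentration bound serves all `τ̃_T` simultaneously.

*Concentration.* An empirical ratio with a random denominator is controlled by applying Chernoff's
method to `a u - w`, where `u` indicates the rounds that count and `w` is their value
(`iidProb_ratio_le`); this needs no separate bound on the number of rounds that count, and
it excludes the value zero that a ratio takes if there are none. A union bound over the `12 n` CHSH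
correlators, the `n - 1` links and the two tails of the third test gives `one_sub_le_protProb`. What
remains is to bound from below the probability that a round counts (`samplingSpec_shared`,
`samplingSpec_local`). In the shared protocol `ε` is not bounded, but for `ε ≥ 3 n W` every
transcript satisfies the claim (`mem_goodEvent_of_large`).
-/


open DISelfTest

namespace DISelfTest

noncomputable section

/-! ### Positive semidefinite matrices, contractions and the trace norm -/

section TraceNorm

variable {ι κ O : Type*} [Fintype ι] [DecidableEq ι] [Fintype κ] [DecidableEq κ] [Fintype O]

/-- Euclidean norm of a complex vector. -/
def l2norm (v : ι → ℂ) : ℝ := ‖WithLp.toLp 2 v‖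

omit [DecidableEq ι] in
lemma l2norm_nonneg (v : ι → ℂ) : 0 ≤ l2norm v := norm_nonneg _

omit [DecidableEq ι] in
lemma norm_star_dotProduct_le (u v : ι → ℂ) : ‖star u ⬝ᵥ v‖ ≤ l2norm u * l2norm v := by
  have := norm_inner_le_norm (𝕜 := ℂ) (WithLp.toLp 2 u) (WithLp.toLp 2 v)
  rwa [EuclideanSpace.inner_toLp_toLp, dotProduct_comm] at this

omit [DecidableEq ι] in
lemma star_dotProduct_self (v : ι → ℂ) : star v ⬝ᵥ v = ((l2norm v ^ 2 : ℝ) : ℂ) := by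
  have := inner_self_eq_norm_sq_to_K (𝕜 := ℂ) (WithLp.toLp 2 v)
  rw [EuclideanSpace.inner_toLp_toLp, dotProduct_comm] at this
  simpa [l2norm] using this

open scoped MatrixOrder in
lemma exists_eq_conjTranspose_mul_self {A : Matrix ι ι ℂ} (hA : A.PosSemidef) :
    ∃ B : Matrix ι ι ℂ, A = Bᴴ * B := by
  obtain ⟨a, rfl⟩ := CStarAlgebra.nonneg_iff_eq_star_mul_self.mp hA.nonneg
  exact ⟨a, rfl⟩

omit [DecidableEq ι] [DecidableEq κ] in
lemma star_dotProduct_conjTranspose_mul (B : Matrix κ ι ℂ) (u v : ι → ℂ) :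
    star u ⬝ᵥ ((Bᴴ * B) *ᵥ v) = star (B *ᵥ u) ⬝ᵥ (B *ᵥ v) := by
  rw [← Matrix.mulVec_mulVec, Matrix.dotProduct_mulVec, Matrix.star_mulVec]

/-- A finite family of matrices that is a POVM. -/
def IsPOVM (M : O → Matrix ι ι ℂ) : Prop := (∀ o, (M o).PosSemidef) ∧ ∑ o, M o = 1

lemma POVM.isPOVM (M : POVM O ι) : IsPOVM M.elem := ⟨M.posSemidef, M.sum_eq_one⟩

/-- A combination of POVM elements with coefficients in `[-1, 1]` is a contraction: this is the
Cauchy-Schwarz inequality for the forms of the POVM elements, summed over the outcomes. -/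
lemma IsPOVM.norm_form_le {M : O → Matrix ι ι ℂ} (hM : IsPOVM M) {g : O → ℝ}
    (hg : ∀ o, |g o| ≤ 1) (u v : ι → ℂ) :
    ‖star u ⬝ᵥ ((∑ o, (g o : ℂ) • M o) *ᵥ v)‖ ≤ l2norm u * l2norm v := by
  choose B hB using fun o => exists_eq_conjTranspose_mul_self (hM.1 o)
  have hsq : ∀ w : ι → ℂ, ∑ o, l2norm (B o *ᵥ w) ^ 2 = l2norm w ^ 2 := by
    intro w
    have h1 : star w ⬝ᵥ ((∑ o, M o) *ᵥ w) = star w ⬝ᵥ w := by rw [hM.2, Matrix.one_mulVec]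
    rw [Matrix.sum_mulVec, dotProduct_sum, star_dotProduct_self] at h1
    simp_rw [hB, star_dotProduct_conjTranspose_mul, star_dotProduct_self] at h1
    exact_mod_cast h1
  have h2 : star u ⬝ᵥ ((∑ o, (g o : ℂ) • M o) *ᵥ v)
      = ∑ o, (g o : ℂ) * (star (B o *ᵥ u) ⬝ᵥ (B o *ᵥ v)) := by
    rw [Matrix.sum_mulVec, dotProduct_sum]
    refine Finset.sum_congr rfl fun o _ => ?_
    rw [Matrix.smul_mulVec, dotProduct_smul, smul_eq_mul, hB, star_dotProduct_conjTranspose_mul]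
  rw [h2]
  calc _ ≤ ∑ o, l2norm (B o *ᵥ u) * l2norm (B o *ᵥ v) := by
        refine (norm_sum_le _ _).trans (Finset.sum_le_sum fun o _ => ?_)
        rw [norm_mul, Complex.norm_real, Real.norm_eq_abs]
        exact (mul_le_of_le_one_left (norm_nonneg _) (hg o)).trans (norm_star_dotProduct_le _ _)
    _ ≤ _ := Real.sum_mul_le_sqrt_mul_sqrt _ _ _
    _ = _ := by
        rw [hsq, hsq, Real.sqrt_sq (l2norm_nonneg _), Real.sqrt_sq (l2norm_nonneg _)]

/-- The trace in the eigenbasis of a Hermitian matrix. -/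
lemma trace_eq_sum_eigenvectorBasis {H : Matrix ι ι ℂ} (hH : H.IsHermitian) (C : Matrix ι ι ℂ) :
    C.trace = ∑ i, star (hH.eigenvectorBasis i : ι → ℂ) ⬝ᵥ (C *ᵥ (hH.eigenvectorBasis i)) := by
  let U : Matrix ι ι ℂ := hH.eigenvectorUnitary
  have hU : U * Uᴴ = 1 := Unitary.coe_mul_star_self hH.eigenvectorUnitary
  have h1 : C.trace = (Uᴴ * C * U).trace := by
    rw [Matrix.trace_mul_cycle, hU, Matrix.one_mul]
  rw [h1, Matrix.trace]
  refine Finset.sum_congr rfl fun i _ => ?_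
  simp only [Matrix.diag_apply, Matrix.mul_assoc, Matrix.mul_apply', dotProduct, Pi.star_apply]
  simp [U, Matrix.mulVec, dotProduct]

lemma l2norm_eigenvectorBasis {H : Matrix ι ι ℂ} (hH : H.IsHermitian) (i : ι) :
    l2norm (hH.eigenvectorBasis i : ι → ℂ) = 1 := hH.eigenvectorBasis.orthonormal.1 i

omit [DecidableEq ι] in
lemma l2norm_mulVec_eigenvectorBasis (A : Matrix ι κ ℂ) (i : κ) :
    l2norm (A *ᵥ ((Matrix.isHermitian_conjTranspose_mul_self A).eigenvectorBasis i : κ → ℂ)) =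
      Real.sqrt ((Matrix.isHermitian_conjTranspose_mul_self A).eigenvalues i) := by
  set hH := Matrix.isHermitian_conjTranspose_mul_self A
  have h1 := star_dotProduct_conjTranspose_mul A (hH.eigenvectorBasis i : κ → ℂ)
    (hH.eigenvectorBasis i : κ → ℂ)
  rw [hH.mulVec_eigenvectorBasis, dotProduct_smul, star_dotProduct_self, star_dotProduct_self,
    l2norm_eigenvectorBasis] at h1
  have h2 : hH.eigenvalues i
      = l2norm (A *ᵥ (hH.eigenvectorBasis i : κ → ℂ)) ^ 2 := by
    have : ((hH.eigenvalues i : ℝ) : ℂ)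
        = ((l2norm (A *ᵥ (hH.eigenvectorBasis i : κ → ℂ)) ^ 2 : ℝ) : ℂ) := by
      rw [← h1]; simp
    exact_mod_cast this
  rw [h2, Real.sqrt_sq (l2norm_nonneg _)]

omit [DecidableEq ι] in
/-- Duality between the trace norm and contractions. -/
lemma norm_trace_mul_le_traceNorm {B : Matrix κ ι ℂ} (A : Matrix ι κ ℂ)
    (hB : ∀ u v, ‖star u ⬝ᵥ (B *ᵥ v)‖ ≤ l2norm u * l2norm v) :
    ‖(B * A).trace‖ ≤ traceNorm A := by
  rw [trace_eq_sum_eigenvectorBasis (Matrix.isHermitian_conjTranspose_mul_self A), traceNorm]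
  refine (norm_sum_le _ _).trans (Finset.sum_le_sum fun i _ => ?_)
  rw [← Matrix.mulVec_mulVec, ← l2norm_mulVec_eigenvectorBasis]
  refine (hB _ _).trans_eq ?_
  rw [l2norm_eigenvectorBasis, one_mul]

/-- For a positive semidefinite matrix the singular values are the eigenvalues. -/
lemma PosSemidef.traceNorm_eq_trace {A : Matrix ι ι ℂ} (hA : A.PosSemidef) :
    (traceNorm A : ℂ) = A.trace := by
  set hH := Matrix.isHermitian_conjTranspose_mul_self A with hHdef
  rw [trace_eq_sum_eigenvectorBasis hH, traceNorm, Complex.ofReal_sum]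
  refine Finset.sum_congr rfl fun i _ => ?_
  set v : ι → ℂ := (hH.eigenvectorBasis i).ofLp with hv
  set s := Real.sqrt (hH.eigenvalues i) with hs
  have hs0 : 0 ≤ s := Real.sqrt_nonneg _
  have hlam : hH.eigenvalues i = s ^ 2 :=
    (Real.sq_sqrt (Matrix.eigenvalues_conjTranspose_mul_self_nonneg A i)).symm
  have hAAv : A *ᵥ (A *ᵥ v) = (s ^ 2 : ℝ) • v := by
    have := hH.mulVec_eigenvectorBasis i
    rw [← Matrix.mulVec_mulVec, hlam, ← hv] at this
    rwa [hA.isHermitian.eq] at this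
  -- `w = A v - s v` satisfies `A w = -s w`, which positivity excludes unless `w = 0`
  set w : ι → ℂ := A *ᵥ v - (s : ℂ) • v with hw
  have hAw : A *ᵥ w = -(s : ℂ) • w := by
    rw [hw, Matrix.mulVec_sub, hAAv, Matrix.mulVec_smul]
    ext j
    simp
    ring
  have hw0 : A *ᵥ v = (s : ℂ) • v := by
    rcases hs0.eq_or_lt with h0 | hpos
    · have h1 : l2norm (A *ᵥ v) = s := l2norm_mulVec_eigenvectorBasis A i
      rw [← h0] at h1 ⊢
      have h2 : A *ᵥ v = 0 := by
        rw [l2norm, norm_eq_zero] at h1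
        exact congrArg WithLp.ofLp h1
      rw [h2]; simp
    · have h1 := hA.dotProduct_mulVec_nonneg w
      rw [hAw, dotProduct_smul, star_dotProduct_self, smul_eq_mul, ← Complex.ofReal_neg,
        ← Complex.ofReal_mul, Complex.zero_le_real] at h1
      have h2 : l2norm w ^ 2 = 0 := by nlinarith [sq_nonneg (l2norm w)]
      have h3 : w = 0 := by
        rw [sq_eq_zero_iff, l2norm, norm_eq_zero] at h2
        exact congrArg WithLp.ofLp h2
      exact sub_eq_zero.mp h3
  rw [hw0, dotProduct_smul, star_dotProduct_self, l2norm_eigenvectorBasis]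
  simp

omit [DecidableEq ι] in
lemma traceNorm_nonneg (A : Matrix ι κ ℂ) : 0 ≤ traceNorm A :=
  Finset.sum_nonneg fun _ _ => Real.sqrt_nonneg _

lemma trace_mul_nonneg {A B : Matrix ι ι ℂ} (hA : A.PosSemidef) (hB : B.PosSemidef) :
    0 ≤ (A * B).trace := by
  obtain ⟨C, rfl⟩ := exists_eq_conjTranspose_mul_self hB
  rw [← Matrix.mul_assoc, Matrix.trace_mul_cycle]
  exact (hA.mul_mul_conjTranspose_same C).trace_nonneg

/-- Two matrices of trace distance `d` give expectation values of a measurement with outcome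
values in `[-1, 1]` that differ by at most `2 d`. -/
lemma IsPOVM.abs_sum_re_trace_sub_le {M : O → Matrix ι ι ℂ} (hM : IsPOVM M) {g : O → ℝ}
    (hg : ∀ o, |g o| ≤ 1) (ρ σ : Matrix ι ι ℂ) :
    |∑ o, g o * (M o * ρ).trace.re - ∑ o, g o * (M o * σ).trace.re| ≤ 2 * traceDist ρ σ := by
  have h := norm_trace_mul_le_traceNorm (ρ - σ) (hM.norm_form_le hg)
  have h2 : ∑ o, g o * (M o * ρ).trace.re - ∑ o, g o * (M o * σ).trace.re
      = ((∑ o, (g o : ℂ) • M o) * (ρ - σ)).trace.re := by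
    rw [Finset.sum_mul, Matrix.trace_sum, Complex.re_sum, ← Finset.sum_sub_distrib]
    refine Finset.sum_congr rfl fun o _ => ?_
    rw [Matrix.smul_mul, Matrix.trace_smul, smul_eq_mul, Complex.re_ofReal_mul, Matrix.mul_sub,
      Matrix.trace_sub, Complex.sub_re, mul_sub]
  rw [h2, traceDist]
  have := (Complex.abs_re_le_norm _).trans h
  linarith

omit [DecidableEq ι] in
lemma l2norm_smul_pi_le {g : ι → ℝ} (hg : ∀ i, |g i| ≤ 1) (v : ι → ℂ) :
    l2norm (fun i => (g i : ℂ) * v i) ≤ l2norm v := by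
  rw [l2norm, l2norm, EuclideanSpace.norm_eq, EuclideanSpace.norm_eq]
  refine Real.sqrt_le_sqrt (Finset.sum_le_sum fun i _ => ?_)
  gcongr
  rw [norm_mul, Complex.norm_real, Real.norm_eq_abs]
  exact mul_le_of_le_one_left (norm_nonneg _) (hg i)

lemma norm_form_diagonal_le {g : ι → ℝ} (hg : ∀ i, |g i| ≤ 1) (u v : ι → ℂ) :
    ‖star u ⬝ᵥ ((Matrix.diagonal fun i => (g i : ℂ)) *ᵥ v)‖ ≤ l2norm u * l2norm v := by
  have h1 : (Matrix.diagonal fun i => (g i : ℂ)) *ᵥ v = fun i => (g i : ℂ) * v i := by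
    ext p; rw [Matrix.mulVec_diagonal]
  rw [h1]
  refine (norm_star_dotProduct_le _ _).trans ?_
  exact mul_le_mul_of_nonneg_left (l2norm_smul_pi_le hg v) (l2norm_nonneg _)

/-- The distribution of the outcomes on a pure state, bounded by the diamond norm. -/
lemma norm_sum_form_le_of_diamondNorm_le [DecidableEq O] {M M' : O → Matrix ι ι ℂ}
    {η : ℝ} (hη : 0 ≤ η)
    (h : diamondNorm (measChannel M - measChannel M') ≤ ENNReal.ofReal η)
    {g : O → ℝ} (hg : ∀ o, |g o| ≤ 1) (w : ι → ℂ) (hw : l2norm w = 1) :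
    ‖star w ⬝ᵥ ((∑ o, (g o : ℂ) • (M o - M' o)) *ᵥ w)‖ ≤ η := by
  -- a one-dimensional ancilla suffices
  let X : Matrix (ι × Fin 1) (ι × Fin 1) ℂ := Matrix.vecMulVec (fun p => w p.1)
    (star fun p => w p.1)
  have hXtr : X.trace = 1 := by
    have : star w ⬝ᵥ w = 1 := by rw [star_dotProduct_self, hw]; simp
    rw [Matrix.trace_vecMulVec, dotProduct_comm, ← this]
    simp [dotProduct, Fintype.sum_prod_type]
  have hX : traceNorm X = 1 := by
    have := PosSemidef.traceNorm_eq_trace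
      (Matrix.posSemidef_vecMulVec_self_star fun p : ι × Fin 1 => w p.1)
    have h2 : (traceNorm X : ℂ) = 1 := this.trans hXtr
    exact_mod_cast h2
  have hle : traceNorm (ampliation (measChannel M - measChannel M') 1 X) ≤ η := by
    rw [← ENNReal.ofReal_le_ofReal_iff hη]
    refine le_trans ?_ h
    exact le_iSup_of_le 1 (le_iSup_of_le X (le_iSup_of_le hX.le le_rfl))
  have hB := norm_trace_mul_le_traceNorm (ampliation (measChannel M - measChannel M') 1 X)
    (norm_form_diagonal_le (g := fun p : O × Fin 1 => g p.1) fun p => hg p.1)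
  refine le_trans (le_of_eq ?_) (hB.trans hle)
  congr 1
  rw [Matrix.sum_mulVec, dotProduct_sum, Matrix.trace, Fintype.sum_prod_type]
  refine Finset.sum_congr rfl fun o _ => ?_
  have hent : ∀ N : Matrix ι ι ℂ,
      ((Matrix.of fun i j => X (i, (0 : Fin 1)) (j, (0 : Fin 1))) * N).trace
        = star w ⬝ᵥ (N *ᵥ w) := by
    intro N
    have : (Matrix.of fun i j => X (i, (0 : Fin 1)) (j, (0 : Fin 1)))
        = Matrix.vecMulVec w (star w) := rfl
    rw [this, Matrix.trace_mul_comm, Matrix.mul_vecMulVec, Matrix.trace_vecMulVec,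
      dotProduct_comm]
  simp only [Finset.univ_unique, Finset.sum_singleton, Matrix.diag_apply, Fin.default_eq_zero]
  rw [Matrix.diagonal_mul, Matrix.smul_mulVec, dotProduct_smul, smul_eq_mul]
  congr 1
  simp only [ampliation, measChannel, Matrix.of_apply, LinearMap.sub_apply, LinearMap.coe_mk,
    AddHom.coe_mk, Matrix.sub_apply, Matrix.diagonal_apply_eq, hent, Matrix.sub_mulVec,
    dotProduct_sub]

/-- A bound on the diamond norm of a difference of measurement channels bounds the operators
`∑ₒ gₒ (Mₒ - M'ₒ)`; the channels need only be applied to pure states without an ancilla. -/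
lemma posSemidef_of_diamondNorm_le [DecidableEq O] {M M' : O → Matrix ι ι ℂ}
    (hM : IsPOVM M) (hM' : IsPOVM M') {η : ℝ} (hη : 0 ≤ η)
    (h : diamondNorm (measChannel M - measChannel M') ≤ ENNReal.ofReal η)
    {g : O → ℝ} (hg : ∀ o, |g o| ≤ 1) :
    ((η : ℂ) • (1 : Matrix ι ι ℂ) - ∑ o, (g o : ℂ) • (M o - M' o)).PosSemidef := by
  have hHerm : ((η : ℂ) • (1 : Matrix ι ι ℂ) - ∑ o, (g o : ℂ) • (M o - M' o)).IsHermitian := by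
    rw [Matrix.IsHermitian, Matrix.conjTranspose_sub, Matrix.conjTranspose_smul,
      Matrix.conjTranspose_one, Matrix.conjTranspose_sum]
    simp [fun o => (hM.1 o).isHermitian.eq, fun o => (hM'.1 o).isHermitian.eq]
  refine Matrix.PosSemidef.of_dotProduct_mulVec_nonneg hHerm fun v => ?_
  suffices hmain : ‖star v ⬝ᵥ ((∑ o, (g o : ℂ) • (M o - M' o)) *ᵥ v)‖ ≤ η * l2norm v ^ 2 by
    have him : (star v ⬝ᵥ (((η : ℂ) • (1 : Matrix ι ι ℂ) -
        ∑ o, (g o : ℂ) • (M o - M' o)) *ᵥ v)).im = 0 := hHerm.im_star_dotProduct_mulVec_self v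
    rw [Complex.nonneg_iff]
    refine ⟨?_, him.symm⟩
    rw [Matrix.sub_mulVec, dotProduct_sub, Matrix.smul_mulVec, Matrix.one_mulVec,
      dotProduct_smul, star_dotProduct_self, smul_eq_mul, ← Complex.ofReal_mul, Complex.sub_re,
      Complex.ofReal_re]
    have := (Complex.re_le_norm _).trans hmain
    linarith
  rcases eq_or_ne (l2norm v) 0 with h0 | h0
  · have hv : v = 0 := by
      rw [l2norm, norm_eq_zero] at h0
      exact congrArg WithLp.ofLp h0
    simp [hv, l2norm]
  · set r := l2norm v with hr
    have hrp : 0 < r := lt_of_le_of_ne (l2norm_nonneg v) (Ne.symm h0)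
    have hw : l2norm (((r⁻¹ : ℝ) : ℂ) • v) = 1 := by
      rw [l2norm, WithLp.toLp_smul, norm_smul, Complex.norm_real, Real.norm_eq_abs,
        abs_of_pos (inv_pos.2 hrp)]
      exact inv_mul_cancel₀ h0
    have h1 := norm_sum_form_le_of_diamondNorm_le hη h hg _ hw
    rw [Matrix.mulVec_smul, dotProduct_smul, star_smul, smul_dotProduct, smul_eq_mul, smul_eq_mul,
      norm_mul, norm_mul, norm_star, Complex.norm_real, Real.norm_eq_abs,
      abs_of_pos (inv_pos.2 hrp), ← mul_assoc, ← mul_inv, inv_mul_le_iff₀ (by positivity)] at h1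
    linarith [h1, sq r]

end TraceNorm

/-! ### Tensor products of matrices and of POVMs -/

section Tensor

variable {I : Type*} [Fintype I] [DecidableEq I] {κ ι μ : I → Type*}

omit [DecidableEq I] in
lemma tensorMat_apply (A : ∀ l, Matrix (κ l) (ι l) ℂ) (i : ∀ l, κ l) (j : ∀ l, ι l) :
    tensorMat A i j = ∏ l, A l (i l) (j l) := rfl

lemma tensorMat_mul [∀ l, Fintype (ι l)] (A : ∀ l, Matrix (κ l) (ι l) ℂ)
    (B : ∀ l, Matrix (ι l) (μ l) ℂ) :
    tensorMat A * tensorMat B = tensorMat fun l => A l * B l := by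
  ext i j
  simp only [Matrix.mul_apply, tensorMat_apply, ← Finset.prod_mul_distrib]
  rw [Fintype.prod_sum]

omit [DecidableEq I] in
lemma conjTranspose_tensorMat (A : ∀ l, Matrix (κ l) (ι l) ℂ) :
    (tensorMat A)ᴴ = tensorMat fun l => (A l)ᴴ := by
  ext i j
  simp [Matrix.conjTranspose_apply, tensorMat_apply]

omit [DecidableEq I] in
lemma tensorMat_one [∀ l, DecidableEq (ι l)] :
    tensorMat (fun l => (1 : Matrix (ι l) (ι l) ℂ)) = 1 := by
  ext i j
  rw [tensorMat_apply, Matrix.one_apply]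
  split_ifs with h
  · subst h
    exact Finset.prod_eq_one fun l _ => Matrix.one_apply_eq _
  · obtain ⟨l, hl⟩ := Function.ne_iff.mp h
    exact Finset.prod_eq_zero (Finset.mem_univ l) (Matrix.one_apply_ne hl)

omit [DecidableEq I] in
lemma tensorMat_smul (c : I → ℂ) (A : ∀ l, Matrix (κ l) (ι l) ℂ) :
    tensorMat (fun l => c l • A l) = (∏ l, c l) • tensorMat A := by
  ext i j
  simp [tensorMat_apply, Finset.prod_mul_distrib]

/-- Multilinear expansion of a tensor product of sums. -/
lemma tensorMat_sum {O : I → Type*} [∀ l, Fintype (O l)]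
    (M : ∀ l, O l → Matrix (κ l) (ι l) ℂ) :
    tensorMat (fun l => ∑ a, M l a) = ∑ o : ∀ l, O l, tensorMat fun l => M l (o l) := by
  ext i j
  simp only [tensorMat_apply, Matrix.sum_apply]
  rw [Fintype.prod_sum]

lemma tensorMat_posSemidef [∀ l, Fintype (ι l)] [∀ l, DecidableEq (ι l)]
    {A : ∀ l, Matrix (ι l) (ι l) ℂ} (hA : ∀ l, (A l).PosSemidef) : (tensorMat A).PosSemidef := by
  choose B hB using fun l => exists_eq_conjTranspose_mul_self (hA l)
  have : tensorMat A = (tensorMat B)ᴴ * tensorMat B := by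
    rw [conjTranspose_tensorMat, tensorMat_mul]
    congr 1
    funext l
    exact hB l
  rw [this]
  exact Matrix.posSemidef_conjTranspose_mul_self _

/-- `A ↦ K ⊗ A` as a linear map, where `A` is put at the place `j`. -/
def tensorUpdate (K : ∀ l, Matrix (κ l) (ι l) ℂ) (j : I) :
    Matrix (κ j) (ι j) ℂ →ₗ[ℂ] Matrix (∀ l, κ l) (∀ l, ι l) ℂ where
  toFun A := tensorMat (Function.update K j A)
  map_add' A B := by
    ext p q
    simp only [tensorMat_apply, Matrix.add_apply]
    rw [← Finset.mul_prod_erase _ _ (Finset.mem_univ j),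
      ← Finset.mul_prod_erase _ (fun l => Function.update K j A l (p l) (q l)) (Finset.mem_univ j),
      ← Finset.mul_prod_erase _ (fun l => Function.update K j B l (p l) (q l)) (Finset.mem_univ j)]
    have h : ∀ C, ∏ l ∈ Finset.univ.erase j, Function.update K j C l (p l) (q l)
        = ∏ l ∈ Finset.univ.erase j, K l (p l) (q l) := fun C =>
      Finset.prod_congr rfl fun l hl => by rw [Function.update_of_ne (Finset.ne_of_mem_erase hl)]
    simp only [h, Function.update_self, Matrix.add_apply, add_mul]
  map_smul' c A := by
    ext p q
    simp only [tensorMat_apply, Matrix.smul_apply, RingHom.id_apply, smul_eq_mul]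
    rw [← Finset.mul_prod_erase _ _ (Finset.mem_univ j),
      ← Finset.mul_prod_erase _ (fun l => Function.update K j A l (p l) (q l)) (Finset.mem_univ j)]
    have h : ∀ C, ∏ l ∈ Finset.univ.erase j, Function.update K j C l (p l) (q l)
        = ∏ l ∈ Finset.univ.erase j, K l (p l) (q l) := fun C =>
      Finset.prod_congr rfl fun l hl => by rw [Function.update_of_ne (Finset.ne_of_mem_erase hl)]
    simp only [h, Function.update_self, Matrix.smul_apply, smul_eq_mul, mul_assoc]

end Tensor

section Hybrid

variable {I : Type*} [Fintype I] [DecidableEq I] {ι : I → Type*} [∀ l, Fintype (ι l)]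
  [∀ l, DecidableEq (ι l)] {O : I → Type*} [∀ l, Fintype (O l)]

lemma IsPOVM.tensor {M : ∀ l, O l → Matrix (ι l) (ι l) ℂ} (hM : ∀ l, IsPOVM (M l)) :
    IsPOVM fun o : ∀ l, O l => tensorMat fun l => M l (o l) := by
  refine ⟨fun o => tensorMat_posSemidef fun l => (hM l).1 _, ?_⟩
  rw [← tensorMat_sum]
  simp_rw [fun l => (hM l).2]
  exact tensorMat_one

lemma IsPOVM.kronecker {α β P Q : Type*} [Fintype α] [DecidableEq α] [Fintype β] [DecidableEq β]
    [Fintype P] [Fintype Q] {M : P → Matrix α α ℂ} {N : Q → Matrix β β ℂ}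
    (hM : IsPOVM M) (hN : IsPOVM N) : IsPOVM fun o : P × Q => M o.1 ⊗ₖ N o.2 := by
  refine ⟨fun o => (hM.1 _).kronecker (hN.1 _), ?_⟩
  rw [← Matrix.one_kronecker_one, ← hM.2, ← hN.2, Fintype.sum_prod_type]
  ext i j
  simp [Matrix.sum_apply, Matrix.kroneckerMap_apply, Finset.sum_mul_sum]

/-- The operator form of a bound `η` on the distance of the measurement channels of `M`, `M'`. -/
def OpClose {P α : Type*} [Fintype P] [DecidableEq α]
    (M M' : P → Matrix α α ℂ) (η : ℝ) : Prop :=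
  ∀ g : P → ℝ, (∀ o, |g o| ≤ 1) →
    ((η : ℂ) • (1 : Matrix α α ℂ) - ∑ o, (g o : ℂ) • (M o - M' o)).PosSemidef

lemma OpClose.refl {P α : Type*} [Fintype P] [DecidableEq α] (M : P → Matrix α α ℂ) :
    OpClose M M 0 := fun g _ => by
  simpa using Matrix.PosSemidef.zero

/-- One step of the hybrid argument, for fixed operators `K` of the other parties. -/
lemma sum_abs_tensorUpdate_le {φ : Matrix (∀ l, ι l) (∀ l, ι l) ℂ →ₗ[ℝ] ℝ}
    (hφ : ∀ A, A.PosSemidef → 0 ≤ φ A) {K : ∀ l, Matrix (ι l) (ι l) ℂ}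
    (hK : ∀ l, (K l).PosSemidef) {j : I} {M M' : O j → Matrix (ι j) (ι j) ℂ} {η : ℝ}
    (h : OpClose M M' η) :
    ∑ x, |φ (tensorUpdate K j (M x - M' x))| ≤ η * φ (tensorUpdate K j 1) := by
  -- the signs turn the sum of absolute values into `φ` of a single operator
  set g : O j → ℝ := fun x => if 0 ≤ φ (tensorUpdate K j (M x - M' x)) then 1 else -1 with hg
  have hg1 : ∀ x, |g x| ≤ 1 := by
    intro x; simp only [hg]; split_ifs <;> simp
  have hgx : ∀ x, |φ (tensorUpdate K j (M x - M' x))|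
      = g x * φ (tensorUpdate K j (M x - M' x)) := by
    intro x; simp only [hg]
    split_ifs with h0
    · rw [abs_of_nonneg h0, one_mul]
    · rw [abs_of_neg (not_le.1 h0), neg_one_mul]
  have hpsd : (tensorUpdate K j ((η : ℂ) • (1 : Matrix (ι j) (ι j) ℂ) -
      ∑ o, (g o : ℂ) • (M o - M' o))).PosSemidef := by
    refine tensorMat_posSemidef fun l => ?_
    rcases eq_or_ne l j with rfl | hl
    · rw [Function.update_self]; exact h g hg1
    · rw [Function.update_of_ne hl]; exact hK l
  have h0 := hφ _ hpsd
  have hsmul : ∀ (c : ℝ) (D : Matrix (ι j) (ι j) ℂ),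
      φ (tensorUpdate K j ((c : ℂ) • D)) = c * φ (tensorUpdate K j D) := by
    intro c D
    rw [map_smul, Complex.coe_smul, map_smul, smul_eq_mul]
  rw [map_sub, map_sum, map_sub, map_sum, hsmul] at h0
  simp_rw [hsmul] at h0
  simp_rw [hgx]
  linarith

/-- Replacing the measurement of one party. -/
lemma sum_abs_replace_le {φ : Matrix (∀ l, ι l) (∀ l, ι l) ℂ →ₗ[ℝ] ℝ}
    (hφ : ∀ A, A.PosSemidef → 0 ≤ φ A) {M : ∀ l, O l → Matrix (ι l) (ι l) ℂ}
    (hM : ∀ l, IsPOVM (M l)) {j : I} {M' : O j → Matrix (ι j) (ι j) ℂ} {η : ℝ}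
    (h : OpClose (M j) M' η) :
    ∑ o : ∀ l, O l, |φ (tensorMat fun l => M l (o l)) -
      φ (tensorMat fun l => Function.update M j M' l (o l))| ≤ η * φ 1 := by
  -- operators of the parties other than `j`, given their outcomes `r`
  let K : (∀ l : {l // l ≠ j}, O l) → ∀ l, Matrix (ι l) (ι l) ℂ := fun r l =>
    if hl : l = j then 1 else M l (r ⟨l, hl⟩)
  have hK : ∀ r l, (K r l).PosSemidef := by
    intro r l
    by_cases hl : l = j
    · simp only [K, hl, dite_true]; exact Matrix.PosSemidef.one
    · simp only [K, hl, dite_false]; exact (hM l).1 _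
  have hKM : ∀ x r, (fun l => M l ((Equiv.piSplitAt j O).symm (x, r) l))
      = Function.update (K r) j (M j x) := by
    intro x r; funext l
    rcases eq_or_ne l j with rfl | hl
    · simp [Equiv.piSplitAt]
    · simp [Equiv.piSplitAt, hl, K]
  have hKM' : ∀ x r, (fun l => Function.update M j M' l ((Equiv.piSplitAt j O).symm (x, r) l))
      = Function.update (K r) j (M' x) := by
    intro x r; funext l
    rcases eq_or_ne l j with rfl | hl
    · simp [Equiv.piSplitAt]
    · simp [Equiv.piSplitAt, hl, K]
  have hone : ∑ r, φ (tensorUpdate (K r) j 1) = φ 1 := by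
    rw [← (IsPOVM.tensor hM).2, map_sum,
      ← (Equiv.piSplitAt j O).symm.sum_comp fun o => φ (tensorMat fun l => M l (o l)),
      Fintype.sum_prod_type_right]
    refine Finset.sum_congr rfl fun r _ => ?_
    rw [← (hM j).2, map_sum, map_sum]
    refine Finset.sum_congr rfl fun x _ => ?_
    rw [hKM]; rfl
  rw [← (Equiv.piSplitAt j O).symm.sum_comp, Fintype.sum_prod_type_right, ← hone, Finset.mul_sum]
  refine Finset.sum_le_sum fun r _ => ?_
  refine le_trans (le_of_eq (Finset.sum_congr rfl fun x _ => ?_))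
    (sum_abs_tensorUpdate_le hφ (hK r) h)
  rw [hKM, hKM', ← map_sub]
  congr 2
  exact (map_sub (tensorUpdate (K r) j) (M j x) (M' x)).symm

/-- The hybrid argument: the total variation distance of the outcomes of two product measurements
on a positive functional is at most the sum of the distances of the local measurements. -/
lemma sum_abs_tensor_sub_le {φ : Matrix (∀ l, ι l) (∀ l, ι l) ℂ →ₗ[ℝ] ℝ}
    (hφ : ∀ A, A.PosSemidef → 0 ≤ φ A) {M M' : ∀ l, O l → Matrix (ι l) (ι l) ℂ}
    (hM : ∀ l, IsPOVM (M l)) (hM' : ∀ l, IsPOVM (M' l)) {η : I → ℝ}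
    (h : ∀ l, OpClose (M l) (M' l) (η l)) :
    ∑ o : ∀ l, O l, |φ (tensorMat fun l => M l (o l)) - φ (tensorMat fun l => M' l (o l))|
      ≤ (∑ l, η l) * φ 1 := by
  have key : ∀ S : Finset I, ∑ o : ∀ l, O l, |φ (tensorMat fun l => M l (o l)) -
      φ (tensorMat fun l => (if l ∈ S then M' l else M l) (o l))| ≤ (∑ l ∈ S, η l) * φ 1 := by
    intro S
    induction S using Finset.induction_on with
    | empty => simp
    | insert j S hj ih =>
      have hmix : ∀ l, IsPOVM (if l ∈ S then M' l else M l) := by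
        intro l; split_ifs
        exacts [hM' l, hM l]
      have hstep := sum_abs_replace_le hφ (M := fun l => if l ∈ S then M' l else M l) hmix
        (j := j) (M' := M' j) (η := η j) (by simp only [hj, if_false]; exact h j)
      have hupd : Function.update (fun l => if l ∈ S then M' l else M l) j (M' j)
          = fun l => if l ∈ insert j S then M' l else M l := by
        funext l
        rcases eq_or_ne l j with rfl | hl
        · simp
        · simp [hl]
      rw [hupd] at hstep
      rw [Finset.sum_insert hj, add_mul, add_comm]
      refine le_trans ?_ (add_le_add ih hstep)
      rw [← Finset.sum_add_distrib]
      exact Finset.sum_le_sum fun o _ => abs_sub_le _ _ _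
  simpa using key Finset.univ

end Hybrid

/-! ### Expectation values of product operators in the reference state -/

section Reference

variable {n : ℕ}

/-- The qubits of all main parties: `T_l`, `S_l` for each party, and `R^▷_l`, `R^◁_{l+1}` for each
link. -/
def qubitEquiv (n : ℕ) : Fin n ⊕ Fin n ⊕ Link n ⊕ Link n ≃ Σ l : Fin n, Regs l where
  toFun
    | .inl l => ⟨l, regT l⟩
    | .inr (.inl l) => ⟨l, regS l⟩
    | .inr (.inr (.inl e)) => ⟨e.1, ⟨.Rright, e.2⟩⟩
    | .inr (.inr (.inr e)) => ⟨e.next, ⟨.Rleft, Nat.succ_pos _⟩⟩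
  invFun
    | ⟨l, ⟨.T, _⟩⟩ => .inl l
    | ⟨l, ⟨.S, _⟩⟩ => .inr (.inl l)
    | ⟨l, ⟨.Rright, h⟩⟩ => .inr (.inr (.inl ⟨l, h⟩))
    | ⟨⟨0, _⟩, ⟨.Rleft, h⟩⟩ => absurd h (lt_irrefl 0)
    | ⟨⟨m + 1, hm⟩, ⟨.Rleft, _⟩⟩ => .inr (.inr (.inr ⟨⟨m, (Nat.lt_succ_self m).trans hm⟩, hm⟩))
  left_inv := by
    rintro (l | l | e | e) <;> rfl
  right_inv := by
    rintro ⟨⟨_ | m, hm⟩, ⟨_ | _ | _ | _, h⟩⟩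
    all_goals first | rfl | exact absurd h (lt_irrefl 0)

lemma prod_regs (f : ∀ l : Fin n, Regs l → ℂ) :
    ∏ l, ∏ r, f l r = (∏ l, f l (regT l)) * ((∏ l, f l (regS l)) *
      ((∏ e : Link n, f e.1 ⟨.Rright, e.2⟩) *
        ∏ e : Link n, f e.next ⟨.Rleft, Nat.succ_pos _⟩)) := by
  rw [← Fintype.prod_sigma' f, ← (qubitEquiv n).prod_comp]
  simp only [Fintype.prod_sum_type]
  rfl

/-- A basis vector of the reference experiment, split into the registers `T`, `S`, `R^▷`, `R^◁`
and the qubits of the auxiliary parties. -/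
def splitIdx (i : RefIdx n) : ((Fin n → Fin 2) × (Fin n → Fin 2) × (Link n → Fin 2) ×
    (Link n → Fin 2)) × (Fin n → Fin 2) :=
  ((fun l => i.1 l (regT l), fun l => i.1 l (regS l), fun e => i.1 e.1 ⟨.Rright, e.2⟩,
    fun e => i.1 e.next ⟨.Rleft, Nat.succ_pos _⟩), i.2)

lemma splitIdx_bijective : Function.Bijective (splitIdx (n := n)) := by
  let e1 : (∀ l : Fin n, RefA l) ≃ ((Σ l : Fin n, Regs l) → Fin 2) :=
    (Equiv.piCurry (fun (l : Fin n) (_ : Regs l) => Fin 2)).symm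
  let e2 : ((Σ l : Fin n, Regs l) → Fin 2) ≃ (Fin n ⊕ Fin n ⊕ Link n ⊕ Link n → Fin 2) :=
    (qubitEquiv n).symm.arrowCongr (Equiv.refl _)
  let e3 : (Fin n ⊕ Fin n ⊕ Link n ⊕ Link n → Fin 2) ≃ ((Fin n → Fin 2) × (Fin n → Fin 2) ×
      (Link n → Fin 2) × (Link n → Fin 2)) :=
    (Equiv.sumArrowEquivProdArrow _ _ _).trans ((Equiv.refl _).prodCongr
      ((Equiv.sumArrowEquivProdArrow _ _ _).trans ((Equiv.refl _).prodCongr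
        (Equiv.sumArrowEquivProdArrow _ _ _))))
  exact (((e1.trans e2).trans e3).prodCongr (Equiv.refl (Fin n → Fin 2))).bijective

lemma sum_prod_four {L : Type*} [Fintype L] [DecidableEq L]
    (g : L → Fin 2 → Fin 2 → Fin 2 → Fin 2 → ℂ) :
    ∑ a : L → Fin 2, ∑ b : L → Fin 2, ∑ c : L → Fin 2, ∑ d : L → Fin 2,
      ∏ l, g l (a l) (b l) (c l) (d l) = ∏ l, ∑ a, ∑ b, ∑ c, ∑ d, g l a b c d := by
  simp only [Fintype.prod_sum]

lemma sum_split_factor {α β γ : Type*} [Fintype α] [Fintype β] [Fintype γ]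
    (A : α → α → ℂ) (B : β → β → β → β → ℂ) (C : γ → γ → γ → γ → ℂ) :
    ∑ x : (α × β × γ × γ) × β, ∑ y : (α × β × γ × γ) × β,
      A x.1.1 y.1.1 * (B x.1.2.1 y.1.2.1 x.2 y.2 *
        C x.1.2.2.1 y.1.2.2.1 x.1.2.2.2 y.1.2.2.2) =
    (∑ a, ∑ b, A a b) * ((∑ a, ∑ b, ∑ c, ∑ d, B a b c d) * ∑ a, ∑ b, ∑ c, ∑ d, C a b c d) := by
  let e : ((α × α) × (β × β × β × β) × (γ × γ × γ × γ)) ≃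
      ((α × β × γ × γ) × β) × ((α × β × γ × γ) × β) :=
    { toFun := fun p => (((p.1.1, p.2.1.1, p.2.2.1, p.2.2.2.2.1), p.2.1.2.2.1),
        ((p.1.2, p.2.1.2.1, p.2.2.2.1, p.2.2.2.2.2), p.2.1.2.2.2))
      invFun := fun q => ((q.1.1.1, q.2.1.1), (q.1.1.2.1, q.2.1.2.1, q.1.2, q.2.2),
        (q.1.1.2.2.1, q.2.1.2.2.1, q.1.1.2.2.2, q.2.1.2.2.2))
      left_inv := fun _ => rfl
      right_inv := fun _ => rfl }
  rw [← Fintype.sum_prod_type', ← e.sum_comp]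
  simp only [e, Equiv.coe_fn_mk]
  simp only [← Fintype.sum_prod_type', Finset.sum_mul_sum]

/-- The expectation value `⟨φ⁺| U ⊗ V |φ⁺⟩ = tr(U Vᵀ) / 2`. -/
def bellExp (U V : Matrix (Fin 2) (Fin 2) ℂ) : ℂ := 1 / 2 * ∑ i, ∑ j, U i j * V i j

lemma inv_sqrt_two_mul_self :
    (((Real.sqrt 2)⁻¹ : ℝ) : ℂ) * (((Real.sqrt 2)⁻¹ : ℝ) : ℂ) = 1 / 2 := by
  rw [← Complex.ofReal_mul, ← mul_inv, Real.mul_self_sqrt (by norm_num)]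
  norm_num

lemma sum_bell (U V : Matrix (Fin 2) (Fin 2) ℂ) :
    ∑ s, ∑ s', ∑ b, ∑ b', U s s' * V b b' * (bell s' b' * star (bell s b)) = bellExp U V := by
  have h := inv_sqrt_two_mul_self
  simp only [Fin.sum_univ_two, bell, bellExp, Complex.star_def]
  simp only [Fin.isValue, reduceIte, zero_ne_one, one_ne_zero, map_zero, mul_zero, add_zero,
    zero_add, zero_mul, Complex.conj_ofReal, h]
  ring

/-- The expectation value in `τ_T ⊗ Φ⁺` of a tensor product of one-qubit operators factorizes into
the expectation value in `τ` and one Bell state expectation value for each Bell pair. -/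
theorem trace_product_mul_refState (U : ∀ l : Fin n, Regs l → Matrix (Fin 2) (Fin 2) ℂ)
    (V : Fin n → Matrix (Fin 2) (Fin 2) ℂ) (τ : Matrix (Fin n → Fin 2) (Fin n → Fin 2) ℂ) :
    (((tensorMat fun l => tensorMat (U l)) ⊗ₖ tensorMat V) * refState τ).trace =
      ((tensorMat fun l => U l (regT l)) * τ).trace * ((∏ l, bellExp (U l (regS l)) (V l)) *
        ∏ e : Link n, bellExp (U e.1 ⟨.Rright, e.2⟩) (U e.next ⟨.Rleft, Nat.succ_pos _⟩)) := by
  simp only [← sum_bell, ← sum_prod_four]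
  simp only [Matrix.trace, Matrix.diag_apply, Matrix.mul_apply]
  rw [← sum_split_factor (fun a b => tensorMat (fun l => U l (regT l)) a b * τ b a)]
  rw [← (splitIdx_bijective (n := n)).sum_comp]
  refine Finset.sum_congr rfl fun i _ => ?_
  rw [← (splitIdx_bijective (n := n)).sum_comp]
  refine Finset.sum_congr rfl fun j _ => ?_
  simp only [splitIdx, Matrix.kroneckerMap_apply, tensorMat_apply, refState, Matrix.of_apply,
    bellVec, prod_regs, Finset.prod_mul_distrib, star_mul', star_prod]
  ring

end Reference

/-! ### The reference measurements as product operators -/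

section Operators

lemma onReg_eq_tensorMat {R : Type*} [Fintype R] [DecidableEq R] (r : R)
    (U : Matrix (Fin 2) (Fin 2) ℂ) :
    onReg r U = tensorMat (Function.update (fun _ : R => (1 : Matrix (Fin 2) (Fin 2) ℂ)) r U) := by
  ext i j
  rw [onReg, Matrix.of_apply, tensorMat_apply, ← Finset.mul_prod_erase _ _ (Finset.mem_univ r),
    Function.update_self]
  have h : ∏ l ∈ Finset.univ.erase r,
      Function.update (fun _ : R => (1 : Matrix (Fin 2) (Fin 2) ℂ)) r U l (i l) (j l)
      = ∏ l ∈ Finset.univ.erase r, if i l = j l then 1 else 0 :=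
    Finset.prod_congr rfl fun l hl => by
      rw [Function.update_of_ne (Finset.ne_of_mem_erase hl), Matrix.one_apply]
  rw [h, Finset.prod_ite_zero]
  simp only [Finset.mem_erase, Finset.mem_univ, and_true, Finset.prod_const_one, mul_ite, mul_one,
    mul_zero]

lemma onRegs_kronecker_eq_tensorMat {R : Type*} [Fintype R] [DecidableEq R] {r s : R} (hrs : r ≠ s)
    (U V : Matrix (Fin 2) (Fin 2) ℂ) :
    onRegs r s (U ⊗ₖ V) = tensorMat (Function.update (Function.update
      (fun _ : R => (1 : Matrix (Fin 2) (Fin 2) ℂ)) s V) r U) := by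
  ext i j
  have hs : s ∈ Finset.univ.erase r := Finset.mem_erase.2 ⟨hrs.symm, Finset.mem_univ _⟩
  rw [onRegs, Matrix.of_apply, tensorMat_apply, ← Finset.mul_prod_erase _ _ (Finset.mem_univ r),
    ← Finset.mul_prod_erase _ _ hs, Function.update_self, Function.update_of_ne hrs.symm,
    Function.update_self, Matrix.kroneckerMap_apply]
  have h : ∏ l ∈ (Finset.univ.erase r).erase s, Function.update (Function.update
      (fun _ : R => (1 : Matrix (Fin 2) (Fin 2) ℂ)) s V) r U l (i l) (j l)
      = ∏ l ∈ (Finset.univ.erase r).erase s, if i l = j l then 1 else 0 :=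
    Finset.prod_congr rfl fun l hl => by
      rw [Function.update_of_ne (Finset.ne_of_mem_erase (Finset.mem_of_mem_erase hl)),
        Function.update_of_ne (Finset.ne_of_mem_erase hl), Matrix.one_apply]
  rw [h, Finset.prod_ite_zero]
  have hiff : (∀ q, q ≠ r → q ≠ s → i q = j q) ↔
      ∀ l ∈ (Finset.univ.erase r).erase s, i l = j l := by
    simp only [Finset.mem_erase, Finset.mem_univ, and_true]
    exact ⟨fun h l hl => h l hl.2 hl.1, fun h l h1 h2 => h l ⟨h2, h1⟩⟩
  simp only [hiff, Finset.prod_const_one, mul_ite, mul_one, mul_zero]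

lemma onRegs_sum {R O : Type*} [Fintype R] [DecidableEq R] [Fintype O] (r s : R) (c : O → ℂ)
    (U : O → Matrix (Fin 2 × Fin 2) (Fin 2 × Fin 2) ℂ) :
    onRegs r s (∑ a, c a • U a) = ∑ a, c a • onRegs r s (U a) := by
  ext i j
  simp only [onRegs, Matrix.of_apply, Matrix.sum_apply, Matrix.smul_apply]
  split_ifs <;> simp

lemma sum_sign_binElem (O : Matrix (Fin 2) (Fin 2) ℂ) :
    ∑ a : Fin 2, ((-1 : ℂ) ^ a.val) • binElem O a = O := by
  rw [Fin.sum_univ_two]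
  simp only [binElem, Fin.val_zero, Fin.val_one, pow_zero, pow_one, one_smul, neg_smul]
  rw [← sub_eq_add_neg, ← smul_sub, add_sub_add_left_eq_sub, sub_neg_eq_add,
    ← two_smul ℂ, smul_smul]
  norm_num

lemma onReg_sum {R O : Type*} [Fintype R] [DecidableEq R] [Fintype O] (r : R) (c : O → ℂ)
    (U : O → Matrix (Fin 2) (Fin 2) ℂ) :
    onReg r (∑ a, c a • U a) = ∑ a, c a • onReg r (U a) := by
  ext i j
  simp only [onReg, Matrix.of_apply, Matrix.sum_apply, Matrix.smul_apply]
  split_ifs <;> simp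

/-! ### Pauli corrections and Bell measurements -/

/-- `P` anticommutes with `U_a`. -/
def Flips (P : Pauli) (a : Fin 2 × Fin 2) : Prop :=
  match P with
  | .X => a.2 = 1
  | .Y => a.1 ≠ a.2
  | .Z => a.1 = 1

instance (P : Pauli) (a : Fin 2 × Fin 2) : Decidable (Flips P a) := by
  cases P <;> unfold Flips <;> infer_instance

lemma anticomm_iff (P : Pauli) (a : Fin 2 × Fin 2) :
    P.mat * corrU a + corrU a * P.mat = 0 ↔ Flips P a := by
  obtain ⟨a0, a1⟩ := a
  fin_cases a0 <;> fin_cases a1 <;> cases P <;>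
    simp [← Matrix.ext_iff, Fin.forall_fin_two, corrU, Pauli.mat, Flips]

lemma corrOut_eq (b : Fin 2) (P : Pauli) (a : Fin 2 × Fin 2) :
    corrOut b P a = b + if Flips P a then 1 else 0 := by
  unfold corrOut
  congr 1
  exact if_congr (anticomm_iff P a) rfl rfl

/-- The sign by which `P` and `U_a` commute. -/
def flipSign (P : Pauli) (a : Fin 2 × Fin 2) : ℝ := if Flips P a then -1 else 1

lemma abs_flipSign (P : Pauli) (a : Fin 2 × Fin 2) : |flipSign P a| = 1 := by
  unfold flipSign; split_ifs <;> simp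

lemma sign_corrOut (b : Fin 2) (P : Pauli) (a : Fin 2 × Fin 2) :
    (-1 : ℝ) ^ (corrOut b P a).val = (-1) ^ b.val * flipSign P a := by
  rw [corrOut_eq, flipSign]
  split_ifs <;> fin_cases b <;> simp

lemma corrOut_involutive (P : Pauli) (a : Fin 2 × Fin 2) :
    Function.Involutive fun b => corrOut b P a := by
  intro b
  simp only [corrOut_eq]
  split_ifs <;> fin_cases b <;> simp

lemma bellProj_apply (a p q : Fin 2 × Fin 2) :
    bellProj a p q = 1 / 2 * (corrU a p.1 p.2 * star (corrU a q.1 q.2)) := by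
  have h := inv_sqrt_two_mul_self
  have hv : ∀ p : Fin 2 × Fin 2, ∑ k, corrU a p.1 k * bell k p.2
      = corrU a p.1 p.2 * (((Real.sqrt 2)⁻¹ : ℝ) : ℂ) := by
    intro p
    rw [Finset.sum_eq_single p.2 (fun k _ hk => by simp [bell, hk]) (by simp)]
    simp [bell]
  rw [bellProj, Matrix.vecMulVec_apply, Pi.star_apply, hv, hv, star_mul', ← h]
  simp only [Complex.star_def, Complex.conj_ofReal]
  ring

/-- The corrected outcomes of a Bell measurement realize the observable `P ⊗ Pᵀ`. -/
lemma sum_flipSign_bellProj (P : Pauli) :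
    ∑ a, (flipSign P a : ℂ) • bellProj a = P.mat ⊗ₖ P.matᵀ := by
  ext ⟨p0, p1⟩ ⟨q0, q1⟩
  simp only [Matrix.sum_apply, Matrix.smul_apply, bellProj_apply, Fintype.sum_prod_type,
    Fin.sum_univ_two, Matrix.kroneckerMap_apply, Matrix.transpose_apply, flipSign, smul_eq_mul]
  cases P <;> fin_cases p0 <;> fin_cases p1 <;> fin_cases q0 <;> fin_cases q1 <;>
    (simp [corrU, Pauli.mat, Flips, Matrix.mul_apply, Matrix.one_apply, Fin.sum_univ_two]
     try norm_num)

lemma corrU_conj_pauli (P : Pauli) (a : Fin 2 × Fin 2) :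
    corrU a * P.mat * (corrU a)ᴴ = (flipSign P a : ℂ) • P.mat := by
  obtain ⟨a0, a1⟩ := a
  ext i j
  fin_cases a0 <;> fin_cases a1 <;> cases P <;> fin_cases i <;> fin_cases j <;>
    simp [corrU, Pauli.mat, Flips, flipSign, Matrix.mul_apply, Matrix.one_apply, Fin.sum_univ_two]

lemma corrU_mul_conjTranspose (a : Fin 2 × Fin 2) : corrU a * (corrU a)ᴴ = 1 := by
  obtain ⟨a0, a1⟩ := a
  ext i j
  fin_cases a0 <;> fin_cases a1 <;> fin_cases i <;> fin_cases j <;>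
    simp [corrU, Pauli.mat, Matrix.mul_apply, Matrix.one_apply, Fin.sum_univ_two]

/-- Teleportation: measuring `P` after a Bell measurement with outcome `a` has the statistics of
the corrected outcome on the teleported qubit. -/
lemma corrU_conj_binElem (b : Fin 2) (P : Pauli) (a : Fin 2 × Fin 2) :
    corrU a * binElem P.mat b * (corrU a)ᴴ = binElem P.mat (corrOut b P a) := by
  have h : (-1 : ℂ) ^ (corrOut b P a).val = (-1) ^ b.val * flipSign P a := by
    exact_mod_cast congrArg (fun x : ℝ => (x : ℂ)) (sign_corrOut b P a)
  rw [binElem, binElem, h, Matrix.mul_smul, Matrix.smul_mul, Matrix.mul_add, Matrix.add_mul,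
    Matrix.mul_one, corrU_mul_conjTranspose, Matrix.mul_smul, Matrix.smul_mul, corrU_conj_pauli,
    smul_smul]

lemma bellExp_one : bellExp 1 1 = 1 := by
  simp [bellExp, Matrix.one_apply]

lemma bellExp_transpose_pauli (P : Pauli) : bellExp P.matᵀ P.mat = 1 := by
  cases P <;> simp [bellExp, Fin.sum_univ_two, Pauli.mat] <;> norm_num

lemma bellExp_pauli (P : Pauli) : bellExp P.mat P.mat = if P = .Y then -1 else 1 := by
  cases P <;> simp [bellExp, Fin.sum_univ_two, Pauli.mat] <;> norm_num

lemma bellExp_chsh (k : Fin 3) (i j : Fin 2) :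
    (-1 : ℂ) ^ (i.val * j.val) * bellExp (chshObs (chshX i k)) (chshY j k).mat
      = ((Real.sqrt 2)⁻¹ : ℝ) := by
  fin_cases k <;> fin_cases i <;> fin_cases j <;>
    (simp [bellExp, Fin.sum_univ_two, chshObs, chshX, chshY, Pauli.mat]; try ring_nf; try simp)

end Operators

/-! ### Comparison of the physical experiment with the embedded reference experiment -/

section Physical

variable {n : ℕ} {HA HB : Fin n → Type} [∀ l, Fintype (HA l)] [∀ l, DecidableEq (HA l)]
  [∀ l, Fintype (HB l)] [∀ l, DecidableEq (HB l)]

open Classical in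
/-- The ideal measurement operators of a main party. Inputs without a reference measurement keep
the implemented measurement. -/
def idealA (E : Experiment HA HB) (R : Embedding HA HB) (l : Fin n) :
    ∀ x : Option ASetting, AOut x → Matrix (HA l) (HA l) ℂ
  | some x, a => if h : Relevant l x then (R.M l x h).elem a else (E.M l x).elem a
  | none, _ => 1

/-- The ideal measurement operators of an auxiliary party. -/
def idealB (R : Embedding HA HB) (l : Fin n) :
    ∀ y : Option Pauli, BOut y → Matrix (HB l) (HB l) ℂ
  | some y, b => (R.N l y).elem b
  | none, _ => 1

/-- Main parties in `S` measure ideally, the others as implemented. -/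
def mixA (E : Experiment HA HB) (R : Embedding HA HB) (S : Finset (Fin n)) (l : Fin n)
    (x : Option ASetting) : AOut x → Matrix (HA l) (HA l) ℂ :=
  if l ∈ S then idealA E R l x else E.elemA l x

/-- Auxiliary parties in `S` measure ideally, the others as implemented. -/
def mixB (E : Experiment HA HB) (R : Embedding HA HB) (S : Finset (Fin n)) (l : Fin n)
    (y : Option Pauli) : BOut y → Matrix (HB l) (HB l) ℂ :=
  if l ∈ S then idealB R l y else E.elemB l y

lemma isPOVM_unit {ι : Type*} [Fintype ι] [DecidableEq ι] :
    IsPOVM fun _ : Unit => (1 : Matrix ι ι ℂ) :=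
  ⟨fun _ => Matrix.PosSemidef.one, by simp⟩

variable (E : Experiment HA HB) (R : Embedding HA HB)

lemma isPOVM_elemA (l : Fin n) (x : Option ASetting) : IsPOVM (E.elemA l x) := by
  cases x with
  | none => exact isPOVM_unit
  | some x => exact (E.M l x).isPOVM

lemma isPOVM_elemB (l : Fin n) (y : Option Pauli) : IsPOVM (E.elemB l y) := by
  cases y with
  | none => exact isPOVM_unit
  | some y => exact (E.N l y).isPOVM

lemma idealA_some (l : Fin n) (x : ASetting) (h : Relevant l x) :
    idealA E R l (some x) = (R.M l x h).elem := by
  funext a; simp [idealA, h]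

lemma idealA_some_not (l : Fin n) (x : ASetting) (h : ¬ Relevant l x) :
    idealA E R l (some x) = (E.M l x).elem := by
  funext a; simp [idealA, h]

lemma isPOVM_idealA (l : Fin n) (x : Option ASetting) : IsPOVM (idealA E R l x) := by
  cases x with
  | none => exact isPOVM_unit
  | some x =>
    by_cases h : Relevant l x
    · rw [idealA_some E R l x h]; exact (R.M l x h).isPOVM
    · rw [idealA_some_not E R l x h]; exact (E.M l x).isPOVM

lemma isPOVM_idealB (l : Fin n) (y : Option Pauli) : IsPOVM (idealB R l y) := by
  cases y with
  | none => exact isPOVM_unit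
  | some y => exact (R.N l y).isPOVM

lemma isPOVM_mixA (S : Finset (Fin n)) (l : Fin n) (x : Option ASetting) :
    IsPOVM (mixA E R S l x) := by
  unfold mixA; split_ifs
  exacts [isPOVM_idealA E R l x, isPOVM_elemA E l x]

lemma isPOVM_mixB (S : Finset (Fin n)) (l : Fin n) (y : Option Pauli) :
    IsPOVM (mixB E R S l y) := by
  unfold mixB; split_ifs
  exacts [isPOVM_idealB R l y, isPOVM_elemB E l y]

variable {E R}

lemma OpClose.of_nonneg {P α : Type*} [Fintype P] [Fintype α] [DecidableEq α]
    (M : P → Matrix α α ℂ) {η : ℝ} (hη : 0 ≤ η) : OpClose M M η := fun g _ => by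
  simp only [sub_self, smul_zero, Finset.sum_const_zero, sub_zero]
  exact Matrix.PosSemidef.one.smul (Complex.zero_le_real.2 hη)

lemma opClose_elemA_mixA {η : ℝ} (hη : 0 ≤ η) (h : measError E R ≤ ENNReal.ofReal η)
    (S : Finset (Fin n)) (l : Fin n) (x : Option ASetting) :
    OpClose (E.elemA l x) (mixA E R S l x) (if l ∈ S then η else 0) := by
  unfold mixA
  split_ifs
  · cases x with
    | none => exact OpClose.of_nonneg _ hη
    | some x =>
      by_cases hx : Relevant l x
      · rw [idealA_some E R l x hx]
        intro g hg
        refine posSemidef_of_diamondNorm_le (E.M l x).isPOVM (R.M l x hx).isPOVM hη ?_ hg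
        refine le_trans ?_ ((le_max_left _ _).trans h)
        exact le_iSup_of_le l (le_iSup_of_le x (le_iSup_of_le hx le_rfl))
      · rw [idealA_some_not E R l x hx]
        exact OpClose.of_nonneg _ hη
  · exact OpClose.refl _

lemma opClose_elemB_mixB {η : ℝ} (hη : 0 ≤ η) (h : measError E R ≤ ENNReal.ofReal η)
    (S : Finset (Fin n)) (l : Fin n) (y : Option Pauli) :
    OpClose (E.elemB l y) (mixB E R S l y) (if l ∈ S then η else 0) := by
  unfold mixB
  split_ifs
  · cases y with
    | none => exact OpClose.of_nonneg _ hη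
    | some y =>
      intro g hg
      refine posSemidef_of_diamondNorm_le (E.N l y).isPOVM (R.N l y).isPOVM hη ?_ hg
      refine le_trans ?_ ((le_max_right _ _).trans h)
      exact le_iSup_of_le l (le_iSup_of_le y le_rfl)
  · exact OpClose.refl _

/-- The functional `A ↦ Re tr((A ⊗ C) ρ)`. -/
def leftFunctional {α β : Type*} [Fintype α] [Fintype β] (C : Matrix β β ℂ)
    (ρ : Matrix (α × β) (α × β) ℂ) : Matrix α α ℂ →ₗ[ℝ] ℝ where
  toFun A := ((A ⊗ₖ C) * ρ).trace.re
  map_add' A B := by rw [Matrix.add_kronecker, Matrix.add_mul, Matrix.trace_add, Complex.add_re]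
  map_smul' c A := by
    rw [Matrix.smul_kronecker, Matrix.smul_mul, Matrix.trace_smul, Complex.smul_re,
      RingHom.id_apply]

/-- The functional `C ↦ Re tr((A ⊗ C) ρ)`. -/
def rightFunctional {α β : Type*} [Fintype α] [Fintype β] (A : Matrix α α ℂ)
    (ρ : Matrix (α × β) (α × β) ℂ) : Matrix β β ℂ →ₗ[ℝ] ℝ where
  toFun C := ((A ⊗ₖ C) * ρ).trace.re
  map_add' B C := by rw [Matrix.kronecker_add, Matrix.add_mul, Matrix.trace_add, Complex.add_re]
  map_smul' c C := by
    rw [Matrix.kronecker_smul, Matrix.smul_mul, Matrix.trace_smul, Complex.smul_re,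
      RingHom.id_apply]

lemma re_trace_mul_nonneg {α : Type*} [Fintype α] [DecidableEq α] {A B : Matrix α α ℂ}
    (hA : A.PosSemidef) (hB : B.PosSemidef) : 0 ≤ (A * B).trace.re :=
  (Complex.nonneg_iff.1 (trace_mul_nonneg hA hB)).1

variable (E R) in
/-- The outcome distribution on the matrix `σ` when the parties in `S` measure ideally. -/
def mixProb (S : Finset (Fin n)) (s : Settings n)
    (σ : Matrix (PhysIdx HA HB) (PhysIdx HA HB) ℂ) (o : Outcomes s) : ℝ :=
  (((tensorMat fun l => mixA E R S l (s.1 l) (o.1 l)) ⊗ₖ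
    (tensorMat fun l => mixB E R S l (s.2 l) (o.2 l))) * σ).trace.re

/-- The total variation distance caused by making the measurements in `S` ideal. -/
lemma sum_abs_born_sub_mixProb_le {η : ℝ} (hη : 0 ≤ η)
    (h : measError E R ≤ ENNReal.ofReal η) (S : Finset (Fin n)) (s : Settings n) :
    ∑ o : Outcomes s, |E.born s o - mixProb E R S s E.ρ.1 o| ≤ 2 * (S.card * η) := by
  set KA : ∀ l, AOut (s.1 l) → Matrix (HA l) (HA l) ℂ := fun l => E.elemA l (s.1 l)
  set KB : ∀ l, BOut (s.2 l) → Matrix (HB l) (HB l) ℂ := fun l => E.elemB l (s.2 l)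
  set LA : ∀ l, AOut (s.1 l) → Matrix (HA l) (HA l) ℂ := fun l => mixA E R S l (s.1 l)
  set LB : ∀ l, BOut (s.2 l) → Matrix (HB l) (HB l) ℂ := fun l => mixB E R S l (s.2 l)
  have hKA : ∀ l, IsPOVM (KA l) := fun l => isPOVM_elemA E l _
  have hKB : ∀ l, IsPOVM (KB l) := fun l => isPOVM_elemB E l _
  have hLA : ∀ l, IsPOVM (LA l) := fun l => isPOVM_mixA E R S l _
  have hLB : ∀ l, IsPOVM (LB l) := fun l => isPOVM_mixB E R S l _
  have hone : (((1 : Matrix (∀ l, HA l) (∀ l, HA l) ℂ) ⊗ₖ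
      (1 : Matrix (∀ l, HB l) (∀ l, HB l) ℂ)) * E.ρ.1).trace.re = 1 := by
    rw [Matrix.one_kronecker_one, Matrix.one_mul, E.ρ.2.2, Complex.one_re]
  have hsum : ∑ l, (if l ∈ S then η else 0) = S.card * η := by
    rw [Finset.sum_ite_mem, Finset.univ_inter, Finset.sum_const, nsmul_eq_mul]
  have hA : ∑ b : ∀ l, BOut (s.2 l), ∑ a : ∀ l, AOut (s.1 l),
      |(((tensorMat fun l => KA l (a l)) ⊗ₖ tensorMat fun l => KB l (b l)) * E.ρ.1).trace.re -
        (((tensorMat fun l => LA l (a l)) ⊗ₖ tensorMat fun l => KB l (b l)) * E.ρ.1).trace.re|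
      ≤ S.card * η := by
    have h1 : ∑ b : ∀ l, BOut (s.2 l),
        leftFunctional (tensorMat fun l => KB l (b l)) E.ρ.1 1 = 1 := by
      have := map_sum (rightFunctional (1 : Matrix (∀ l, HA l) (∀ l, HA l) ℂ) E.ρ.1)
        (fun b : ∀ l, BOut (s.2 l) => tensorMat fun l => KB l (b l)) Finset.univ
      rw [(IsPOVM.tensor hKB).2] at this
      exact this.symm.trans hone
    calc _ ≤ ∑ b : ∀ l, BOut (s.2 l), (S.card * η) *
          leftFunctional (tensorMat fun l => KB l (b l)) E.ρ.1 1 := by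
          refine Finset.sum_le_sum fun b _ => ?_
          rw [← hsum]
          exact sum_abs_tensor_sub_le (φ := leftFunctional (tensorMat fun l => KB l (b l)) E.ρ.1)
            (fun A hA => re_trace_mul_nonneg
              (hA.kronecker ((IsPOVM.tensor hKB).1 b)) E.ρ.2.1) hKA hLA
            (fun l => opClose_elemA_mixA hη h S l _)
      _ = S.card * η := by rw [← Finset.mul_sum, h1, mul_one]
  have hB : ∑ a : ∀ l, AOut (s.1 l), ∑ b : ∀ l, BOut (s.2 l),
      |(((tensorMat fun l => LA l (a l)) ⊗ₖ tensorMat fun l => KB l (b l)) * E.ρ.1).trace.re -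
        (((tensorMat fun l => LA l (a l)) ⊗ₖ tensorMat fun l => LB l (b l)) * E.ρ.1).trace.re|
      ≤ S.card * η := by
    have h1 : ∑ a : ∀ l, AOut (s.1 l),
        rightFunctional (tensorMat fun l => LA l (a l)) E.ρ.1 1 = 1 := by
      have := map_sum (leftFunctional (1 : Matrix (∀ l, HB l) (∀ l, HB l) ℂ) E.ρ.1)
        (fun a : ∀ l, AOut (s.1 l) => tensorMat fun l => LA l (a l)) Finset.univ
      rw [(IsPOVM.tensor hLA).2] at this
      exact this.symm.trans hone
    calc _ ≤ ∑ a : ∀ l, AOut (s.1 l), (S.card * η) *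
          rightFunctional (tensorMat fun l => LA l (a l)) E.ρ.1 1 := by
          refine Finset.sum_le_sum fun a _ => ?_
          rw [← hsum]
          exact sum_abs_tensor_sub_le (φ := rightFunctional (tensorMat fun l => LA l (a l)) E.ρ.1)
            (fun A hA => re_trace_mul_nonneg
              (((IsPOVM.tensor hLA).1 a).kronecker hA) E.ρ.2.1) hKB hLB
            (fun l => opClose_elemB_mixB hη h S l _)
      _ = S.card * η := by rw [← Finset.mul_sum, h1, mul_one]
  rw [Finset.sum_comm] at hA
  rw [two_mul, Fintype.sum_prod_type]
  refine le_trans ?_ (add_le_add hA hB)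
  rw [← Finset.sum_add_distrib]
  refine Finset.sum_le_sum fun a _ => ?_
  rw [← Finset.sum_add_distrib]
  exact Finset.sum_le_sum fun b _ => abs_sub_le _ _ _

lemma IsPOVM.tensor_kronecker_tensor {OA OB : Fin n → Type} [∀ l, Fintype (OA l)]
    [∀ l, Fintype (OB l)] {M : ∀ l, OA l → Matrix (HA l) (HA l) ℂ}
    {N : ∀ l, OB l → Matrix (HB l) (HB l) ℂ} (hM : ∀ l, IsPOVM (M l)) (hN : ∀ l, IsPOVM (N l)) :
    IsPOVM fun o : (∀ l, OA l) × (∀ l, OB l) =>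
      (tensorMat fun l => M l (o.1 l)) ⊗ₖ (tensorMat fun l => N l (o.2 l)) :=
  ⟨fun o => ((IsPOVM.tensor hM).1 o.1).kronecker ((IsPOVM.tensor hN).1 o.2),
    (IsPOVM.kronecker (IsPOVM.tensor hM) (IsPOVM.tensor hN)).2⟩

variable (E R) in
lemma isPOVM_mix (S : Finset (Fin n)) (s : Settings n) :
    IsPOVM fun o : Outcomes s => (tensorMat fun l => mixA E R S l (s.1 l) (o.1 l)) ⊗ₖ
      (tensorMat fun l => mixB E R S l (s.2 l) (o.2 l)) :=
  IsPOVM.tensor_kronecker_tensor (M := fun l => mixA E R S l (s.1 l))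
    (N := fun l => mixB E R S l (s.2 l)) (fun l => isPOVM_mixA E R S l (s.1 l))
    (fun l => isPOVM_mixB E R S l (s.2 l))

/-- The physical expectation value of a function of the outcomes, compared with the reference
state and ideal measurements of the parties in `S`. -/
lemma abs_born_sub_reference_le {η : ℝ} (hη : 0 ≤ η) (h : measError E R ≤ ENNReal.ofReal η)
    (S : Finset (Fin n)) (s : Settings n) (τ : QState (Fin n → Fin 2)) {g : Outcomes s → ℝ}
    (hg : ∀ o, |g o| ≤ 1) :
    |∑ o, g o * E.born s o - ∑ o, g o * mixProb E R S s (R.state τ) o| ≤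
      2 * (S.card * η) + 2 * traceDist E.ρ.1 (R.state τ) := by
  refine (abs_sub_le _ (∑ o, g o * mixProb E R S s E.ρ.1 o) _).trans (add_le_add ?_ ?_)
  · refine le_trans ?_ (sum_abs_born_sub_mixProb_le hη h S s)
    rw [← Finset.sum_sub_distrib]
    refine (Finset.abs_sum_le_sum_abs _ _).trans (Finset.sum_le_sum fun o _ => ?_)
    rw [← mul_sub, abs_mul]
    exact mul_le_of_le_one_left (abs_nonneg _) (hg o)
  · exact (isPOVM_mix E R S s).abs_sum_re_trace_sub_le hg _ _

lemma born_nonneg (s : Settings n) (o : Outcomes s) : 0 ≤ E.born s o :=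
  re_trace_mul_nonneg ((tensorMat_posSemidef fun l => (isPOVM_elemA E l _).1 _).kronecker
    (tensorMat_posSemidef fun l => (isPOVM_elemB E l _).1 _)) E.ρ.2.1

lemma sum_born (s : Settings n) : ∑ o, E.born s o = 1 := by
  have h := (IsPOVM.kronecker (IsPOVM.tensor fun l => isPOVM_elemA E l (s.1 l))
    (IsPOVM.tensor fun l => isPOVM_elemB E l (s.2 l))).2
  have h2 := congrArg (fun X => (X * E.ρ.1).trace.re) h
  simp only [Matrix.sum_mul, Matrix.trace_sum, Complex.re_sum, Matrix.one_mul, E.ρ.2.2,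
    Complex.one_re] at h2
  exact h2

/-- Pulling a product operator back along the local isometries. -/
lemma trace_mul_state (A : ∀ l, Matrix (HA l) (HA l) ℂ) (B : ∀ l, Matrix (HB l) (HB l) ℂ)
    (τ : QState (Fin n → Fin 2)) :
    ((tensorMat A ⊗ₖ tensorMat B) * R.state τ).trace =
      (((tensorMat fun l => (R.VA l)ᴴ * A l * R.VA l) ⊗ₖ
        (tensorMat fun l => (R.VB l)ᴴ * B l * R.VB l)) * refState τ.1).trace := by
  rw [Embedding.state, Matrix.mul_assoc, ← Matrix.mul_assoc, Matrix.trace_mul_comm,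
    ← tensorMat_mul, ← tensorMat_mul, ← tensorMat_mul, ← tensorMat_mul, ← conjTranspose_tensorMat,
    ← conjTranspose_tensorMat, Matrix.mul_kronecker_mul, Matrix.mul_kronecker_mul,
    Matrix.conjTranspose_kronecker]
  simp only [Matrix.mul_assoc]
  rw [Matrix.trace_mul_comm]
  simp only [Matrix.mul_assoc]

/-- The expectation value of a product of functions of the local outcomes. The hypotheses name the
products of one-qubit operators into which the weighted sums of measurement operators turn on the
reference space. -/
lemma sum_weights_mixProb (S : Finset (Fin n)) (s : Settings n) (τ : QState (Fin n → Fin 2))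
    (wA : ∀ l, AOut (s.1 l) → ℝ) (wB : ∀ l, BOut (s.2 l) → ℝ)
    (U : ∀ l : Fin n, Regs l → Matrix (Fin 2) (Fin 2) ℂ) (V : Fin n → Matrix (Fin 2) (Fin 2) ℂ)
    (hU : ∀ l, ∑ a, (wA l a : ℂ) • ((R.VA l)ᴴ * mixA E R S l (s.1 l) a * R.VA l) = tensorMat (U l))
    (hV : ∀ l, ∑ b, (wB l b : ℂ) • ((R.VB l)ᴴ * mixB E R S l (s.2 l) b * R.VB l) = V l) :
    ∑ o, ((∏ l, wA l (o.1 l)) * ∏ l, wB l (o.2 l)) * mixProb E R S s (R.state τ) o =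
      (((tensorMat fun l => U l (regT l)) * τ.1).trace * ((∏ l, bellExp (U l (regS l)) (V l)) *
        ∏ e : Link n,
          bellExp (U e.1 ⟨.Rright, e.2⟩) (U e.next ⟨.Rleft, Nat.succ_pos _⟩))).re := by
  rw [← trace_product_mul_refState]
  rw [show (fun l => tensorMat (U l)) = _ from funext fun l => (hU l).symm,
    show V = _ from funext fun l => (hV l).symm, tensorMat_sum, tensorMat_sum]
  have hk : ∀ (F : (∀ l, AOut (s.1 l)) → Matrix (∀ l : Fin n, RefA l) (∀ l : Fin n, RefA l) ℂ)
      (G : (∀ l, BOut (s.2 l)) → Matrix (Fin n → Fin 2) (Fin n → Fin 2) ℂ),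
      (∑ a, F a) ⊗ₖ (∑ b, G b) = ∑ o : Outcomes s, F o.1 ⊗ₖ G o.2 := by
    intro F G
    ext i j
    simp [Matrix.sum_apply, Matrix.kroneckerMap_apply, Finset.sum_mul_sum, Fintype.sum_prod_type]
  rw [hk, Matrix.sum_mul, Matrix.trace_sum, Complex.re_sum]
  refine Finset.sum_congr rfl fun o _ => ?_
  rw [tensorMat_smul, tensorMat_smul, Matrix.smul_kronecker, Matrix.kronecker_smul, smul_smul,
    Matrix.smul_mul, Matrix.trace_smul, smul_eq_mul, ← Complex.ofReal_prod, ← Complex.ofReal_prod,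
    ← Complex.ofReal_mul, Complex.re_ofReal_mul, mixProb, trace_mul_state]

end Physical

/-! ### Reference values of the three tests -/

section Values

variable {n : ℕ} {HA HB : Fin n → Type} [∀ l, Fintype (HA l)] [∀ l, DecidableEq (HA l)]
  [∀ l, Fintype (HB l)] [∀ l, DecidableEq (HB l)] {E : Experiment HA HB} {R : Embedding HA HB}

lemma conj_idealA (l : Fin n) (x : ASetting) (h : Relevant l x) (a : x.Out) :
    (R.VA l)ᴴ * idealA E R l (some x) a * R.VA l = refMeasA l x h a := by
  rw [idealA_some E R l x h, Matrix.mul_assoc, R.M_extends, ← Matrix.mul_assoc,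
    R.VA_isometry, Matrix.one_mul]

lemma conj_idealB (l : Fin n) (y : Pauli) (b : Fin 2) :
    (R.VB l)ᴴ * (R.N l y).elem b * R.VB l = refMeasB y b := by
  rw [Matrix.mul_assoc, R.N_extends, ← Matrix.mul_assoc, R.VB_isometry, Matrix.one_mul]

lemma IsPOVM.sum_conj {O α β : Type*} [Fintype O] [Fintype α] [DecidableEq α] [DecidableEq β]
    {M : O → Matrix α α ℂ} (hM : IsPOVM M) {V : Matrix α β ℂ} (hV : Vᴴ * V = 1) :
    ∑ a, ((1 : ℝ) : ℂ) • (Vᴴ * M a * V) = 1 := by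
  simp only [Complex.ofReal_one, one_smul]
  rw [← Matrix.sum_mul, ← Matrix.mul_sum, hM.2, Matrix.mul_one, hV]

/-- The observable of a CHSH input on the reference space. -/
lemma sum_signA_idealA (l : Fin n) (x : Fin 6) (z : Option ASetting) (hz : z = some (.chsh x)) :
    ∑ a, (signA z a : ℂ) • ((R.VA l)ᴴ * idealA E R l z a * R.VA l) =
      tensorMat (Function.update (fun _ : Regs l => 1) (regS l) (chshObs x)) := by
  subst hz
  rw [← onReg_eq_tensorMat, ← sum_sign_binElem (chshObs x), onReg_sum]
  refine Finset.sum_congr rfl fun a _ => ?_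
  refine (congrArg (((signA (some (.chsh x)) a : ℝ) : ℂ) • ·)
    (conj_idealA (E := E) l (.chsh x) trivial a)).trans ?_
  simp [signA, refMeasA]

/-- The observable of a Pauli input on the reference space. -/
lemma sum_sign_idealB (l : Fin n) (y : Pauli) (z : Option Pauli) (hz : z = some y) :
    ∑ b, (((-1) ^ (bitB z b).val : ℝ) : ℂ) • ((R.VB l)ᴴ * idealB R l z b * R.VB l) = y.mat := by
  subst hz
  rw [← sum_sign_binElem y.mat]
  refine Finset.sum_congr rfl fun a _ => ?_
  rw [idealB, conj_idealB]
  simp [bitB, refMeasB]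

/-- The corrected observable `P ⊗ Pᵀ` on `R^▷ S` for the input `▷`. -/
lemma sum_flipSign_right (l : Fin n) (h : l.val + 1 < n) (P : Pauli) (z : Option ASetting)
    (hz : z = some .right) :
    ∑ a, (flipSign P (pairA z a) : ℂ) • ((R.VA l)ᴴ * idealA E R l z a * R.VA l) =
      tensorMat (Function.update (Function.update (fun _ : Regs l => 1) (regS l) P.matᵀ)
        (⟨.Rright, h⟩ : Regs l) P.mat) := by
  subst hz
  have hne : (⟨.Rright, h⟩ : Regs l) ≠ regS l := by simp [regS, Subtype.ext_iff]
  rw [← onRegs_kronecker_eq_tensorMat hne, ← sum_flipSign_bellProj P, onRegs_sum]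
  refine Finset.sum_congr rfl fun a _ => ?_
  refine (congrArg (((flipSign P (pairA (some .right) a) : ℝ) : ℂ) • ·)
    (conj_idealA (E := E) l .right h a)).trans ?_
  simp [pairA, refMeasA]

/-- The corrected observable `P ⊗ Pᵀ` on `R^◁ S` for the input `◁`. -/
lemma sum_flipSign_left (l : Fin n) (h : 0 < l.val) (P : Pauli) (z : Option ASetting)
    (hz : z = some .left) :
    ∑ a, (flipSign P (pairA z a) : ℂ) • ((R.VA l)ᴴ * idealA E R l z a * R.VA l) =
      tensorMat (Function.update (Function.update (fun _ : Regs l => 1) (regS l) P.matᵀ)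
        (⟨.Rleft, h⟩ : Regs l) P.mat) := by
  subst hz
  have hne : (⟨.Rleft, h⟩ : Regs l) ≠ regS l := by simp [regS, Subtype.ext_iff]
  rw [← onRegs_kronecker_eq_tensorMat hne, ← sum_flipSign_bellProj P, onRegs_sum]
  refine Finset.sum_congr rfl fun a _ => ?_
  refine (congrArg (((flipSign P (pairA (some .left) a) : ℝ) : ℂ) • ·)
    (conj_idealA (E := E) l .left h a)).trans ?_
  simp [pairA, refMeasA]

/-- The observable `chshObs x` on the qubit `S` of party `l`, by registers of the main parties. -/
def chshString (l : Fin n) (x : Fin 6) (l' : Fin n) (r : Regs l') : Matrix (Fin 2) (Fin 2) ℂ :=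
  if r.1 = .S ∧ l' = l then chshObs x else 1

/-- Every CHSH correlator has the reference value `± 1/√2`. -/
theorem chsh_reference_value (s : Settings n) (τ : QState (Fin n → Fin 2)) (l : Fin n) (k : Fin 3)
    (i j : Fin 2) (hA : s.1 l = some (.chsh (chshX i k))) (hB : s.2 l = some (chshY j k)) :
    ∑ o, ((-1) ^ (i.val * j.val) * (signA (s.1 l) (o.1 l) * (-1) ^ (bitB (s.2 l) (o.2 l)).val)) *
      mixProb E R {l} s (R.state τ) o = (Real.sqrt 2)⁻¹ := by
  have h := sum_weights_mixProb (E := E) (R := R) {l} s τ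
    (fun l' a => if l' = l then signA (s.1 l') a else 1)
    (fun l' b => if l' = l then (-1) ^ (bitB (s.2 l') b).val else 1)
    (chshString l (chshX i k)) (fun l' => if l' = l then (chshY j k).mat else 1) ?_ ?_
  · have hw : ∀ o : Outcomes s,
        (∏ l', if l' = l then signA (s.1 l') (o.1 l') else 1) *
          (∏ l', if l' = l then (-1 : ℝ) ^ (bitB (s.2 l') (o.2 l')).val else 1)
        = signA (s.1 l) (o.1 l) * (-1) ^ (bitB (s.2 l) (o.2 l)).val := by
      intro o
      rw [Fintype.prod_ite_eq', Fintype.prod_ite_eq']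
    simp only [hw] at h
    simp only [mul_assoc ((-1 : ℝ) ^ (i.val * j.val)), ← Finset.mul_sum, h]
    have hT : (tensorMat fun l' => chshString l (chshX i k) l' (regT l')) = 1 := by
      rw [← tensorMat_one]
      congr 1
    have hS : ∏ l', bellExp (chshString l (chshX i k) l' (regS l'))
        (if l' = l then (chshY j k).mat else 1) =
        bellExp (chshObs (chshX i k)) (chshY j k).mat := by
      rw [Finset.prod_eq_single l]
      · simp [chshString, regS]
      · intro l' _ hl; simp [chshString, hl, bellExp_one]
      · simp
    have hL : ∏ e : Link n, bellExp (chshString l (chshX i k) e.1 ⟨.Rright, e.2⟩)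
        (chshString l (chshX i k) e.next ⟨.Rleft, Nat.succ_pos _⟩) = 1 :=
      Finset.prod_eq_one fun e _ => by simp [chshString, bellExp_one]
    rw [hT, hS, hL, Matrix.one_mul, τ.2.2, one_mul, mul_one, ← Complex.re_ofReal_mul,
      Complex.ofReal_pow, Complex.ofReal_neg, Complex.ofReal_one, bellExp_chsh, Complex.ofReal_re]
  · intro l'
    by_cases hl : l' = l
    · subst hl
      simp only [if_true, mixA, Finset.mem_singleton]
      rw [sum_signA_idealA l' _ _ hA]
      congr 1
      funext r
      simp [chshString, Function.update_apply, Subtype.ext_iff, regS]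
    · simp only [hl, if_false]
      rw [(isPOVM_mixA E R {l} l' _).sum_conj (R.VA_isometry l'), ← tensorMat_one]
      congr 1
      funext r
      simp [chshString, hl]
  · intro l'
    by_cases hl : l' = l
    · subst hl
      simp only [if_true, mixB, Finset.mem_singleton]
      exact sum_sign_idealB l' _ _ hB
    · simp only [hl, if_false]
      exact (isPOVM_mixB E R {l} l' _).sum_conj (R.VB_isometry l')

/-- The Pauli string `P_{R^▷_l} ⊗ Pᵀ_{S_l} ⊗ P_{R^◁_{l+1}} ⊗ Pᵀ_{S_{l+1}}` of a link, by registers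
of the main parties. -/
def linkString (e : Link n) (P : Pauli) (l : Fin n) (r : Regs l) : Matrix (Fin 2) (Fin 2) ℂ :=
  if r.1 = .S ∧ (l = e.1 ∨ l = e.next) then P.matᵀ
  else if (r.1 = .Rright ∧ l = e.1) ∨ (r.1 = .Rleft ∧ l = e.next) then P.mat
  else 1

lemma Link.ne_next (e : Link n) : e.1 ≠ e.next := by
  intro h
  have := congrArg Fin.val h
  simp [Link.next] at this

lemma Link.next_injective : Function.Injective (Link.next (n := n)) := by
  intro e e' h
  have := congrArg Fin.val h
  simp only [Link.next, Nat.add_right_cancel_iff] at this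
  exact Subtype.ext (Fin.ext this)

/-- The corrected Pauli correlations on a link have the reference value `-1` for `Y` and `1` for
`X` and `Z`. -/
theorem link_reference_value (s : Settings n) (τ : QState (Fin n → Fin 2)) (e : Link n) (P : Pauli)
    (hA : s.1 e.1 = some .right) (hA' : s.1 e.next = some .left)
    (hB : s.2 e.1 = some P) (hB' : s.2 e.next = some P) :
    ∑ o, ((flipSign P (pairA (s.1 e.1) (o.1 e.1)) * flipSign P (pairA (s.1 e.next) (o.1 e.next))) *
      ((-1) ^ (bitB (s.2 e.1) (o.2 e.1)).val * (-1) ^ (bitB (s.2 e.next) (o.2 e.next)).val)) *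
      mixProb E R {e.1, e.next} s (R.state τ) o = if P = .Y then -1 else 1 := by
  have h := sum_weights_mixProb (E := E) (R := R) {e.1, e.next} s τ
    (fun l a => if l = e.1 ∨ l = e.next then flipSign P (pairA (s.1 l) a) else 1)
    (fun l b => if l = e.1 ∨ l = e.next then (-1) ^ (bitB (s.2 l) b).val else 1)
    (linkString e P) (fun l => if l = e.1 ∨ l = e.next then P.mat else 1) ?_ ?_
  · have hpair : ∀ f : Fin n → ℝ, (∏ l, if l = e.1 ∨ l = e.next then f l else 1)
        = f e.1 * f e.next := by
      intro f
      rw [← Finset.prod_pair e.ne_next, ← Finset.prod_filter]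
      refine Finset.prod_congr ?_ fun _ _ => rfl
      ext l; simp
    simp only [hpair (fun l => flipSign P (pairA (s.1 l) _)),
      hpair (fun l => (-1 : ℝ) ^ (bitB (s.2 l) _).val)] at h
    rw [h]
    have hT : (tensorMat fun l => linkString e P l (regT l)) = 1 := by
      rw [← tensorMat_one]
      congr 1
    have hS : ∏ l, bellExp (linkString e P l (regS l)) (if l = e.1 ∨ l = e.next then P.mat else 1)
        = 1 := by
      refine Finset.prod_eq_one fun l _ => ?_
      by_cases hl : l = e.1 ∨ l = e.next
      · simp [linkString, regS, hl, bellExp_transpose_pauli]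
      · simp [linkString, regS, hl, bellExp_one]
    have hL : ∏ e' : Link n, bellExp (linkString e P e'.1 ⟨.Rright, e'.2⟩)
        (linkString e P e'.next ⟨.Rleft, Nat.succ_pos _⟩) = if P = .Y then -1 else 1 := by
      rw [Finset.prod_eq_single e]
      · simp [linkString, bellExp_pauli]
      · intro e' _ he
        have h1 : e'.1 ≠ e.1 := fun h => he (Subtype.ext h)
        have h2 : e'.next ≠ e.next := fun h => he (Link.next_injective h)
        simp [linkString, h1, h2, bellExp_one]
      · simp
    rw [hT, hS, hL, Matrix.one_mul, τ.2.2, one_mul, one_mul]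
    split_ifs <;> simp
  · intro l
    by_cases h1 : l = e.1
    · subst h1
      simp only [true_or, if_true, mixA, Finset.mem_insert]
      rw [sum_flipSign_right e.1 e.2 P _ hA]
      congr 1
      funext ⟨r, hr⟩
      cases r <;> simp [linkString, Subtype.ext_iff, regS, e.ne_next]
    · by_cases h2 : l = e.next
      · subst h2
        simp only [or_true, if_true, mixA, Finset.mem_insert, Finset.mem_singleton]
        rw [sum_flipSign_left e.next (Nat.succ_pos _) P _ hA']
        congr 1
        funext ⟨r, hr⟩
        cases r <;> simp [linkString, Subtype.ext_iff, regS, e.ne_next.symm]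
      · simp only [h1, h2, or_self, if_false]
        rw [(isPOVM_mixA E R _ l _).sum_conj (R.VA_isometry l), ← tensorMat_one]
        congr 1
        funext r
        simp [linkString, h1, h2]
  · intro l
    by_cases h1 : l = e.1
    · subst h1
      simp only [true_or, if_true, mixB, Finset.mem_insert]
      exact sum_sign_idealB _ _ _ hB
    · by_cases h2 : l = e.next
      · subst h2
        simp only [or_true, if_true, mixB, Finset.mem_insert, Finset.mem_singleton]
        exact sum_sign_idealB _ _ _ hB'
      · simp only [h1, h2, or_self, if_false]
        exact (isPOVM_mixB E R _ l _).sum_conj (R.VB_isometry l)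

end Values

/-! ### The teleportation test -/

section Teleportation

variable {n : ℕ} {HA HB : Fin n → Type} [∀ l, Fintype (HA l)] [∀ l, DecidableEq (HA l)]
  [∀ l, Fintype (HB l)] [∀ l, DecidableEq (HB l)] {E : Experiment HA HB} {R : Embedding HA HB}

/-- The settings of the third test: `⋄` for all main parties and Pauli inputs `P`. -/
def teleSettings (P : Fin n → Pauli) : Settings n := (fun _ => some .tele, fun l => some (P l))

/-- The block of a two-qubit operator for given indices of the first qubit. -/
def blockSnd (M : Matrix (Fin 2 × Fin 2) (Fin 2 × Fin 2) ℂ) (p : Fin 2 × Fin 2) :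
    Matrix (Fin 2) (Fin 2) ℂ := Matrix.of fun s t => M (p.1, s) (p.2, t)

lemma eq_sum_single_kronecker (M : Matrix (Fin 2 × Fin 2) (Fin 2 × Fin 2) ℂ) :
    M = ∑ p : Fin 2 × Fin 2, (1 : ℂ) • (Matrix.single p.1 p.2 (1 : ℂ) ⊗ₖ blockSnd M p) := by
  ext ⟨x, s⟩ ⟨y, t⟩
  simp only [one_smul, Matrix.sum_apply, Matrix.kroneckerMap_apply]
  rw [Finset.sum_eq_single (x, y)]
  · simp [blockSnd]
  · rintro ⟨x', y'⟩ _ h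
    rw [Matrix.single_apply, if_neg, zero_mul]
    rintro ⟨rfl, rfl⟩
    exact h rfl
  · simp

/-- The operator that a Bell projector on `T S` and a Pauli projector on `B` induce on `T`. -/
lemma sum_bellExp_blockSnd (P : Pauli) (a : Fin 2 × Fin 2) (b : Fin 2) :
    ∑ p : Fin 2 × Fin 2, bellExp (blockSnd (bellProj a) p) (binElem P.mat b) •
      Matrix.single p.1 p.2 (1 : ℂ) = (1 / 4 : ℂ) • binElem P.mat (corrOut b P a) := by
  rw [← corrU_conj_binElem]
  ext x y
  rw [Matrix.sum_apply, Finset.sum_eq_single (x, y)]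
  · simp only [Matrix.smul_apply, Matrix.single_apply_same, smul_eq_mul, mul_one, bellExp,
      blockSnd, Matrix.of_apply, bellProj_apply, Matrix.mul_apply, Matrix.conjTranspose_apply,
      Fin.sum_univ_two]
    ring
  · rintro ⟨x', y'⟩ _ h
    rw [Matrix.smul_apply, Matrix.single_apply, if_neg, smul_zero]
    rintro ⟨rfl, rfl⟩
    exact h rfl
  · simp

/-- The operators on the registers of a main party in the expansion of a Bell projector on
`T S`. -/
def teleString (a : Fin 2 × Fin 2) (p : Fin 2 × Fin 2) (l : Fin n) (r : Regs l) :
    Matrix (Fin 2) (Fin 2) ℂ :=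
  if r.1 = .T then Matrix.single p.1 p.2 1 else if r.1 = .S then blockSnd (bellProj a) p else 1

lemma onRegs_bellProj (a : Fin 2 × Fin 2) (l : Fin n) :
    onRegs (regT l) (regS l) (bellProj a) = ∑ p, tensorMat (teleString a p l) := by
  have hne : regT l ≠ regS l := by simp [regS, regT, Subtype.ext_iff]
  rw [eq_sum_single_kronecker (bellProj a), onRegs_sum]
  refine Finset.sum_congr rfl fun p _ => ?_
  rw [one_smul, onRegs_kronecker_eq_tensorMat hne]
  congr 1
  funext r
  simp [teleString, Function.update_apply, regS, regT, Subtype.ext_iff]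

/-- In the reference experiment all outcomes of the Bell measurements on `T_l S_l` are equally
likely, and the corrected outcomes of the auxiliary parties are those of Pauli measurements on
`τ`. -/
theorem tele_reference_value (P : Fin n → Pauli) (τ : QState (Fin n → Fin 2))
    (o : Outcomes (teleSettings P)) :
    mixProb E R Finset.univ (teleSettings P) (R.state τ) o = (1 / 4) ^ n *
      ((tensorMat fun l => binElem (P l).mat (corrOut (bitB _ (o.2 l)) (P l) (pairA _ (o.1 l))))
        * τ.1).trace.re := by
  let a : Fin n → Fin 2 × Fin 2 := o.1
  let b : Fin n → Fin 2 := o.2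
  have hA : ∀ l, (R.VA l)ᴴ * mixA E R Finset.univ l (some .tele) (o.1 l) * R.VA l
      = ∑ p, tensorMat (teleString (a l) p l) := by
    intro l
    rw [← onRegs_bellProj]
    simp only [mixA, Finset.mem_univ, if_true]
    exact conj_idealA (E := E) l .tele trivial (a l)
  have hB : ∀ l, (R.VB l)ᴴ * mixB E R Finset.univ l (some (P l)) (o.2 l) * R.VB l
      = binElem (P l).mat (b l) := by
    intro l
    simp only [mixB, Finset.mem_univ, if_true]
    exact conj_idealB l (P l) (b l)
  have hgoal : (((tensorMat fun l => ∑ p, tensorMat (teleString (a l) p l)) ⊗ₖ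
      (tensorMat fun l => binElem (P l).mat (b l))) * refState τ.1).trace = (1 / 4) ^ n *
      ((tensorMat fun l => binElem (P l).mat (corrOut (b l) (P l) (a l))) * τ.1).trace := by
    have hk : ∀ (F : (Fin n → Fin 2 × Fin 2) →
        Matrix (∀ l : Fin n, RefA l) (∀ l : Fin n, RefA l) ℂ)
        (G : Matrix (Fin n → Fin 2) (Fin n → Fin 2) ℂ),
        (∑ q, F q) ⊗ₖ G = ∑ q, F q ⊗ₖ G := by
      intro F G
      ext i j
      simp [Matrix.sum_apply, Matrix.kroneckerMap_apply, Finset.sum_mul]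
    have hrhs : (1 / 4 : ℂ) ^ n *
        ((tensorMat fun l => binElem (P l).mat (corrOut (b l) (P l) (a l))) * τ.1).trace =
        ((tensorMat fun l => (1 / 4 : ℂ) • binElem (P l).mat (corrOut (b l) (P l) (a l)))
          * τ.1).trace := by
      rw [tensorMat_smul, Matrix.smul_mul, Matrix.trace_smul, Finset.prod_const, Finset.card_univ,
        Fintype.card_fin, smul_eq_mul]
    rw [hrhs, show (fun l => (1 / 4 : ℂ) • binElem (P l).mat (corrOut (b l) (P l) (a l))) = _ from
      funext fun l => (sum_bellExp_blockSnd (P l) (a l) (b l)).symm, tensorMat_sum, tensorMat_sum,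
      hk, Matrix.sum_mul, Matrix.sum_mul, Matrix.trace_sum, Matrix.trace_sum]
    refine Finset.sum_congr rfl fun q _ => ?_
    rw [trace_product_mul_refState (fun l => teleString (a l) (q l) l), tensorMat_smul,
      Matrix.smul_mul, Matrix.trace_smul, smul_eq_mul, mul_comm]
    congr 1
    rw [Finset.prod_eq_one (s := (Finset.univ : Finset (Link n)))
      (fun e _ => by simp [teleString, bellExp_one]), mul_one]
    rfl
  have h := trace_mul_state (R := R) (fun l => mixA E R Finset.univ l (some .tele) (o.1 l))
    (fun l => mixB E R Finset.univ l (some (P l)) (o.2 l)) τ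
  rw [show (fun l => (R.VA l)ᴴ * mixA E R Finset.univ l (some .tele) (o.1 l) * R.VA l) = _ from
    funext hA, show (fun l => (R.VB l)ᴴ * mixB E R Finset.univ l (some (P l)) (o.2 l) * R.VB l) = _
    from funext hB, hgoal] at h
  have h4 : ((1 / 4 : ℂ) ^ n) = (((1 / 4 : ℝ) ^ n : ℝ) : ℂ) := by push_cast; rfl
  rw [h4] at h
  exact (congrArg Complex.re h).trans (Complex.re_ofReal_mul _ _)

/-- The reference value of the third test for fixed Pauli inputs. -/
theorem sum_weight_tele_reference_value (P : Fin n → Pauli) (τ : QState (Fin n → Fin 2))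
    (w : (Fin n → Fin 2) → ℝ) :
    ∑ o : Outcomes (teleSettings P),
      w (fun l => corrOut (bitB _ (o.2 l)) (P l) (pairA _ (o.1 l))) *
        mixProb E R Finset.univ (teleSettings P) (R.state τ) o =
      ∑ c, w c * ((tensorMat fun l => binElem (P l).mat (c l)) * τ.1).trace.re := by
  set F : (Fin n → Fin 2) → ℝ := fun c =>
    w c * ((tensorMat fun l => binElem (P l).mat (c l)) * τ.1).trace.re with hF
  have h1 : ∀ o : Outcomes (teleSettings P),
      w (fun l => corrOut (bitB _ (o.2 l)) (P l) (pairA _ (o.1 l))) *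
        mixProb E R Finset.univ (teleSettings P) (R.state τ) o
      = (1 / 4) ^ n * F (fun l => corrOut (bitB _ (o.2 l)) (P l) (pairA _ (o.1 l))) := by
    intro o
    rw [tele_reference_value, hF]
    ring
  rw [Finset.sum_congr rfl fun o _ => h1 o, ← Finset.mul_sum]
  have h2 : ∑ o : Outcomes (teleSettings P),
      F (fun l => corrOut (bitB _ (o.2 l)) (P l) (pairA _ (o.1 l)))
      = ∑ a : Fin n → Fin 2 × Fin 2, ∑ b : Fin n → Fin 2,
        F (fun l => corrOut (b l) (P l) (a l)) := by
    rw [← Fintype.sum_prod_type']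
    rfl
  have h3 : ∀ a : Fin n → Fin 2 × Fin 2, ∑ b : Fin n → Fin 2,
      F (fun l => corrOut (b l) (P l) (a l)) = ∑ c, F c := by
    intro a
    have hinv : Function.Involutive fun (b : Fin n → Fin 2) l => corrOut (b l) (P l) (a l) :=
      fun b => funext fun l => corrOut_involutive (P l) (a l) (b l)
    exact hinv.bijective.sum_comp F
  rw [h2, Finset.sum_congr rfl fun a _ => h3 a, Finset.sum_const, Finset.card_univ, nsmul_eq_mul]
  have h4 : (Fintype.card (Fin n → Fin 2 × Fin 2) : ℝ) = 4 ^ n := by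
    simp
  rw [h4, ← mul_assoc, ← mul_pow]
  norm_num

end Teleportation

/-! ### Concentration of ratios of empirical sums -/

section Concentration

variable {Ω : Type*} [Fintype Ω] {p : Ω → ℝ} {N : ℕ}

/-- The probability of an event of `N` independent samples of the distribution `p`. -/
def iidProb (p : Ω → ℝ) (N : ℕ) (ev : Set (Fin N → Ω)) : ℝ :=
  ∑ t : Fin N → Ω, ev.indicator (fun t => ∏ m, p (t m)) t

lemma sum_prod_iid (f : Ω → ℝ) : ∑ t : Fin N → Ω, ∏ m, f (t m) = (∑ x, f x) ^ N := by
  rw [← Fintype.prod_sum fun (_ : Fin N) x => f x]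
  simp

lemma iidProb_univ (h1 : ∑ x, p x = 1) : iidProb p N Set.univ = 1 := by
  simp [iidProb, sum_prod_iid, h1]

/-- Union bound for the complement of an event. -/
lemma one_sub_sum_le_iidProb {I : Type*} [Fintype I] (hp : ∀ x, 0 ≤ p x) (h1 : ∑ x, p x = 1)
    {ev : Set (Fin N → Ω)} (bad : I → Set (Fin N → Ω))
    (h : ∀ t, (∀ i, t ∉ bad i) → t ∈ ev) : 1 - ∑ i, iidProb p N (bad i) ≤ iidProb p N ev := by
  rw [← iidProb_univ (N := N) h1, sub_le_iff_le_add]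
  simp only [iidProb]
  rw [Finset.sum_comm, ← Finset.sum_add_distrib]
  refine Finset.sum_le_sum fun t _ => ?_
  have h0 : 0 ≤ ∏ m, p (t m) := Finset.prod_nonneg fun m _ => hp _
  have hs : ∀ S : Set (Fin N → Ω), 0 ≤ S.indicator (fun t => ∏ m, p (t m)) t := fun S =>
    Set.indicator_nonneg (fun t _ => Finset.prod_nonneg fun m _ => hp _) t
  rw [Set.indicator_univ]
  by_cases ht : t ∈ ev
  · rw [Set.indicator_of_mem ht]
    exact le_add_of_nonneg_right (Finset.sum_nonneg fun i _ => hs _)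
  · have : ∃ i, t ∈ bad i := by
      by_contra hc
      push Not at hc
      exact ht (h t hc)
    obtain ⟨i, hi⟩ := this
    rw [Set.indicator_of_notMem ht, zero_add]
    refine le_trans (le_of_eq ?_) (Finset.single_le_sum (fun i _ => hs (bad i)) (Finset.mem_univ i))
    rw [Set.indicator_of_mem hi]

/-- A Chernoff bound for the ratio of the sums of a value `w` and of a hit indicator `u`. If the
conditional mean of `w` exceeds `a` by `η`, then the empirical ratio exceeds `a` except with
exponentially small probability. The bad event contains the case that there is no hit. -/
lemma iidProb_ratio_le (hp : ∀ x, 0 ≤ p x) (h1 : ∑ x, p x = 1) {u w : Ω → ℝ} {a B η q : ℝ}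
    (hu : ∀ x, u x = 0 ∨ u x = 1) (hw : ∀ x, |w x| ≤ B * u x) (hB : 0 < B) (ha : |a| ≤ B)
    (hη : 0 ≤ η) (hηB : η ≤ 4 * B) (hmean : (a + η) * ∑ x, p x * u x ≤ ∑ x, p x * w x)
    (hq : q ≤ ∑ x, p x * u x) :
    iidProb p N {t | ∑ m, w (t m) ≤ a * ∑ m, u (t m)} ≤
      Real.exp (-(N * (q * η ^ 2 / (16 * B ^ 2)))) := by
  -- `θ` minimizes the exponent `-θ η + 4 B² θ²` of the bound on the moment generating function
  set θ : ℝ := η / (8 * B ^ 2) with hθ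
  have hθ0 : 0 ≤ θ := by positivity
  set h : Ω → ℝ := fun x => a * u x - w x with hh
  have hu0 : ∀ x, 0 ≤ u x := fun x => by rcases hu x with h | h <;> norm_num [h]
  have hh1 : ∀ x, |h x| ≤ 2 * B * u x := by
    intro x
    calc |h x| ≤ |a * u x| + |w x| := abs_sub _ _
      _ ≤ B * u x + B * u x := by
        refine add_le_add ?_ (hw x)
        rw [abs_mul, abs_of_nonneg (hu0 x)]
        exact mul_le_mul_of_nonneg_right ha (hu0 x)
      _ = 2 * B * u x := by ring
  have hθB : θ * (2 * B) = η / (4 * B) := by rw [hθ]; field_simp; ring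
  have hexp : ∀ x, Real.exp (θ * h x) ≤ 1 + θ * h x + θ ^ 2 * (4 * B ^ 2) * u x := by
    intro x
    have hle : |θ * h x| ≤ 1 := by
      rw [abs_mul, abs_of_nonneg hθ0]
      calc θ * |h x| ≤ θ * (2 * B * u x) := mul_le_mul_of_nonneg_left (hh1 x) hθ0
        _ ≤ θ * (2 * B) := by
          refine mul_le_mul_of_nonneg_left (mul_le_of_le_one_right (by positivity) ?_) hθ0
          rcases hu x with h | h <;> norm_num [h]
        _ ≤ 1 := by rw [hθB, div_le_one (by positivity)]; exact hηB
    have h2 := (abs_le.1 (Real.abs_exp_sub_one_sub_id_le hle)).2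
    have h3 : (h x) ^ 2 ≤ 4 * B ^ 2 * u x := by
      have h4 : (h x) ^ 2 ≤ (2 * B * u x) ^ 2 := by
        rw [← sq_abs]
        exact pow_le_pow_left₀ (abs_nonneg _) (hh1 x) 2
      have h5 : (u x) ^ 2 = u x := by rcases hu x with h | h <;> norm_num [h]
      calc (h x) ^ 2 ≤ 4 * B ^ 2 * (u x) ^ 2 := by linarith
        _ = _ := by rw [h5]
    nlinarith [mul_le_mul_of_nonneg_left h3 (sq_nonneg θ)]
  set Q := ∑ x, p x * u x with hQ
  have hQ0 : 0 ≤ Q := Finset.sum_nonneg fun x _ => mul_nonneg (hp x) (hu0 x)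
  have hmgf : ∑ x, p x * Real.exp (θ * h x) ≤ Real.exp (-(q * η ^ 2 / (16 * B ^ 2))) := by
    have hmean' : ∑ x, p x * h x ≤ -(η * Q) := by
      have : ∑ x, p x * h x = a * Q - ∑ x, p x * w x := by
        rw [hQ, Finset.mul_sum, ← Finset.sum_sub_distrib]
        exact Finset.sum_congr rfl fun x _ => by rw [hh]; ring
      rw [this]; linarith
    calc ∑ x, p x * Real.exp (θ * h x)
        ≤ ∑ x, p x * (1 + θ * h x + θ ^ 2 * (4 * B ^ 2) * u x) :=
          Finset.sum_le_sum fun x _ => mul_le_mul_of_nonneg_left (hexp x) (hp x)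
      _ = 1 + θ * ∑ x, p x * h x + θ ^ 2 * (4 * B ^ 2) * Q := by
          conv_rhs => rw [← h1]
          rw [hQ, Finset.mul_sum, Finset.mul_sum, ← Finset.sum_add_distrib,
            ← Finset.sum_add_distrib]
          exact Finset.sum_congr rfl fun x _ => by ring
      _ ≤ 1 + θ * -(η * Q) + θ ^ 2 * (4 * B ^ 2) * Q := by gcongr
      _ = -(Q * η ^ 2 / (16 * B ^ 2)) + 1 := by rw [hθ]; field_simp; ring
      _ ≤ Real.exp (-(Q * η ^ 2 / (16 * B ^ 2))) := Real.add_one_le_exp _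
      _ ≤ _ := by
          refine Real.exp_le_exp.2 (neg_le_neg ?_)
          gcongr
  calc iidProb p N {t | ∑ m, w (t m) ≤ a * ∑ m, u (t m)}
      ≤ ∑ t : Fin N → Ω, ∏ m, (p (t m) * Real.exp (θ * h (t m))) := by
        refine Finset.sum_le_sum fun t _ => ?_
        have hP : 0 ≤ ∏ m, p (t m) := Finset.prod_nonneg fun m _ => hp _
        rw [Finset.prod_mul_distrib, ← Real.exp_sum]
        refine Set.indicator_apply_le' (fun ht => ?_) (fun _ => mul_nonneg hP (Real.exp_nonneg _))
        refine le_mul_of_one_le_right hP (Real.one_le_exp ?_)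
        rw [← Finset.mul_sum]
        refine mul_nonneg hθ0 ?_
        rw [Finset.sum_sub_distrib, ← Finset.mul_sum]
        exact sub_nonneg.2 ht
    _ = (∑ x, p x * Real.exp (θ * h x)) ^ N :=
        sum_prod_iid fun x => p x * Real.exp (θ * h x)
    _ ≤ (Real.exp (-(q * η ^ 2 / (16 * B ^ 2)))) ^ N :=
        pow_le_pow_left₀ (Finset.sum_nonneg fun x _ => mul_nonneg (hp x) (Real.exp_nonneg _)) hmgf N
    _ = _ := by rw [← Real.exp_nat_mul]; congr 1; ring

omit [Fintype Ω] in
/-- Outside the bad event the ratio exceeds `a`; the case of an empty sum, in which the quotient is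
`0` by convention, belongs to the bad event. -/
lemma lt_div_of_lt {u w : Ω → ℝ} {a B : ℝ} (hu : ∀ x, u x = 0 ∨ u x = 1)
    (hw : ∀ x, |w x| ≤ B * u x) (t : Fin N → Ω) (h : a * ∑ m, u (t m) < ∑ m, w (t m)) :
    a < (∑ m, w (t m)) / ∑ m, u (t m) := by
  have hu0 : ∀ x, 0 ≤ u x := fun x => by rcases hu x with h | h <;> norm_num [h]
  have hpos : 0 < ∑ m, u (t m) := by
    refine lt_of_le_of_ne (Finset.sum_nonneg fun m _ => hu0 _) fun h0 => ?_
    have h1 : ∑ m, w (t m) ≤ B * ∑ m, u (t m) := by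
      rw [Finset.mul_sum]
      exact Finset.sum_le_sum fun m _ => (le_abs_self _).trans (hw _)
    rw [← h0, mul_zero] at h h1
    linarith
  exact (lt_div_iff₀ hpos).2 h

end Concentration

/-! ### Expectations in one round -/

section Rounds

variable {n : ℕ} {HA HB : Fin n → Type} [∀ l, Fintype (HA l)] [∀ l, DecidableEq (HA l)]
  [∀ l, Fintype (HB l)] [∀ l, DecidableEq (HB l)] {E : Experiment HA HB} {R : Embedding HA HB}
  {Q : Sampling n} {𝒟 : (Fin n → Pauli) → ℝ}

/-- The settings that count for the CHSH correlator `(l, k, i, j)`. -/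
def CondI (l : Fin n) (k : Fin 3) (i j : Fin 2) (s : Settings n) : Prop :=
  s.1 l = some (.chsh (chshX i k)) ∧ s.2 l = some (chshY j k)

/-- The settings that count for the link `e` with the Pauli input `P`. -/
def CondII (e : Link n) (P : Pauli) (s : Settings n) : Prop :=
  s.1 e.1 = some .right ∧ s.1 e.next = some .left ∧ s.2 e.1 = some P ∧ s.2 e.next = some P

open Classical in
/-- What the analysis needs to know about the random choices of a protocol: lower bounds for the
probabilities that a round counts for a given CHSH correlator or link, and the fact that the Pauli
inputs of the third test have the distribution `𝒟`. -/
structure SamplingSpec (Q : Sampling n) (𝒟 : (Fin n → Pauli) → ℝ) (qI qII qIII : ℝ) : Prop where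
  settingProb_nonneg : ∀ s, 0 ≤ Q.settingProb s
  sum_settingProb : ∑ s, Q.settingProb s = 1
  accept_nonneg : ∀ s e, 0 ≤ Q.accept s e
  accept_le_one : ∀ s e, Q.accept s e ≤ 1
  hitI_le : ∀ l k i j, qI ≤ ∑ s, Q.settingProb s * (if CondI l k i j s then 1 else 0)
  hitII_le : ∀ e, qII ≤ ∑ s, Q.settingProb s * (Q.accept s e * ∑ P, if CondII e P s then 1 else 0)
  tele : ∀ P, Q.settingProb (teleSettings P) = qIII * 𝒟 P

lemma sum_coins {L : Type*} [Fintype L] [DecidableEq L] (a : L → ℝ) :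
    ∑ c : L → Bool, ∏ e, (if c e then a e else 1 - a e) = 1 := by
  rw [← Fintype.prod_sum fun e (b : Bool) => if b then a e else 1 - a e]
  simp

lemma sum_coins_mul {L : Type*} [Fintype L] [DecidableEq L] (a : L → ℝ) (e : L) :
    ∑ c : L → Bool, (∏ e', (if c e' then a e' else 1 - a e')) * (if c e then 1 else 0) = a e := by
  have h : ∀ c : L → Bool, (∏ e', (if c e' then a e' else 1 - a e')) * (if c e then (1 : ℝ) else 0)
      = ∏ e', (if c e' then a e' else 1 - a e') *
        (if e' = e then (if c e' then 1 else 0) else 1) := by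
    intro c
    rw [Finset.prod_mul_distrib, Fintype.prod_ite_eq']
  simp_rw [h]
  rw [← Fintype.prod_sum fun e' (b : Bool) =>
    (if b then a e' else 1 - a e') * (if e' = e then (if b then 1 else 0) else 1)]
  rw [Finset.prod_eq_single e]
  · simp
  · intro e' _ he; simp [he]
  · simp

/-- The expectation of a function of settings and outcomes. -/
lemma sum_roundProb_mul (F : ∀ s : Settings n, Outcomes s → ℝ) :
    ∑ r, roundProb Q E r * F r.1 r.2.1 = ∑ s, Q.settingProb s * ∑ o, E.born s o * F s o := by
  rw [Fintype.sum_sigma]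
  refine Finset.sum_congr rfl fun s _ => ?_
  rw [Fintype.sum_prod_type, Finset.mul_sum]
  refine Finset.sum_congr rfl fun o _ => ?_
  simp only [roundProb]
  have hc := congrArg (Q.settingProb s * (E.born s o * F s o) * ·) (sum_coins (Q.accept s))
  simp only [Finset.mul_sum, mul_one] at hc
  rw [← hc]
  exact Finset.sum_congr rfl fun c _ => by ring

/-- The expectation of a function of settings and outcomes in the accepted rounds. -/
lemma sum_roundProb_mul_coin (e : Link n) (F : ∀ s : Settings n, Outcomes s → ℝ) :
    ∑ r, roundProb Q E r * ((if r.2.2 e then 1 else 0) * F r.1 r.2.1) =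
      ∑ s, Q.settingProb s * (Q.accept s e * ∑ o, E.born s o * F s o) := by
  rw [Fintype.sum_sigma]
  refine Finset.sum_congr rfl fun s _ => ?_
  rw [Fintype.sum_prod_type, Finset.mul_sum, Finset.mul_sum]
  refine Finset.sum_congr rfl fun o _ => ?_
  simp only [roundProb]
  rw [mul_left_comm, ← sum_coins_mul (Q.accept s) e, Finset.sum_mul]
  exact Finset.sum_congr rfl fun c _ => by ring

lemma roundProb_nonneg {qI qII qIII : ℝ} (h : SamplingSpec Q 𝒟 qI qII qIII) (r : Round n) :
    0 ≤ roundProb Q E r := by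
  refine mul_nonneg (mul_nonneg (h.settingProb_nonneg _) (born_nonneg _ _))
    (Finset.prod_nonneg fun e _ => ?_)
  split_ifs
  exacts [h.accept_nonneg _ _, sub_nonneg.2 (h.accept_le_one _ _)]

lemma sum_roundProb {qI qII qIII : ℝ} (h : SamplingSpec Q 𝒟 qI qII qIII) :
    ∑ r, roundProb Q E r = 1 := by
  have := sum_roundProb_mul (Q := Q) (E := E) fun _ _ => 1
  simp only [mul_one, sum_born] at this
  rw [this, h.sum_settingProb]

/-! ### The three tests in one round -/

open Classical in
/-- Indicator of the rounds that count for the CHSH correlator `(l, k, i, j)`. -/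
def indI (l : Fin n) (k : Fin 3) (i j : Fin 2) (r : Round n) : ℝ :=
  if hitI l k i j r then 1 else 0

open Classical in
/-- Contribution of a round to the signed CHSH correlator `(l, k, i, j)`. -/
def valI (l : Fin n) (k : Fin 3) (i j : Fin 2) (r : Round n) : ℝ :=
  if hitI l k i j r then (-1) ^ (i.val * j.val) *
    (signA (r.1.1 l) (r.2.1.1 l) * (-1) ^ (bitB (r.1.2 l) (r.2.1.2 l)).val) else 0

open Classical in
/-- Indicator of the rounds that count for the link `e`. -/
def indII (e : Link n) (r : Round n) : ℝ := ∑ P : Pauli, if hitII e P r then 1 else 0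

open Classical in
/-- Contribution of a round to the correlation on the link `e`, with the sign that makes the
reference value positive. -/
def valII (e : Link n) (r : Round n) : ℝ :=
  ∑ P : Pauli, if hitII e P r then (if P = .Y then -1 else 1) *
    (-1) ^ ((corrAt e.1 P r).val + (corrAt e.next P r).val) else 0

open Classical in
/-- Indicator of the rounds of the third test. -/
def indIII (r : Round n) : ℝ := ∑ P : Fin n → Pauli, if hitIII P r then 1 else 0

open Classical in
/-- Contribution of a round to the estimate of `tr(L τ)`. -/
def valIII (ω : (Fin n → Fin 2) → (Fin n → Pauli) → ℝ) (r : Round n) : ℝ :=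
  ∑ P : Fin n → Pauli, if hitIII P r then ω (fun l => corrAt l (P l) r) P else 0

lemma abs_neg_one_pow (m : ℕ) : |(-1 : ℝ) ^ m| = 1 := by rw [abs_pow]; simp

lemma abs_signA (x : Option ASetting) (a : AOut x) : |signA x a| = 1 := by
  rcases x with _ | (_ | _ | _ | _) <;> simp [signA]

lemma indI_eq (l : Fin n) (k : Fin 3) (i j : Fin 2) (r : Round n) :
    indI l k i j r = 0 ∨ indI l k i j r = 1 := by
  unfold indI; split_ifs <;> simp

lemma abs_valI_le (l : Fin n) (k : Fin 3) (i j : Fin 2) (r : Round n) :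
    |valI l k i j r| ≤ 1 * indI l k i j r := by
  unfold indI valI; split_ifs
  · rw [abs_mul, abs_mul, abs_neg_one_pow, abs_neg_one_pow, abs_signA]; norm_num
  · simp

lemma hitII_unique {e : Link n} {P P' : Pauli} {r : Round n} (h : hitII e P r)
    (h' : hitII e P' r) : P' = P := Option.some_injective _ (h'.2.2.1.symm.trans h.2.2.1)

open Classical in
lemma sum_ite_hitII {e : Link n} {P : Pauli} {r : Round n} (h : hitII e P r) (f : Pauli → ℝ) :
    (∑ P', if hitII e P' r then f P' else 0) = f P := by
  rw [Finset.sum_eq_single P (fun P' _ hne => if_neg fun h' => hne (hitII_unique h h')) (by simp),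
    if_pos h]

lemma indII_eq (e : Link n) (r : Round n) : indII e r = 0 ∨ indII e r = 1 := by
  by_cases h : ∃ P, hitII e P r
  · obtain ⟨P, hP⟩ := h
    right
    exact sum_ite_hitII hP fun _ => 1
  · push Not at h
    left
    simp [indII, h]

lemma abs_valII_le (e : Link n) (r : Round n) : |valII e r| ≤ 1 * indII e r := by
  by_cases h : ∃ P, hitII e P r
  · obtain ⟨P, hP⟩ := h
    rw [valII, indII, sum_ite_hitII hP, sum_ite_hitII hP fun _ => 1, abs_mul, abs_neg_one_pow]
    split_ifs <;> simp
  · push Not at h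
    simp [indII, valII, h]

lemma hitIII_iff (P : Fin n → Pauli) (r : Round n) : hitIII P r ↔ r.1 = teleSettings P := by
  constructor
  · rintro ⟨h1, h2⟩
    exact Prod.ext (funext h1) (funext h2)
  · intro h
    unfold hitIII
    rw [h]
    exact ⟨fun _ => rfl, fun _ => rfl⟩

lemma teleSettings_injective : Function.Injective (teleSettings (n := n)) := by
  intro P P' h
  funext l
  exact Option.some_injective _ (congrFun (congrArg Prod.snd h) l)

open Classical in
lemma sum_ite_hitIII {P : Fin n → Pauli} {r : Round n} (h : hitIII P r)
    (f : (Fin n → Pauli) → ℝ) : (∑ P', if hitIII P' r then f P' else 0) = f P := by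
  rw [Finset.sum_eq_single P (fun P' _ hne => if_neg fun h' => hne ?_) (by simp), if_pos h]
  exact teleSettings_injective (((hitIII_iff P' r).1 h').symm.trans ((hitIII_iff P r).1 h))

lemma indIII_eq (r : Round n) : indIII r = 0 ∨ indIII r = 1 := by
  by_cases h : ∃ P, hitIII P r
  · obtain ⟨P, hP⟩ := h
    right
    exact sum_ite_hitIII hP fun _ => 1
  · push Not at h
    left
    simp [indIII, h]

lemma abs_valIII_le {ω : (Fin n → Fin 2) → (Fin n → Pauli) → ℝ} {W : ℝ} (hω : ∀ b P, |ω b P| ≤ W)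
    (r : Round n) : |valIII ω r| ≤ W * indIII r := by
  by_cases h : ∃ P, hitIII P r
  · obtain ⟨P, hP⟩ := h
    rw [valIII, indIII, sum_ite_hitIII hP fun P => ω (fun l => corrAt l (P l) r) P,
      sum_ite_hitIII hP fun _ => 1, mul_one]
    exact hω _ _
  · push Not at h
    simp [indIII, valIII, h]

open Classical in
lemma sum_indI (l : Fin n) (k : Fin 3) (i j : Fin 2) :
    ∑ r, roundProb Q E r * indI l k i j r
      = ∑ s, Q.settingProb s * (if CondI l k i j s then 1 else 0) := by
  have := sum_roundProb_mul (Q := Q) (E := E) fun s _ => if CondI l k i j s then 1 else 0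
  simp only [← Finset.sum_mul, sum_born, one_mul] at this
  exact this

open Classical in
lemma indII_eq_coin (e : Link n) (r : Round n) :
    indII e r = (if r.2.2 e then 1 else 0) * ∑ P, if CondII e P r.1 then 1 else 0 := by
  rw [indII, Finset.mul_sum]
  refine Finset.sum_congr rfl fun P _ => ?_
  by_cases hc : r.2.2 e = true <;> by_cases h : CondII e P r.1 <;>
    simp only [CondII] at h <;> simp [hitII, CondII, hc, h]

open Classical in
lemma sum_indII (e : Link n) :
    ∑ r, roundProb Q E r * indII e r
      = ∑ s, Q.settingProb s * (Q.accept s e * ∑ P, if CondII e P s then 1 else 0) := by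
  have := sum_roundProb_mul_coin (Q := Q) (E := E) e fun s _ => ∑ P, if CondII e P s then 1 else 0
  simp only [← Finset.sum_mul, sum_born, one_mul] at this
  rw [← this]
  exact Finset.sum_congr rfl fun r _ => by rw [indII_eq_coin]

/-- The mean of a CHSH correlator in the rounds that count for it. -/
lemma mean_valI {qI qII qIII η : ℝ} (hQ : SamplingSpec Q 𝒟 qI qII qIII) (hη : 0 ≤ η)
    (h : measError E R ≤ ENNReal.ofReal η) (τ : QState (Fin n → Fin 2)) (l : Fin n) (k : Fin 3)
    (i j : Fin 2) :
    ((Real.sqrt 2)⁻¹ - (2 * η + 2 * traceDist E.ρ.1 (R.state τ))) *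
        ∑ r, roundProb Q E r * indI l k i j r ≤ ∑ r, roundProb Q E r * valI l k i j r := by
  classical
  have hval := sum_roundProb_mul (Q := Q) (E := E) fun s o => if CondI l k i j s then
    (-1) ^ (i.val * j.val) * (signA (s.1 l) (o.1 l) * (-1) ^ (bitB (s.2 l) (o.2 l)).val) else 0
  have hval' : ∑ r, roundProb Q E r * valI l k i j r = _ := hval
  rw [hval', sum_indI, Finset.mul_sum]
  refine Finset.sum_le_sum fun s _ => ?_
  rw [mul_left_comm]
  refine mul_le_mul_of_nonneg_left ?_ (hQ.settingProb_nonneg s)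
  by_cases hs : CondI l k i j s
  · simp only [hs, if_true, mul_one]
    have hb := abs_born_sub_reference_le hη h {l} s τ (g := fun o => (-1) ^ (i.val * j.val) *
      (signA (s.1 l) (o.1 l) * (-1) ^ (bitB (s.2 l) (o.2 l)).val)) (fun o => by
        rw [abs_mul, abs_mul, abs_neg_one_pow, abs_neg_one_pow, abs_signA]; norm_num)
    rw [chsh_reference_value s τ l k i j hs.1 hs.2, Finset.card_singleton, Nat.cast_one,
      one_mul] at hb
    have := (abs_le.1 hb).1
    simp only [mul_comm (E.born s _)]
    linarith
  · simp [hs]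

/-- The mean of a link correlation in the rounds that count for it. -/
lemma mean_valII {qI qII qIII η : ℝ} (hQ : SamplingSpec Q 𝒟 qI qII qIII) (hη : 0 ≤ η)
    (h : measError E R ≤ ENNReal.ofReal η) (τ : QState (Fin n → Fin 2)) (e : Link n) :
    (1 - (4 * η + 2 * traceDist E.ρ.1 (R.state τ))) *
        ∑ r, roundProb Q E r * indII e r ≤ ∑ r, roundProb Q E r * valII e r := by
  classical
  have hval := sum_roundProb_mul_coin (Q := Q) (E := E) e fun s o => ∑ P, if CondII e P s then
    (if P = .Y then -1 else 1) *
      ((flipSign P (pairA (s.1 e.1) (o.1 e.1)) * flipSign P (pairA (s.1 e.next) (o.1 e.next))) *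
      ((-1) ^ (bitB (s.2 e.1) (o.2 e.1)).val * (-1) ^ (bitB (s.2 e.next) (o.2 e.next)).val)) else 0
  have hfun : ∀ r, valII e r = (if r.2.2 e then 1 else 0) * ∑ P, if CondII e P r.1 then
      (if P = .Y then -1 else 1) * ((flipSign P (pairA (r.1.1 e.1) (r.2.1.1 e.1)) *
        flipSign P (pairA (r.1.1 e.next) (r.2.1.1 e.next))) *
        ((-1) ^ (bitB (r.1.2 e.1) (r.2.1.2 e.1)).val *
          (-1) ^ (bitB (r.1.2 e.next) (r.2.1.2 e.next)).val)) else 0 := by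
    intro r
    rw [valII, Finset.mul_sum]
    refine Finset.sum_congr rfl fun P _ => ?_
    have hsign : (-1 : ℝ) ^ ((corrAt e.1 P r).val + (corrAt e.next P r).val) =
        (flipSign P (pairA (r.1.1 e.1) (r.2.1.1 e.1)) *
          flipSign P (pairA (r.1.1 e.next) (r.2.1.1 e.next))) *
        ((-1) ^ (bitB (r.1.2 e.1) (r.2.1.2 e.1)).val *
          (-1) ^ (bitB (r.1.2 e.next) (r.2.1.2 e.next)).val) := by
      rw [pow_add, corrAt, corrAt, sign_corrOut, sign_corrOut]; ring
    rw [hsign]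
    by_cases hc : r.2.2 e = true <;> by_cases h : CondII e P r.1 <;>
      simp only [CondII] at h <;> simp [hitII, CondII, hc, h]
  simp only [hfun]
  rw [hval, sum_indII, Finset.mul_sum]
  refine Finset.sum_le_sum fun s _ => ?_
  rw [mul_left_comm, mul_left_comm (1 - _)]
  refine mul_le_mul_of_nonneg_left (mul_le_mul_of_nonneg_left ?_ (hQ.accept_nonneg s e))
    (hQ.settingProb_nonneg s)
  by_cases hs : ∃ P, CondII e P s
  · obtain ⟨P, hP⟩ := hs
    have huniq : ∀ f : Pauli → ℝ, (∑ P', if CondII e P' s then f P' else 0) = f P := by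
      intro f
      rw [Finset.sum_eq_single P (fun P' _ hne => if_neg fun h' => hne
        (Option.some_injective _ (h'.2.2.1.symm.trans hP.2.2.1))) (by simp), if_pos hP]
    simp only [huniq, mul_one]
    have hb := abs_born_sub_reference_le hη h {e.1, e.next} s τ (g := fun o =>
      (if P = .Y then -1 else 1) *
      ((flipSign P (pairA (s.1 e.1) (o.1 e.1)) * flipSign P (pairA (s.1 e.next) (o.1 e.next))) *
      ((-1) ^ (bitB (s.2 e.1) (o.2 e.1)).val * (-1) ^ (bitB (s.2 e.next) (o.2 e.next)).val)))
      (fun o => by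
        simp only [abs_mul, abs_neg_one_pow, abs_flipSign]
        split_ifs <;> norm_num)
    have href := link_reference_value (E := E) (R := R) s τ e P hP.1 hP.2.1 hP.2.2.1 hP.2.2.2
    have href' : ∑ o, ((if P = .Y then -1 else 1) *
      ((flipSign P (pairA (s.1 e.1) (o.1 e.1)) * flipSign P (pairA (s.1 e.next) (o.1 e.next))) *
      ((-1) ^ (bitB (s.2 e.1) (o.2 e.1)).val * (-1) ^ (bitB (s.2 e.next) (o.2 e.next)).val))) *
      mixProb E R {e.1, e.next} s (R.state τ) o = 1 := by
      simp only [mul_assoc (if P = Pauli.Y then (-1 : ℝ) else 1)]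
      rw [← Finset.mul_sum, href]
      split_ifs <;> norm_num
    rw [href', Finset.card_pair e.ne_next] at hb
    have := (abs_le.1 hb).1
    simp only [mul_comm (E.born s _)]
    push_cast at this
    linarith
  · push Not at hs
    simp [hs]

/-- The mean of the weight in the rounds of the third test. -/
def meanIII (E : Experiment HA HB) (𝒟 : (Fin n → Pauli) → ℝ)
    (ω : (Fin n → Fin 2) → (Fin n → Pauli) → ℝ) : ℝ :=
  ∑ P, 𝒟 P * ∑ o : Outcomes (teleSettings P), E.born (teleSettings P) o *
    ω (fun l => corrOut (bitB _ (o.2 l)) (P l) (pairA _ (o.1 l))) P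

open Classical in
lemma sum_settings_tele {qI qII qIII : ℝ} (hQ : SamplingSpec Q 𝒟 qI qII qIII)
    (f : ∀ s : Settings n, (Fin n → Pauli) → Outcomes s → ℝ) :
    ∑ s, Q.settingProb s * ∑ o, E.born s o * ∑ P, (if s = teleSettings P then f s P o else 0) =
      qIII * ∑ P, 𝒟 P * ∑ o, E.born (teleSettings P) o * f (teleSettings P) P o := by
  have h1 : ∀ s, Q.settingProb s * ∑ o, E.born s o *
      ∑ P, (if s = teleSettings P then f s P o else 0) =
      ∑ P, if s = teleSettings P then Q.settingProb s * ∑ o, E.born s o * f s P o else 0 := by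
    intro s
    simp_rw [Finset.mul_sum]
    rw [Finset.sum_comm]
    refine Finset.sum_congr rfl fun P _ => ?_
    split_ifs <;> simp
  rw [Finset.sum_congr rfl fun s _ => h1 s, Finset.sum_comm, Finset.mul_sum]
  refine Finset.sum_congr rfl fun P _ => ?_
  rw [Finset.sum_ite_eq' Finset.univ (teleSettings P), if_pos (Finset.mem_univ _), hQ.tele P,
    mul_assoc]

lemma sum_indIII {qI qII qIII : ℝ} (hQ : SamplingSpec Q 𝒟 qI qII qIII) (h𝒟 : ∑ P, 𝒟 P = 1) :
    ∑ r, roundProb Q E r * indIII r = qIII := by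
  classical
  have h1 := sum_roundProb_mul (Q := Q) (E := E) fun s _ => ∑ P, if s = teleSettings P then 1 else 0
  rw [sum_settings_tele hQ fun _ _ _ => 1] at h1
  simp only [mul_one, sum_born, h𝒟] at h1
  rw [← h1]
  refine Finset.sum_congr rfl fun r _ => ?_
  simp only [indIII, hitIII_iff]

lemma sum_valIII {qI qII qIII : ℝ} (hQ : SamplingSpec Q 𝒟 qI qII qIII)
    (ω : (Fin n → Fin 2) → (Fin n → Pauli) → ℝ) :
    ∑ r, roundProb Q E r * valIII ω r = qIII * meanIII E 𝒟 ω := by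
  classical
  have h1 := sum_roundProb_mul (Q := Q) (E := E) fun s o => ∑ P, if s = teleSettings P then
    ω (fun l => corrOut (bitB _ (o.2 l)) (P l) (pairA _ (o.1 l))) P else 0
  rw [sum_settings_tele hQ fun s P o =>
    ω (fun l => corrOut (bitB _ (o.2 l)) (P l) (pairA _ (o.1 l))) P] at h1
  rw [meanIII, ← h1]
  refine Finset.sum_congr rfl fun r _ => ?_
  simp only [valIII, hitIII_iff]
  rfl

lemma isPOVM_binElem (P : Pauli) : IsPOVM (binElem P.mat) := by
  have hH : P.matᴴ = P.mat := by
    ext i j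
    cases P <;> fin_cases i <;> fin_cases j <;> simp [Pauli.mat]
  have hsq : P.mat * P.mat = 1 := by
    ext i j
    cases P <;> fin_cases i <;> fin_cases j <;> simp [Pauli.mat]
  constructor
  · intro b
    -- the elements are projections
    have h1 : ((-1 : ℂ) ^ b.val) * (-1) ^ b.val = 1 := by rw [← mul_pow]; simp
    have h2 : binElem P.mat b = (binElem P.mat b)ᴴ * binElem P.mat b := by
      have h3 : (binElem P.mat b)ᴴ = binElem P.mat b := by
        simp [binElem, Matrix.conjTranspose_smul, hH]
      rw [h3]
      simp only [binElem, Matrix.smul_mul, Matrix.mul_smul, Matrix.add_mul, Matrix.mul_add, hsq,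
        Matrix.one_mul, Matrix.mul_one]
      ext i j
      simp only [Matrix.smul_apply, Matrix.add_apply, smul_eq_mul]
      linear_combination (-(1 / 4 : ℂ) * (1 : Matrix (Fin 2) (Fin 2) ℂ) i j) * h1
    rw [h2]
    exact Matrix.posSemidef_conjTranspose_mul_self _
  · rw [Fin.sum_univ_two]
    ext i j
    simp only [binElem, Matrix.add_apply, Matrix.smul_apply, smul_eq_mul, Fin.val_zero, Fin.val_one]
    ring

/-- The expectation value of `L` is real. -/
lemma trace_obsL (ω : (Fin n → Fin 2) → (Fin n → Pauli) → ℝ) (τ : QState (Fin n → Fin 2)) :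
    (obsL 𝒟 ω * τ.1).trace = ((∑ P, 𝒟 P * ∑ c, ω c P *
      ((tensorMat fun l => binElem (P l).mat (c l)) * τ.1).trace.re : ℝ) : ℂ) := by
  rw [obsL, Matrix.sum_mul, Matrix.trace_sum, Complex.ofReal_sum]
  refine Finset.sum_congr rfl fun P _ => ?_
  rw [Matrix.smul_mul, Matrix.trace_smul, smul_eq_mul, Complex.ofReal_mul, Matrix.sum_mul,
    Matrix.trace_sum, Complex.ofReal_sum]
  congr 1
  refine Finset.sum_congr rfl fun c _ => ?_
  rw [Matrix.smul_mul, Matrix.trace_smul, smul_eq_mul, Complex.ofReal_mul]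
  congr 1
  have h0 := trace_mul_nonneg
    ((IsPOVM.tensor fun l => isPOVM_binElem (P l)).1 c) τ.2.1
  exact Complex.ext rfl (Complex.nonneg_iff.1 h0).2.symm

/-- The mean of the third test is close to the expectation value of `L`, for every state `τ`
simultaneously. -/
lemma abs_meanIII_sub_le {ω : (Fin n → Fin 2) → (Fin n → Pauli) → ℝ} {W η : ℝ} (hW : 0 < W)
    (hω : ∀ b P, |ω b P| ≤ W) (h𝒟 : 𝒟 ∈ stdSimplex ℝ (Fin n → Pauli)) (hη : 0 ≤ η)
    (h : measError E R ≤ ENNReal.ofReal η) (τ : QState (Fin n → Fin 2)) :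
    |meanIII E 𝒟 ω - (obsL 𝒟 ω * τ.1).trace.re| ≤
      W * (2 * (n * η) + 2 * traceDist E.ρ.1 (R.state τ)) := by
  rw [trace_obsL, Complex.ofReal_re, meanIII, ← Finset.sum_sub_distrib]
  refine (Finset.abs_sum_le_sum_abs _ _).trans ?_
  rw [← one_mul (W * _), ← h𝒟.2, Finset.sum_mul]
  refine Finset.sum_le_sum fun P _ => ?_
  rw [← mul_sub, abs_mul, abs_of_nonneg (h𝒟.1 P)]
  refine mul_le_mul_of_nonneg_left ?_ (h𝒟.1 P)
  have hb := abs_born_sub_reference_le hη h Finset.univ (teleSettings P) τ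
    (g := fun o => W⁻¹ * ω (fun l => corrOut (bitB _ (o.2 l)) (P l) (pairA _ (o.1 l))) P)
    (fun o => by
      rw [abs_mul, abs_of_pos (inv_pos.2 hW), inv_mul_le_iff₀ hW, mul_one]
      exact hω _ _)
  simp only [mul_assoc W⁻¹] at hb
  rw [← Finset.mul_sum, ← Finset.mul_sum, sum_weight_tele_reference_value P τ fun c => ω c P,
    ← mul_sub, abs_mul, abs_of_pos (inv_pos.2 hW), inv_mul_le_iff₀ hW, Finset.card_univ,
    Fintype.card_fin] at hb
  simp only [mul_comm (E.born _ _)]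
  exact hb

end Rounds

/-! ### Certification with high probability -/

section Certification

variable {n N : ℕ} {HA HB : Fin n → Type} [∀ l, Fintype (HA l)] [∀ l, DecidableEq (HA l)]
  [∀ l, Fintype (HB l)] [∀ l, DecidableEq (HB l)] {E : Experiment HA HB} {R : Embedding HA HB}
  {Q : Sampling n} {𝒟 : (Fin n → Pauli) → ℝ} {ω : (Fin n → Fin 2) → (Fin n → Pauli) → ℝ}

lemma card_link (hn : 1 ≤ n) : (Fintype.card (Link n) : ℝ) = n - 1 := by
  obtain ⟨m, rfl⟩ : ∃ m, n = m + 1 := ⟨n - 1, by omega⟩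
  have e : Link (m + 1) ≃ Fin m :=
    { toFun := fun e => ⟨e.1.val, by have := e.2; omega⟩
      invFun := fun i => ⟨⟨i.val, by omega⟩, by simp⟩
      left_inv := fun _ => rfl
      right_inv := fun _ => rfl }
  rw [Fintype.card_congr e, Fintype.card_fin]
  push_cast; ring

lemma countI_eq (t : Fin N → Round n) (l : Fin n) (k : Fin 3) (i j : Fin 2) :
    countI t l k i j = ∑ m, indI l k i j (t m) := rfl

lemma sign_mul_sumI (t : Fin N → Round n) (l : Fin n) (k : Fin 3) (i j : Fin 2) :
    (-1) ^ (i.val * j.val) * sumI t l k i j = ∑ m, valI l k i j (t m) := by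
  rw [sumI, Finset.mul_sum]
  exact Finset.sum_congr rfl fun m _ => by rw [mul_ite, mul_zero]; rfl

lemma countII_eq (t : Fin N → Round n) (e : Link n) :
    countII t e = ∑ m, indII e (t m) := rfl

lemma sumII_eq (t : Fin N → Round n) (e : Link n) :
    sumII t e = -∑ m, valII e (t m) := by
  rw [sumII, ← Finset.sum_neg_distrib]
  refine Finset.sum_congr rfl fun m _ => ?_
  rw [valII, ← Finset.sum_neg_distrib]
  refine Finset.sum_congr rfl fun P _ => ?_
  split_ifs <;> simp

lemma estIII_eq (t : Fin N → Round n) :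
    estIII t ω = (∑ m, valIII ω (t m)) / ∑ m, indIII (t m) := rfl

/-- Lower bounds for the signed CHSH correlators bound `v̂_I`. -/
lemma estI_le (hn : 1 ≤ n) (t : Fin N → Round n) {y : ℝ}
    (h : ∀ l k i j, y ≤ (∑ m, valI l k i j (t m)) / ∑ m, indI l k i j (t m)) :
    estI t ≤ 2 * Real.sqrt 2 - 4 * y := by
  have hn0 : (0 : ℝ) < n := by exact_mod_cast hn
  have hsum : 12 * n * y ≤ ∑ l : Fin n, ∑ k : Fin 3, ∑ i : Fin 2, ∑ j : Fin 2,
      (-1) ^ (i.val * j.val) * (sumI t l k i j / countI t l k i j) := by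
    have h1 : ∑ _l : Fin n, ∑ _k : Fin 3, ∑ _i : Fin 2, ∑ _j : Fin 2, y = 12 * n * y := by
      simp; ring
    rw [← h1]
    refine Finset.sum_le_sum fun l _ => Finset.sum_le_sum fun k _ => Finset.sum_le_sum fun i _ =>
      Finset.sum_le_sum fun j _ => ?_
    rw [← mul_div_assoc, sign_mul_sumI, countI_eq]
    exact h l k i j
  have h2 : 4 * y ≤ 1 / (3 * n) * ∑ l : Fin n, ∑ k : Fin 3, ∑ i : Fin 2, ∑ j : Fin 2,
      (-1) ^ (i.val * j.val) * (sumI t l k i j / countI t l k i j) := by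
    have h3 := mul_le_mul_of_nonneg_left hsum (by positivity : (0 : ℝ) ≤ 1 / (3 * n))
    have h4 : 1 / (3 * (n : ℝ)) * (12 * n * y) = 4 * y := by field_simp; ring
    linarith
  rw [estI]
  linarith

/-- Lower bounds for the link correlations bound `v̂_II`. -/
lemma estII_le (hn : 2 ≤ n) (t : Fin N → Round n) {y : ℝ}
    (h : ∀ e, y ≤ (∑ m, valII e (t m)) / ∑ m, indII e (t m)) : estII t ≤ 1 - y := by
  have hn0 : (0 : ℝ) < (n : ℝ) - 1 := by
    have : (2 : ℝ) ≤ n := by exact_mod_cast hn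
    linarith
  have hsum : ∑ e : Link n, sumII t e / countII t e ≤ -(((n : ℝ) - 1) * y) := by
    have h1 : ∑ _e : Link n, -y = -(((n : ℝ) - 1) * y) := by
      rw [Finset.sum_const, Finset.card_univ, nsmul_eq_mul, card_link (by omega)]; ring
    rw [← h1]
    refine Finset.sum_le_sum fun e _ => ?_
    rw [sumII_eq, countII_eq, neg_div]
    exact neg_le_neg (h e)
  have h3 := mul_le_mul_of_nonneg_left hsum (by positivity : (0 : ℝ) ≤ 1 / ((n : ℝ) - 1))
  have h4 : 1 / ((n : ℝ) - 1) * -(((n : ℝ) - 1) * y) = -y := by field_simp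
  rw [estII]
  linarith

/-- The bound holds also if no round counts, as the quotient is then `0`. -/
lemma abs_div_sum_le {Ω : Type*} {u w : Ω → ℝ} {B : ℝ} (hB : 0 ≤ B)
    (hu : ∀ x, u x = 0 ∨ u x = 1) (hw : ∀ x, |w x| ≤ B * u x) (t : Fin N → Ω) :
    |(∑ m, w (t m)) / ∑ m, u (t m)| ≤ B := by
  have hu0 : ∀ x, 0 ≤ u x := fun x => by rcases hu x with h | h <;> norm_num [h]
  have hs : 0 ≤ ∑ m, u (t m) := Finset.sum_nonneg fun m _ => hu0 _
  rw [abs_div, abs_of_nonneg hs]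
  refine div_le_of_le_mul₀ hs hB ?_
  rw [Finset.mul_sum]
  exact (Finset.abs_sum_le_sum_abs _ _).trans (Finset.sum_le_sum fun m _ => hw _)

lemma abs_sum_mul_le_of_prob {O : Type*} [Fintype O] {p w : O → ℝ} {W : ℝ} (hp : ∀ o, 0 ≤ p o)
    (h1 : ∑ o, p o = 1) (hw : ∀ o, |w o| ≤ W) : |∑ o, p o * w o| ≤ W := by
  calc |∑ o, p o * w o| ≤ ∑ o, p o * W := by
        refine (Finset.abs_sum_le_sum_abs _ _).trans (Finset.sum_le_sum fun o _ => ?_)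
        rw [abs_mul, abs_of_nonneg (hp o)]
        exact mul_le_mul_of_nonneg_left (hw o) (hp o)
    _ = W := by rw [← Finset.sum_mul, h1, one_mul]

lemma abs_meanIII_le {W : ℝ} (hω : ∀ b P, |ω b P| ≤ W)
    (h𝒟 : 𝒟 ∈ stdSimplex ℝ (Fin n → Pauli)) : |meanIII E 𝒟 ω| ≤ W :=
  abs_sum_mul_le_of_prob h𝒟.1 h𝒟.2 fun _ =>
    abs_sum_mul_le_of_prob (fun _ => born_nonneg _ _) (sum_born _) fun _ => hω _ _

lemma abs_re_trace_obsL_le {W : ℝ} (hω : ∀ b P, |ω b P| ≤ W)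
    (h𝒟 : 𝒟 ∈ stdSimplex ℝ (Fin n → Pauli)) (τ : QState (Fin n → Fin 2)) :
    |(obsL 𝒟 ω * τ.1).trace.re| ≤ W := by
  rw [trace_obsL, Complex.ofReal_re]
  refine abs_sum_mul_le_of_prob h𝒟.1 h𝒟.2 fun P => ?_
  have hM := IsPOVM.tensor fun l => isPOVM_binElem (P l)
  simp only [mul_comm (ω _ _)]
  refine abs_sum_mul_le_of_prob (fun c => re_trace_mul_nonneg (hM.1 c) τ.2.1) ?_ fun c => hω c P
  have h := congrArg (fun X => (X * τ.1).trace.re) hM.2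
  simp only [Matrix.sum_mul, Matrix.trace_sum, Complex.re_sum, Matrix.one_mul] at h
  rw [τ.2.2, Complex.one_re] at h
  exact h

lemma norm_sub_trace_obsL (v : ℝ) (τ : QState (Fin n → Fin 2)) :
    ‖(v : ℂ) - (obsL 𝒟 ω * τ.1).trace‖ = |v - (obsL 𝒟 ω * τ.1).trace.re| := by
  have h : (obsL 𝒟 ω * τ.1).trace = (((obsL 𝒟 ω * τ.1).trace.re : ℝ) : ℂ) := by
    rw [trace_obsL, Complex.ofReal_re]
  rw [h, Complex.ofReal_re, ← Complex.ofReal_sub, Complex.norm_real, Real.norm_eq_abs]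

lemma traceDist_nonneg {ι : Type*} [Fintype ι] [DecidableEq ι] (ρ σ : Matrix ι ι ℂ) :
    0 ≤ traceDist ρ σ := div_nonneg (traceNorm_nonneg _) (by norm_num)

lemma mem_goodEvent {t : Fin N → Round n} {W ε C : ℝ}
    (h1 : estI t ≤ ε ^ 2 / (n ^ 2 * W ^ 2)) (h2 : estII t ≤ ε / (n * W))
    (h3 : ∀ τ : QState (Fin n → Fin 2), |estIII t ω - (obsL 𝒟 ω * τ.1).trace.re| ≤
      C * (ε + W * traceDist E.ρ.1 (R.state τ))) : t ∈ goodEvent E R 𝒟 ω W ε C N := by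
  refine ⟨estIII t ω, ?_, fun τ => ?_⟩
  · rw [output, if_neg]
    rintro (h | h)
    · exact absurd h1 (not_le.2 h)
    · exact absurd h2 (not_le.2 h)
  · rw [norm_sub_trace_obsL]
    exact h3 τ

/-- If the thresholds are so large that the estimates cannot exceed them, then every transcript is
successful. -/
lemma mem_goodEvent_of_large (hn : 2 ≤ n) (h𝒟 : 𝒟 ∈ stdSimplex ℝ (Fin n → Pauli)) {W ε : ℝ}
    (hW : 1 < W) (hω : ∀ b P, |ω b P| ≤ W) (hx : 3 * (n * W) ≤ ε) (t : Fin N → Round n) :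
    t ∈ goodEvent E R 𝒟 ω W ε 2 N := by
  have hn2 : (2 : ℝ) ≤ n := by exact_mod_cast hn
  have hnW : 0 < (n : ℝ) * W := by positivity
  have hx3 : 3 ≤ ε / (n * W) := by rwa [le_div_iff₀ hnW]
  have hsqrt : Real.sqrt 2 ≤ 3 / 2 := Real.sqrt_le_iff.2 ⟨by norm_num, by norm_num⟩
  refine mem_goodEvent ?_ ?_ fun τ => ?_
  · have h := estI_le (by omega) t (y := -1) fun l k i j =>
      (abs_le.1 (abs_div_sum_le zero_le_one (indI_eq l k i j) (abs_valI_le l k i j) t)).1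
    have h2 : ε ^ 2 / (n ^ 2 * W ^ 2) = (ε / (n * W)) ^ 2 := by rw [div_pow, mul_pow]
    rw [h2]
    nlinarith
  · have h := estII_le hn t (y := -1) fun e =>
      (abs_le.1 (abs_div_sum_le zero_le_one (indII_eq e) (abs_valII_le e) t)).1
    linarith
  · have h1 : |estIII t ω| ≤ W := by
      rw [estIII_eq]
      exact abs_div_sum_le (by linarith) indIII_eq (abs_valIII_le hω) t
    have h2 := abs_re_trace_obsL_le hω h𝒟 τ
    have h3 := traceDist_nonneg E.ρ.1 (R.state τ)
    have h4 := abs_sub (estIII t ω) ((obsL 𝒟 ω * τ.1).trace.re)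
    have h5 : W ≤ ε := by nlinarith
    have h6 : 0 ≤ W * traceDist E.ρ.1 (R.state τ) := mul_nonneg (by linarith) h3
    linarith

/-- The exponent `5 log (n / δ)` suffices for a union bound over `13 n + 1 ≤ 15 n` events. -/
lemma exp_neg_five_log_le (hn : 2 ≤ n) {δ : ℝ} (hδ : 0 < δ) (hδ1 : δ < 1) :
    15 * n * Real.exp (-(5 * Real.log (n / δ))) ≤ δ := by
  have hn2 : (2 : ℝ) ≤ n := by exact_mod_cast hn
  have hn0 : (0 : ℝ) < n := by linarith
  have hexp : Real.exp (-(5 * Real.log (n / δ))) = (δ / n) ^ 5 := by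
    rw [Real.exp_neg, show (5 : ℝ) = ((5 : ℕ) : ℝ) by norm_num, Real.exp_nat_mul,
      Real.exp_log (by positivity), ← inv_pow, inv_div]
  have hy : δ / n ≤ 1 / 2 := by
    rw [div_le_div_iff₀ hn0 (by norm_num)]; linarith
  have hy4 : (δ / n) ^ 4 ≤ (1 / 2) ^ 4 := pow_le_pow_left₀ (by positivity) hy 4
  rw [hexp]
  calc 15 * n * (δ / n) ^ 5 = 15 * δ * (δ / n) ^ 4 := by field_simp
    _ ≤ 15 * δ * (1 / 2) ^ 4 := by gcongr
    _ ≤ δ := by norm_num; linarith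

/-- Both protocols succeed with probability at least `1 - δ` as soon as the number of rounds that
count for each estimate is large enough. -/
theorem one_sub_le_protProb (hn : 2 ≤ n) (h𝒟 : 𝒟 ∈ stdSimplex ℝ (Fin n → Pauli))
    {qI qII qIII W ε δ : ℝ} (hQ : SamplingSpec Q 𝒟 qI qII qIII) (hW : 1 < W)
    (hω : ∀ b P, |ω b P| ≤ W) (hε : 0 < ε) (hδ : 0 < δ) (hδ1 : δ < 1) (hx : ε ≤ 3 * (n * W))
    (hS : stateError E R ≤ 1 / 48 * (ε ^ 2 / (n ^ 2 * W ^ 2)))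
    (hM : measError E R ≤ ENNReal.ofReal (1 / 48 * (ε ^ 2 / (n ^ 2 * W ^ 2))))
    (hNI : 5 * Real.log (n / δ) ≤ N * (qI * ((ε / (n * W)) ^ 2 / 8) ^ 2 / (16 * 2 ^ 2)))
    (hNII : 5 * Real.log (n / δ) ≤ N * (qII * (ε / (n * W) / 2) ^ 2 / (16 * 2 ^ 2)))
    (hNIII : 5 * Real.log (n / δ) ≤ N * (qIII * (min ε W) ^ 2 / (16 * (2 * W) ^ 2))) :
    1 - δ ≤ protProb Q E N (goodEvent E R 𝒟 ω W ε 2 N) := by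
  have hn2 : (2 : ℝ) ≤ n := by exact_mod_cast hn
  have hn0 : (0 : ℝ) < n := by linarith
  have hW0 : 0 < W := by linarith
  have hnW : 0 < (n : ℝ) * W := by positivity
  have hx2 : ε ^ 2 / (n ^ 2 * W ^ 2) = (ε / (n * W)) ^ 2 := by rw [div_pow, mul_pow]
  rw [hx2] at hS hM
  set x := ε / (n * W) with hxdef
  have hx0 : 0 < x := div_pos hε hnW
  have hx3 : x ≤ 3 := by rw [hxdef, div_le_iff₀ hnW]; exact hx
  set γ := 1 / 48 * x ^ 2 with hγ
  have hγ0 : 0 < γ := by positivity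
  -- the infimum over `τ` in the state error need not be known to be attained
  obtain ⟨τ₀, hτ₀⟩ : ∃ τ : QState (Fin n → Fin 2), traceDist E.ρ.1 (R.state τ) < 2 * γ := by
    have : Nonempty (QState (Fin n → Fin 2)) :=
      ⟨⟨Matrix.single 0 0 1, by
        have h := Matrix.posSemidef_vecMulVec_self_star (Pi.single (0 : Fin n → Fin 2) (1 : ℂ))
        have h2 : Matrix.vecMulVec (Pi.single (0 : Fin n → Fin 2) (1 : ℂ))
            (star (Pi.single (0 : Fin n → Fin 2) (1 : ℂ))) = Matrix.single 0 0 1 := by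
          rw [← Pi.single_star, star_one, Matrix.single_eq_single_vecMulVec_single]
        rwa [h2] at h, by rw [Matrix.trace_single_eq_same]⟩⟩
    exact exists_lt_of_ciInf_lt (lt_of_le_of_lt hS (by linarith))
  -- the concentration bound needs a deviation of at most the order of `W`, while `ε` may be larger
  set η₃ := min ε W with hη₃
  have hη₃0 : 0 < η₃ := lt_min hε hW0
  set μ := meanIII E 𝒟 ω with hμ
  have hμW : |μ| ≤ W := abs_meanIII_le hω h𝒟
  have hs1 : 1 / 2 ≤ (Real.sqrt 2)⁻¹ := by
    rw [one_div]
    refine inv_anti₀ (by positivity) (Real.sqrt_le_iff.2 ⟨by norm_num, by norm_num⟩)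
  have hs2 : (Real.sqrt 2)⁻¹ ≤ 1 :=
    inv_le_one_of_one_le₀ (Real.one_le_sqrt.2 (by norm_num))
  have hp := roundProb_nonneg (E := E) hQ
  have hp1 := sum_roundProb (E := E) hQ
  -- with `γ = x² / 48` the means differ from the reference values by at most `x² / 8` and `x / 2`,
  -- half of what the thresholds allow; the other half is left for the statistical deviation
  let bad : (Fin n × Fin 3 × Fin 2 × Fin 2) ⊕ Link n ⊕ Bool → Set (Fin N → Round n)
    | .inl c => {t | ∑ m, valI c.1 c.2.1 c.2.2.1 c.2.2.2 (t m) ≤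
        ((Real.sqrt 2)⁻¹ - x ^ 2 / 4) * ∑ m, indI c.1 c.2.1 c.2.2.1 c.2.2.2 (t m)}
    | .inr (.inl e) => {t | ∑ m, valII e (t m) ≤ (1 - x) * ∑ m, indII e (t m)}
    | .inr (.inr true) => {t | ∑ m, valIII ω (t m) ≤ (μ - η₃) * ∑ m, indIII (t m)}
    | .inr (.inr false) => {t | ∑ m, -valIII ω (t m) ≤ (-μ - η₃) * ∑ m, indIII (t m)}
  have hbad : ∀ c, iidProb (roundProb Q E) N (bad c) ≤ Real.exp (-(5 * Real.log (n / δ))) := by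
    have hx9 : x ^ 2 ≤ 9 := by nlinarith
    rintro (⟨l, k, i, j⟩ | e | b)
    · refine (iidProb_ratio_le (q := qI) (B := 2) (η := x ^ 2 / 8) hp hp1 (indI_eq l k i j)
        (fun r => ?_) (by norm_num) ?_ (by positivity) (by linarith) ?_ ?_).trans
        (Real.exp_le_exp.2 (neg_le_neg hNI))
      · have := abs_valI_le l k i j r
        have h0 : 0 ≤ |valI l k i j r| := abs_nonneg _
        linarith
      · rw [abs_le]; constructor <;> nlinarith
      · refine le_trans ?_ (mean_valI hQ hγ0.le hM τ₀ l k i j)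
        refine mul_le_mul_of_nonneg_right ?_ ?_
        · linarith
        · exact Finset.sum_nonneg fun r _ => mul_nonneg (hp r)
            (by rcases indI_eq l k i j r with h | h <;> norm_num [h])
      · rw [sum_indI]; exact hQ.hitI_le l k i j
    · refine (iidProb_ratio_le (q := qII) (B := 2) (η := x / 2) hp hp1 (indII_eq e)
        (fun r => ?_) (by norm_num) ?_ (by positivity) (by linarith) ?_ ?_).trans
        (Real.exp_le_exp.2 (neg_le_neg hNII))
      · have := abs_valII_le e r
        have h0 : 0 ≤ |valII e r| := abs_nonneg _
        linarith
      · rw [abs_le]; constructor <;> linarith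
      · refine le_trans ?_ (mean_valII hQ hγ0.le hM τ₀ e)
        refine mul_le_mul_of_nonneg_right ?_ ?_
        · nlinarith
        · exact Finset.sum_nonneg fun r _ => mul_nonneg (hp r)
            (by rcases indII_eq e r with h | h <;> norm_num [h])
      · rw [sum_indII]; exact hQ.hitII_le e
    · have hle : η₃ ≤ W := min_le_right _ _
      have hcount := sum_indIII (E := E) hQ h𝒟.2
      have hval : ∑ r, roundProb Q E r * valIII ω r = qIII * μ := sum_valIII (E := E) hQ ω
      have hvalB : ∀ r : Round n, |valIII ω r| ≤ 2 * W * indIII r := fun r => by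
        have := abs_valIII_le hω r
        have h0 : 0 ≤ |valIII ω r| := abs_nonneg _
        linarith
      have h1 := abs_le.1 hμW
      cases b with
      | true =>
        refine (iidProb_ratio_le (q := qIII) (B := 2 * W) (η := η₃) hp hp1 indIII_eq
          hvalB (by positivity) ?_ hη₃0.le (by linarith) ?_ ?_).trans
          (Real.exp_le_exp.2 (neg_le_neg hNIII))
        · rw [abs_le]; constructor <;> linarith
        · rw [hval, hcount, sub_add_cancel, mul_comm]
        · rw [hcount]
      | false =>
        refine (iidProb_ratio_le (q := qIII) (B := 2 * W) (η := η₃) hp hp1 indIII_eq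
          (w := fun r => -valIII ω r)
          (fun r => by rw [abs_neg]; exact hvalB r) (by positivity) ?_ hη₃0.le (by linarith)
          ?_ ?_).trans (Real.exp_le_exp.2 (neg_le_neg hNIII))
        · rw [abs_le]; constructor <;> linarith
        · simp only [mul_neg, Finset.sum_neg_distrib]
          rw [hval, hcount, sub_add_cancel, mul_comm, mul_neg]
        · rw [hcount]
  have hunion := one_sub_sum_le_iidProb (N := N) hp hp1 (ev := goodEvent E R 𝒟 ω W ε 2 N) bad
    (fun t ht => by
      have hI : ∀ l k i j, (Real.sqrt 2)⁻¹ - x ^ 2 / 4 ≤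
          (∑ m, valI l k i j (t m)) / ∑ m, indI l k i j (t m) := fun l k i j =>
        (lt_div_of_lt (indI_eq l k i j) (abs_valI_le l k i j) t
          (not_le.1 (ht (.inl (l, k, i, j))))).le
      have hII : ∀ e, 1 - x ≤ (∑ m, valII e (t m)) / ∑ m, indII e (t m) := fun e =>
        (lt_div_of_lt (indII_eq e) (abs_valII_le e) t (not_le.1 (ht (.inr (.inl e))))).le
      have hIII1 : μ - η₃ ≤ estIII t ω :=
        (lt_div_of_lt indIII_eq (abs_valIII_le hω) t (not_le.1 (ht (.inr (.inr true))))).le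
      have hIII2 : -μ - η₃ ≤ -estIII t ω := by
        have h := (lt_div_of_lt (w := fun r => -valIII ω r) indIII_eq
          (fun r => by rw [abs_neg]; exact abs_valIII_le hω r) t
          (not_le.1 (ht (.inr (.inr false))))).le
        rwa [Finset.sum_neg_distrib, neg_div] at h
      refine mem_goodEvent ?_ ?_ fun τ => ?_
      · rw [hx2]
        refine (estI_le (by omega) t hI).trans (le_of_eq ?_)
        have h : (Real.sqrt 2)⁻¹ = Real.sqrt 2 / 2 := by
          rw [inv_eq_one_div, Real.sqrt_div_self'.symm]
        rw [h]; ring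
      · exact (estII_le hn t hII).trans (by linarith)
      · have h1 := abs_meanIII_sub_le hW0 hω h𝒟 hγ0.le hM τ
        have h2 : |estIII t ω - μ| ≤ η₃ := abs_le.2 ⟨by linarith, by linarith⟩
        have h3 : η₃ ≤ ε := min_le_left _ _
        have h4 := abs_sub_le (estIII t ω) μ ((obsL 𝒟 ω * τ.1).trace.re)
        have h5 := traceDist_nonneg E.ρ.1 (R.state τ)
        have h6 : W * (n * γ) = 1 / 48 * (ε * x) := by
          have : (n : ℝ) * W * x = ε := by rw [hxdef]; field_simp
          rw [hγ, ← this]; ring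
        have h7 : ε * x ≤ ε * 3 := mul_le_mul_of_nonneg_left hx3 hε.le
        have h8 : W * (2 * (n * γ) + 2 * traceDist E.ρ.1 (R.state τ))
            = 2 * (W * (n * γ)) + 2 * (W * traceDist E.ρ.1 (R.state τ)) := by ring
        rw [h8, h6] at h1
        linarith)
  refine le_trans ?_ hunion
  have hsum : ∑ c, iidProb (roundProb Q E) N (bad c) ≤ δ := by
    refine (Finset.sum_le_sum fun c _ => hbad c).trans ?_
    rw [Finset.sum_const, Finset.card_univ, nsmul_eq_mul]
    refine le_trans (mul_le_mul_of_nonneg_right ?_ (Real.exp_nonneg _))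
      (exp_neg_five_log_le hn hδ hδ1)
    simp only [Fintype.card_sum, Fintype.card_prod, Fintype.card_fin, Fintype.card_bool]
    push_cast
    rw [card_link (by omega)]
    linarith
  linarith

end Certification

/-! ### The sampling of the two protocols -/

section Samplings

variable {n : ℕ}

lemma sum_settings_prod (G : Fin n → Option ASetting → Option Pauli → ℝ) :
    ∑ s : Settings n, ∏ l, G l (s.1 l) (s.2 l) = ∏ l, ∑ a, ∑ b, G l a b := by
  rw [Fintype.sum_prod_type]
  simp only [Fintype.prod_sum]

/-- The distribution of the inputs `(x_l, y_l)` of a pair of parties in the first test. -/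
def pairProbI (a : Option ASetting) (b : Option Pauli) : ℝ :=
  ∑ k : Fin 3, ∑ i : Fin 2, ∑ j : Fin 2,
    if a = some (.chsh (chshX i k)) ∧ b = some (chshY j k) then (1 / 12 : ℝ) else 0

lemma pairProbI_nonneg (a : Option ASetting) (b : Option Pauli) : 0 ≤ pairProbI a b :=
  Finset.sum_nonneg fun k _ => Finset.sum_nonneg fun i _ => Finset.sum_nonneg fun j _ => by
    split_ifs <;> norm_num

lemma le_pairProbI (k : Fin 3) (i j : Fin 2) :
    1 / 12 ≤ pairProbI (some (.chsh (chshX i k))) (some (chshY j k)) := by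
  have h0 : ∀ k' i' j', (0 : ℝ) ≤ if
      (some (ASetting.chsh (chshX i k)) = some (.chsh (chshX i' k')) ∧
      some (chshY j k) = some (chshY j' k')) then (1 / 12 : ℝ) else 0 := fun k' i' j' => by
    split_ifs <;> norm_num
  refine le_trans ?_ (Finset.single_le_sum (fun k' _ => Finset.sum_nonneg fun i' _ =>
    Finset.sum_nonneg fun j' _ => h0 k' i' j') (Finset.mem_univ k))
  refine le_trans ?_ (Finset.single_le_sum (fun i' _ =>
    Finset.sum_nonneg fun j' _ => h0 k i' j') (Finset.mem_univ i))
  refine le_trans ?_ (Finset.single_le_sum (fun j' _ => h0 k i j') (Finset.mem_univ j))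
  simp

lemma sum_pairProbI : ∑ a, ∑ b, pairProbI a b = 1 := by
  have h : ∀ (k : Fin 3) (i j : Fin 2), ∑ a : Option ASetting, ∑ b : Option Pauli,
      (if a = some (.chsh (chshX i k)) ∧ b = some (chshY j k) then (1 / 12 : ℝ) else 0)
      = 1 / 12 := by
    intro k i j
    simp only [ite_and, Finset.sum_ite_eq', Finset.sum_ite_irrel, Finset.sum_const_zero,
      Finset.mem_univ, if_true]
  calc ∑ a, ∑ b, pairProbI a b = ∑ k : Fin 3, ∑ i : Fin 2, ∑ j : Fin 2,
        ∑ a : Option ASetting, ∑ b : Option Pauli,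
        (if a = some (.chsh (chshX i k)) ∧ b = some (chshY j k) then (1 / 12 : ℝ) else 0) := by
        simp only [pairProbI, ← Fintype.sum_prod_type']
        exact Fintype.sum_equiv ⟨fun x => (x.2.2.1, x.2.2.2.1, x.2.2.2.2, x.1, x.2.1),
          fun x => (x.2.2.2.1, x.2.2.2.2, x.1, x.2.1, x.2.2.1), fun _ => rfl, fun _ => rfl⟩
          _ _ fun _ => rfl
    _ = 1 := by simp only [h]; simp; norm_num

lemma sharedProbI_eq (s : Settings n) : sharedProbI s = ∏ l, pairProbI (s.1 l) (s.2 l) := rfl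

lemma sharedProbI_nonneg (s : Settings n) : 0 ≤ sharedProbI s :=
  Finset.prod_nonneg fun _ _ => pairProbI_nonneg _ _

lemma sum_sharedProbI : ∑ s : Settings n, sharedProbI s = 1 := by
  simp only [sharedProbI_eq]
  rw [sum_settings_prod fun _ => pairProbI]
  simp only [sum_pairProbI, Finset.prod_const_one]

open Classical in
lemma le_sum_sharedProbI (l : Fin n) (k : Fin 3) (i j : Fin 2) :
    1 / 12 ≤ ∑ s, sharedProbI s * (if CondI l k i j s then 1 else 0) := by
  have h : ∀ s : Settings n, sharedProbI s * (if CondI l k i j s then 1 else 0)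
      = ∏ l', pairProbI (s.1 l') (s.2 l') * (if l' = l then
        (if s.1 l' = some (.chsh (chshX i k)) ∧ s.2 l' = some (chshY j k) then 1 else 0)
        else 1) := by
    intro s
    rw [Finset.prod_mul_distrib, Fintype.prod_ite_eq', sharedProbI_eq]
    congr
  rw [Finset.sum_congr rfl fun s _ => h s, sum_settings_prod fun l' a b => pairProbI a b *
    (if l' = l then (if a = some (.chsh (chshX i k)) ∧ b = some (chshY j k) then 1 else 0) else 1),
    Fintype.prod_eq_single l]
  · simp only [if_true, mul_ite, mul_one, mul_zero, ite_and, Finset.sum_ite_eq',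
      Finset.sum_ite_irrel, Finset.sum_const_zero, Finset.mem_univ]
    exact le_pairProbI k i j
  · intro l' hl
    simp only [hl, if_false, mul_one, sum_pairProbI]

/-- The second test draws one of six settings uniformly. -/
lemma sum_sharedProbII_mul (f : Settings n → ℝ) :
    ∑ s, sharedProbII s * f s = 1 / 6 * ∑ par, ∑ P, f (linkSettings par P) := by
  simp only [sharedProbII, Finset.sum_mul, ite_mul, zero_mul]
  rw [Finset.sum_comm, Finset.mul_sum]
  refine Finset.sum_congr rfl fun par _ => ?_
  rw [Finset.sum_comm, Finset.mul_sum]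
  refine Finset.sum_congr rfl fun P _ => ?_
  rw [Finset.sum_ite_eq' Finset.univ (linkSettings par P), if_pos (Finset.mem_univ _)]

lemma sharedProbII_nonneg (s : Settings n) : 0 ≤ sharedProbII s :=
  Finset.sum_nonneg fun k _ => Finset.sum_nonneg fun i _ => by split_ifs <;> norm_num

lemma card_pauli : Fintype.card Pauli = 3 := rfl

lemma sum_sharedProbII : ∑ s : Settings n, sharedProbII s = 1 := by
  have := sum_sharedProbII_mul (n := n) fun _ => 1
  simp only [mul_one] at this
  rw [this]
  simp [card_pauli]; norm_num

lemma condII_linkSettings (e : Link n) (P : Pauli) :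
    CondII e P (linkSettings ⟨e.1.val % 2, Nat.mod_lt _ (by norm_num)⟩ P) := by
  have h1 := e.2
  have h2 : (e.1.val + 1) % 2 ≠ e.1.val % 2 := by omega
  refine ⟨?_, ?_, ?_, ?_⟩ <;> simp [linkSettings, Link.next, h1, h2]

lemma sum_sharedProbIII_mul (𝒟 : (Fin n → Pauli) → ℝ) (f : Settings n → ℝ) :
    ∑ s, sharedProbIII 𝒟 s * f s = ∑ P, 𝒟 P * f (teleSettings P) := by
  simp only [sharedProbIII, Finset.sum_mul, ite_mul, zero_mul]
  rw [Finset.sum_comm]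
  refine Finset.sum_congr rfl fun P _ => ?_
  exact (Finset.sum_ite_eq' Finset.univ (teleSettings P) fun s => 𝒟 P * f s).trans
    (if_pos (Finset.mem_univ _))

lemma sharedProbIII_nonneg {𝒟 : (Fin n → Pauli) → ℝ} (h : ∀ P, 0 ≤ 𝒟 P) (s : Settings n) :
    0 ≤ sharedProbIII 𝒟 s :=
  Finset.sum_nonneg fun P _ => by split_ifs; exacts [h P, le_rfl]

/-- A round belongs to each test with probability `1 / 3`. In the first test a given CHSH input has
probability `1 / 12`; in the second, a given link is tested for one of the two parities. -/
lemma samplingSpec_shared (hn : 2 ≤ n) {𝒟 : (Fin n → Pauli) → ℝ}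
    (h𝒟 : 𝒟 ∈ stdSimplex ℝ (Fin n → Pauli)) :
    SamplingSpec (sharedSampling 𝒟) 𝒟 (1 / 36) (1 / 6) (1 / 3) where
  settingProb_nonneg s := div_nonneg (add_nonneg (add_nonneg (sharedProbI_nonneg s)
    (sharedProbII_nonneg s)) (sharedProbIII_nonneg h𝒟.1 s)) (by norm_num)
  sum_settingProb := by
    have h3 := sum_sharedProbIII_mul 𝒟 fun _ => 1
    simp only [mul_one, h𝒟.2] at h3
    simp only [sharedSampling]
    rw [← Finset.sum_div, Finset.sum_add_distrib, Finset.sum_add_distrib, sum_sharedProbI,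
      sum_sharedProbII, h3]
    norm_num
  accept_nonneg _ _ := zero_le_one
  accept_le_one _ _ := le_rfl
  hitI_le l k i j := by
    classical
    have h := le_sum_sharedProbI l k i j
    calc (1 / 36 : ℝ) ≤ 1 / 3 * ∑ s, sharedProbI s * (if CondI l k i j s then 1 else 0) := by
          linarith
      _ ≤ _ := by
          rw [Finset.mul_sum]
          refine Finset.sum_le_sum fun s _ => ?_
          rw [← mul_assoc]
          refine mul_le_mul_of_nonneg_right ?_ (by split_ifs <;> norm_num)
          simp only [sharedSampling]
          linarith [sharedProbII_nonneg s, sharedProbIII_nonneg h𝒟.1 s]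
  hitII_le e := by
    classical
    have hnn : ∀ s : Settings n, (0 : ℝ) ≤ ∑ P, if CondII e P s then 1 else 0 := fun s =>
      Finset.sum_nonneg fun P _ => by split_ifs <;> norm_num
    have h := sum_sharedProbII_mul fun s => ∑ P, if CondII e P s then (1 : ℝ) else 0
    have h2 : (3 : ℝ) ≤
        ∑ par, ∑ P, ∑ P', if CondII e P' (linkSettings par P) then (1 : ℝ) else 0 := by
      refine le_trans ?_ (Finset.single_le_sum (fun par _ => Finset.sum_nonneg fun P _ =>
        hnn (linkSettings par P)) (Finset.mem_univ ⟨e.1.val % 2, Nat.mod_lt _ (by norm_num)⟩))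
      have h3 : (3 : ℝ) = ∑ _P : Pauli, 1 := by simp [card_pauli]
      rw [h3]
      refine Finset.sum_le_sum fun P _ => ?_
      refine le_trans ?_ (Finset.single_le_sum (fun P' _ => ?_) (Finset.mem_univ P))
      · rw [if_pos (condII_linkSettings e P)]
      · split_ifs <;> norm_num
    calc (1 / 6 : ℝ) ≤ 1 / 3 * ∑ s, sharedProbII s * ∑ P, if CondII e P s then (1 : ℝ) else 0 := by
          rw [h]; linarith
      _ ≤ _ := by
          rw [Finset.mul_sum]
          refine Finset.sum_le_sum fun s _ => ?_
          rw [← mul_assoc]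
          simp only [sharedSampling, one_mul]
          refine mul_le_mul_of_nonneg_right ?_ (hnn s)
          linarith [sharedProbI_nonneg s, sharedProbIII_nonneg h𝒟.1 s]
  tele P := by
    have h1 : sharedProbI (teleSettings P) = 0 := by
      rw [sharedProbI_eq]
      refine Finset.prod_eq_zero (Finset.mem_univ ⟨0, by omega⟩) ?_
      simp [pairProbI, teleSettings]
    have h2 : sharedProbII (teleSettings P) = 0 := by
      refine Finset.sum_eq_zero fun par _ => Finset.sum_eq_zero fun P' _ => if_neg fun h => ?_
      have h0 := congrFun (congrArg Prod.fst h) ⟨0, by omega⟩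
      simp only [teleSettings, linkSettings] at h0
      split_ifs at h0 <;> simp_all
    have h3 : sharedProbIII 𝒟 (teleSettings P) = 𝒟 P := by
      rw [sharedProbIII, Finset.sum_eq_single P]
      · exact if_pos rfl
      · intro P' _ hne
        exact if_neg fun h => hne (teleSettings_injective h).symm
      · simp
    simp only [sharedSampling, h1, h2, h3]
    ring

lemma sum_localProbA (hn : 1 ≤ n) : ∑ a, localProbA n a = 1 := by
  have hn0 : (n : ℝ) ≠ 0 := by positivity
  have huniv : (Finset.univ : Finset ASetting) =
      {.chsh 0, .chsh 1, .chsh 2, .chsh 3, .chsh 4, .chsh 5, .right, .left, .tele} := by decide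
  rw [Fintype.sum_option, huniv]
  simp [localProbA]
  field_simp
  ring

lemma localProbA_nonneg (hn : 1 ≤ n) (a : Option ASetting) : 0 ≤ localProbA n a := by
  have h1 : (1 : ℝ) ≤ n := by exact_mod_cast hn
  rcases a with _ | (_ | _ | _ | _) <;> simp only [localProbA]
  · exact le_rfl
  · positivity
  · positivity
  · positivity
  · rw [sub_nonneg, div_le_one (by linarith)]; exact h1

lemma sum_localProbB {p : Pauli → ℝ} (hp : p ∈ stdSimplex ℝ Pauli) : ∑ b, localProbB p b = 1 := by
  rw [Fintype.sum_option]
  simp only [localProbB, zero_add]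
  exact hp.2

lemma localProbB_nonneg {p : Pauli → ℝ} (hp : ∀ P, 0 ≤ p P) (b : Option Pauli) :
    0 ≤ localProbB p b := by
  cases b with
  | none => exact le_rfl
  | some P => exact hp P

lemma minPair_le (p : Fin n → Pauli → ℝ) (e : Link n) (P : Pauli) :
    minPair p e ≤ p e.1 P * p e.next P := ciInf_le (Set.finite_range _).bddBelow P

lemma le_minPair {p : Fin n → Pauli → ℝ} {p₀ : ℝ} (hp₀ : 0 < p₀) (hp : ∀ l P, p₀ ≤ p l P)
    (e : Link n) : p₀ ^ 2 ≤ minPair p e := by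
  have : Nonempty Pauli := ⟨.X⟩
  refine le_ciInf fun P => ?_
  rw [sq]
  exact mul_le_mul (hp _ _) (hp _ _) hp₀.le (hp₀.le.trans (hp _ _))

/-- The acceptance probabilities make the hit probabilities of a link equal for the three Pauli
inputs; the bound for `X` alone is sufficient here. -/
lemma samplingSpec_local (hn : 2 ≤ n) {p : Fin n → Pauli → ℝ} {p₀ : ℝ} (hp₀ : 0 < p₀)
    (hs : ∀ l, p l ∈ stdSimplex ℝ Pauli) (hp : ∀ l P, p₀ ≤ p l P) :
    SamplingSpec (localSampling p) (prodDist p) (p₀ / (8 * n)) (p₀ ^ 2 / (64 * n ^ 2))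
      ((1 - 1 / n) ^ n) := by
  have hn1 : 1 ≤ n := by omega
  have hn0 : (0 : ℝ) < n := by positivity
  have hpos : ∀ l P, 0 < p l P := fun l P => hp₀.trans_le (hp l P)
  have hA := sum_localProbA hn1
  have hB := fun l => sum_localProbB (hs l)
  have hAB : ∀ l, ∑ a, ∑ b, localProbA n a * localProbB (p l) b = 1 := fun l => by
    rw [← Finset.sum_mul_sum, hA, hB, one_mul]
  have hset : ∀ s : Settings n, (localSampling p).settingProb s
      = ∏ l, localProbA n (s.1 l) * localProbB (p l) (s.2 l) := fun s => by
    rw [Finset.prod_mul_distrib]; rfl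
  have hnn : ∀ s, 0 ≤ (localSampling p).settingProb s := fun s => by
    rw [hset]
    exact Finset.prod_nonneg fun l _ => mul_nonneg (localProbA_nonneg hn1 _)
      (localProbB_nonneg (fun P => (hpos l P).le) _)
  have hacc0 : ∀ s e, 0 ≤ (localSampling p).accept s e := by
    intro s e
    simp only [localSampling]
    split
    · exact div_nonneg ((sq_nonneg p₀).trans (le_minPair hp₀ hp e))
        (mul_pos (hpos _ _) (hpos _ _)).le
    · exact zero_le_one
  refine ⟨hnn, ?_, hacc0, ?_, ?_, ?_, ?_⟩
  · simp only [hset]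
    rw [sum_settings_prod fun l a b => localProbA n a * localProbB (p l) b]
    simp only [hAB, Finset.prod_const_one]
  · intro s e
    simp only [localSampling]
    split
    · exact (div_le_one (mul_pos (hpos _ _) (hpos _ _))).2 (minPair_le p e _)
    · exact le_rfl
  · intro l k i j
    classical
    have h : ∀ s : Settings n, (localSampling p).settingProb s * (if CondI l k i j s then 1 else 0)
        = ∏ l', localProbA n (s.1 l') * localProbB (p l') (s.2 l') * (if l' = l then
          (if s.1 l' = some (.chsh (chshX i k)) ∧ s.2 l' = some (chshY j k) then 1 else 0)
          else 1) := by
      intro s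
      rw [Finset.prod_mul_distrib, Fintype.prod_ite_eq', hset]
      congr
    rw [Finset.sum_congr rfl fun s _ => h s, sum_settings_prod fun l' a b =>
      localProbA n a * localProbB (p l') b * (if l' = l then
        (if a = some (.chsh (chshX i k)) ∧ b = some (chshY j k) then 1 else 0) else 1),
      Fintype.prod_eq_single l]
    · simp only [if_true, mul_ite, mul_one, mul_zero, ite_and, Finset.sum_ite_eq',
        Finset.sum_ite_irrel, Finset.sum_const_zero, Finset.mem_univ]
      simp only [localProbA, localProbB]
      rw [div_mul_eq_mul_div, one_mul]
      gcongr
      exact hp _ _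
    · intro l' hl
      simp only [hl, if_false, mul_one, hAB]
  · intro e
    classical
    have h : ∀ s : Settings n, (localSampling p).settingProb s *
        ((localSampling p).accept s e * (if CondII e .X s then 1 else 0))
        = minPair p e / (p e.1 .X * p e.next .X) *
          ∏ l', localProbA n (s.1 l') * localProbB (p l') (s.2 l') *
          (if l' = e.1 then (if s.1 l' = some .right ∧ s.2 l' = some .X then 1 else 0)
            else if l' = e.next then (if s.1 l' = some .left ∧ s.2 l' = some .X then 1 else 0)
            else 1) := by
      intro s
      rw [Finset.prod_mul_distrib, ← hset]
      rw [Fintype.prod_eq_mul e.1 e.next e.ne_next (fun l' hl => by simp [hl.1, hl.2])]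
      by_cases hc : CondII e .X s
      · have hacc : (localSampling p).accept s e = minPair p e / (p e.1 .X * p e.next .X) := by
          simp only [localSampling, hc.2.2.1]
        simp only [hc, if_true, hacc, hc.1, hc.2.1, hc.2.2.1, hc.2.2.2, and_self,
          if_neg e.ne_next.symm]
        ring
      · have hz : (if s.1 e.1 = some .right ∧ s.2 e.1 = some .X then (1 : ℝ) else 0) *
            (if s.1 e.next = some .left ∧ s.2 e.next = some .X then 1 else 0) = 0 := by
          rw [mul_eq_zero]
          by_contra hcon
          push Not at hcon
          have h1 : s.1 e.1 = some .right ∧ s.2 e.1 = some .X := by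
            by_contra h; exact hcon.1 (if_neg h)
          have h2 : s.1 e.next = some .left ∧ s.2 e.next = some .X := by
            by_contra h; exact hcon.2 (if_neg h)
          exact hc ⟨h1.1, h2.1, h1.2, h2.2⟩
        simp only [if_true, if_neg e.ne_next.symm, hz, hc, if_false, mul_zero]
    have hle : ∑ s, (localSampling p).settingProb s *
        ((localSampling p).accept s e * (if CondII e .X s then 1 else 0)) ≤
        ∑ s, (localSampling p).settingProb s *
        ((localSampling p).accept s e * ∑ P, if CondII e P s then 1 else 0) := by
      refine Finset.sum_le_sum fun s _ => mul_le_mul_of_nonneg_left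
        (mul_le_mul_of_nonneg_left ?_ (hacc0 s e)) (hnn s)
      exact Finset.single_le_sum (f := fun P => if CondII e P s then (1 : ℝ) else 0)
        (fun P _ => by split_ifs <;> norm_num) (Finset.mem_univ Pauli.X)
    refine le_trans (le_of_le_of_eq ?_ (Finset.sum_congr rfl fun s _ => (h s).symm)) hle
    rw [← Finset.mul_sum, sum_settings_prod fun l' a b =>
      localProbA n a * localProbB (p l') b *
          (if l' = e.1 then (if a = some .right ∧ b = some .X then 1 else 0)
            else if l' = e.next then (if a = some .left ∧ b = some .X then 1 else 0)
            else 1),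
      Fintype.prod_eq_mul e.1 e.next e.ne_next (fun l' hl => by
        simp only [hl.1, hl.2, if_false, mul_one, hAB])]
    simp only [if_true, if_neg e.ne_next.symm, mul_ite, mul_one, mul_zero, ite_and,
      Finset.sum_ite_eq', Finset.sum_ite_irrel, Finset.sum_const_zero, Finset.mem_univ]
    simp only [localProbA, localProbB]
    have h1 := hpos e.1 .X
    have h2 := hpos e.next .X
    have heq : minPair p e / (p e.1 .X * p e.next .X) *
        (1 / (8 * (n : ℝ)) * p e.1 .X * (1 / (8 * n) * p e.next .X))
        = minPair p e / (64 * n ^ 2) := by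
      field_simp
      norm_num
    rw [heq]
    gcongr
    exact le_minPair hp₀ hp e
  · intro P
    rw [hset, Finset.prod_mul_distrib]
    simp only [teleSettings, localProbA, localProbB, Finset.prod_const, Finset.card_univ,
      Fintype.card_fin, prodDist]

lemma quarter_le_one_sub_inv_pow (hn : 2 ≤ n) : (1 / 4 : ℝ) ≤ (1 - 1 / n) ^ n := by
  have hn2 : (2 : ℝ) ≤ n := by exact_mod_cast hn
  have hn0 : (0 : ℝ) < n := by linarith
  have hinv : 1 / (n : ℝ) ≤ 1 := (div_le_one hn0).2 (by linarith)
  -- Bernoulli's inequality for the exponent `n / 2 ≥ 1`, squared.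
  have h := one_add_mul_self_le_rpow_one_add (s := -(1 / (n : ℝ))) (by linarith)
    (p := n / 2) (by linarith)
  have h1 : 1 + (n : ℝ) / 2 * -(1 / n) = 1 / 2 := by field_simp; norm_num
  rw [h1, ← sub_eq_add_neg] at h
  calc (1 / 4 : ℝ) = (1 / 2) ^ 2 := by norm_num
    _ ≤ ((1 - 1 / (n : ℝ)) ^ ((n : ℝ) / 2)) ^ 2 := pow_le_pow_left₀ (by norm_num) h 2
    _ = (1 - 1 / n) ^ n := by
        rw [← Real.rpow_natCast, ← Real.rpow_mul (by linarith), ← Real.rpow_natCast]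
        congr 1
        push_cast
        ring

lemma prodDist_mem_stdSimplex {p : Fin n → Pauli → ℝ} (hs : ∀ l, p l ∈ stdSimplex ℝ Pauli) :
    prodDist p ∈ stdSimplex ℝ (Fin n → Pauli) := by
  refine ⟨fun P => Finset.prod_nonneg fun l _ => (hs l).1 _, ?_⟩
  simp only [prodDist]
  rw [← Fintype.prod_sum]
  simp [(hs _).2]

/-- For `x = ε / (n W) ≤ 3`, the squared relative deviation `(min ε W / W)²` allowed in the third
test is at least of order `x²`. -/
lemma sq_le_min_sq (hn : 1 ≤ n) {ε W : ℝ} (hε : 0 < ε) (hW : 0 < W) (hx : ε ≤ 3 * (n * W)) :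
    (ε / (n * W)) ^ 2 * W ^ 2 / 9 ≤ (min ε W) ^ 2 := by
  have hn1 : (1 : ℝ) ≤ n := by exact_mod_cast hn
  have hx3 : ε / (n * W) ≤ 3 := by rwa [div_le_iff₀ (by positivity)]
  have h1 : ε / (n * W) * W / 3 ≤ min ε W := by
    refine le_min ?_ ?_
    · have : ε / (n * W) * W = ε / n := by field_simp
      rw [this]
      have : ε / n ≤ ε := div_le_self hε.le hn1
      linarith
    · nlinarith
  calc (ε / (n * W)) ^ 2 * W ^ 2 / 9 = (ε / (n * W) * W / 3) ^ 2 := by ring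
    _ ≤ _ := pow_le_pow_left₀ (by positivity) h1 2

end Samplings

/-! ### The number of rounds -/

section Rounds

variable {n : ℕ} {HA HB : Fin n → Type}
  [∀ l, Fintype (HA l)] [∀ l, DecidableEq (HA l)] [∀ l, Fintype (HB l)] [∀ l, DecidableEq (HB l)]
  {E : Experiment HA HB} {R : Embedding HA HB}

/-- In terms of `x = ε / (n W)`, the number of rounds is at least of order `log (n / δ) / x⁴`. -/
lemma one_sub_le_protProb_shared (hn : 2 ≤ n) {𝒟 : (Fin n → Pauli) → ℝ}
    {ω : (Fin n → Fin 2) → (Fin n → Pauli) → ℝ} {W ε δ : ℝ}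
    (h𝒟 : 𝒟 ∈ stdSimplex ℝ (Fin n → Pauli)) (hW : 1 < W) (hω : ∀ b P, |ω b P| ≤ W)
    (hε : 0 < ε) (hδ : 0 < δ) (hδ1 : δ < 1)
    (hS : stateError E R ≤ 1 / 48 * (ε ^ 2 / (n ^ 2 * W ^ 2)))
    (hM : measError E R ≤ ENNReal.ofReal (1 / 48 * (ε ^ 2 / (n ^ 2 * W ^ 2)))) {N : ℕ}
    (hN : 10 ^ 6 * (W ^ 4 * n ^ 4 * (Real.log (n / δ) / ε ^ 4)) ≤ N) :
    1 - δ ≤ protProb (sharedSampling 𝒟) E N (goodEvent E R 𝒟 ω W ε 2 N) := by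
  have hn2 : (2 : ℝ) ≤ n := by exact_mod_cast hn
  have hn0 : (0 : ℝ) < n := by linarith
  have hW0 : 0 < W := by linarith
  have hQ := samplingSpec_shared hn h𝒟
  rcases le_total ε (3 * (n * W)) with hx | hx
  · have hL : 0 < Real.log (n / δ) := Real.log_pos ((one_lt_div hδ).2 (by linarith))
    have hmin := sq_le_min_sq (by omega) hε hW0 hx
    set x := ε / (n * W) with hxdef
    have hx0 : 0 < x := by positivity
    have hx3 : x ≤ 3 := by rwa [hxdef, div_le_iff₀ (by positivity)]
    have hx9 : x ^ 2 ≤ 9 := by nlinarith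
    set Λ := Real.log (n / δ) with hΛ
    have hN4 : 10 ^ 6 * Λ ≤ N * x ^ 4 := by
      have : 10 ^ 6 * (W ^ 4 * n ^ 4 * (Λ / ε ^ 4)) = 10 ^ 6 * Λ / x ^ 4 := by
        rw [hxdef]; field_simp
      rwa [this, div_le_iff₀ (by positivity)] at hN
    have hN2 : 10 ^ 6 * Λ ≤ N * x ^ 2 * 9 := by
      have h0 : (0 : ℝ) ≤ N * x ^ 2 := by positivity
      nlinarith
    refine one_sub_le_protProb hn h𝒟 hQ hW hω hε hδ hδ1 hx hS hM ?_ ?_ ?_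
    · linarith
    · linarith
    · have : x ^ 2 / 36 ≤ min ε W ^ 2 / (2 * W) ^ 2 := by
        rw [le_div_iff₀ (by positivity)]
        linarith
      have h0 : (0 : ℝ) ≤ N := by positivity
      calc 5 * Λ ≤ N * (1 / 3 * (x ^ 2 / 36) / 16) := by linarith
        _ ≤ N * (1 / 3 * (min ε W ^ 2 / (2 * W) ^ 2) / 16) := by gcongr
        _ = _ := by field_simp
  · have huniv : goodEvent E R 𝒟 ω W ε 2 N = Set.univ :=
      Set.eq_univ_of_forall (mem_goodEvent_of_large hn h𝒟 hW hω hx)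
    have h1 : protProb (sharedSampling 𝒟) E N Set.univ = 1 := 
      iidProb_univ (sum_roundProb hQ)
    rw [huniv, h1]
    linarith

/-- In terms of `x = ε / (n W)`, the number of rounds is at least of order `n log (n / δ) / x⁴`. -/
lemma one_sub_le_protProb_local (hn : 2 ≤ n) {p : Fin n → Pauli → ℝ} {p₀ : ℝ}
    {ω : (Fin n → Fin 2) → (Fin n → Pauli) → ℝ} {W ε δ : ℝ} (hp₀ : 0 < p₀)
    (hs : ∀ l, p l ∈ stdSimplex ℝ Pauli) (hp : ∀ l P, p₀ ≤ p l P)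
    (hW : 1 < W) (hω : ∀ b P, |ω b P| ≤ W)
    (hε : 0 < ε) (hεn : ε ≤ Real.sqrt n * W) (hδ : 0 < δ) (hδ1 : δ < 1)
    (hS : stateError E R ≤ 1 / 48 * (ε ^ 2 / (n ^ 2 * W ^ 2)))
    (hM : measError E R ≤ ENNReal.ofReal (1 / 48 * (ε ^ 2 / (n ^ 2 * W ^ 2)))) {N : ℕ}
    (hN : 10 ^ 6 * (1 + 1 / p₀ + 1 / p₀ ^ 2) *
      (W ^ 4 * n ^ 5 * (Real.log (n / δ) / ε ^ 4)) ≤ N) :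
    1 - δ ≤ protProb (localSampling p) E N (goodEvent E R (prodDist p) ω W ε 2 N) := by
  have hn2 : (2 : ℝ) ≤ n := by exact_mod_cast hn
  have hn0 : (0 : ℝ) < n := by linarith
  have hW0 : 0 < W := by linarith
  have hQ := samplingSpec_local hn hp₀ hs hp
  have hsq : Real.sqrt n ≤ n := by
    rw [Real.sqrt_le_left hn0.le]; nlinarith
  have hx : ε ≤ 3 * (n * W) := by nlinarith
  have hL : 0 < Real.log (n / δ) := Real.log_pos ((one_lt_div hδ).2 (by linarith))
  have hmin := sq_le_min_sq (by omega) hε hW0 hx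
  -- `x² ≤ 1 / n` is what the restriction on `ε` is needed for: the link test has hit
  -- probability of order `1 / n²` only.
  have hxn : (ε / (n * W)) ^ 2 * n ≤ 1 := by
    have h1 : ε ^ 2 ≤ n * W ^ 2 := by
      calc ε ^ 2 ≤ (Real.sqrt n * W) ^ 2 := pow_le_pow_left₀ hε.le hεn 2
        _ = n * W ^ 2 := by rw [mul_pow, Real.sq_sqrt hn0.le]
    rw [div_pow, div_mul_eq_mul_div, div_le_one (by positivity)]
    nlinarith
  set x := ε / (n * W) with hxdef
  have hx0 : 0 < x := by positivity
  set Λ := Real.log (n / δ) with hΛ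
  have hN4 : 10 ^ 6 * (1 + 1 / p₀ + 1 / p₀ ^ 2) * (n * Λ) ≤ N * x ^ 4 := by
    have : 10 ^ 6 * (1 + 1 / p₀ + 1 / p₀ ^ 2) * (W ^ 4 * n ^ 5 * (Λ / ε ^ 4))
        = 10 ^ 6 * (1 + 1 / p₀ + 1 / p₀ ^ 2) * (n * Λ) / x ^ 4 := by
      rw [hxdef]; field_simp
    rwa [this, div_le_iff₀ (by positivity)] at hN
  have hN2 : 10 ^ 6 * (1 + 1 / p₀ + 1 / p₀ ^ 2) * (n ^ 2 * Λ) ≤ N * x ^ 2 := by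
    calc 10 ^ 6 * (1 + 1 / p₀ + 1 / p₀ ^ 2) * (n ^ 2 * Λ)
        = 10 ^ 6 * (1 + 1 / p₀ + 1 / p₀ ^ 2) * (n * Λ) * n := by ring
      _ ≤ N * x ^ 4 * n := by gcongr
      _ = N * x ^ 2 * (x ^ 2 * n) := by ring
      _ ≤ N * x ^ 2 * 1 := by gcongr
      _ = N * x ^ 2 := mul_one _
  have h1 : 0 < 1 / p₀ := by positivity
  have h2 : 0 < 1 / p₀ ^ 2 := by positivity
  refine one_sub_le_protProb hn (prodDist_mem_stdSimplex hs) hQ hW hω hε hδ hδ1 hx hS hM ?_ ?_ ?_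
  · have h : 10 ^ 6 * (1 / p₀) * (n * Λ) ≤ N * x ^ 4 :=
      le_trans (by gcongr; linarith) hN4
    have h' : 10 ^ 6 * Λ ≤ N * x ^ 4 * (p₀ / n) := by
      calc 10 ^ 6 * Λ = 10 ^ 6 * (1 / p₀) * (n * Λ) * (p₀ / n) := by field_simp
        _ ≤ _ := by gcongr
    calc 5 * Λ ≤ N * x ^ 4 * (p₀ / n) / (8 * 64 * 64) := by linarith
      _ = _ := by rw [← hxdef]; ring
  · have h : 10 ^ 6 * (1 / p₀ ^ 2) * (n ^ 2 * Λ) ≤ N * x ^ 2 :=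
      le_trans (by gcongr; linarith) hN2
    have h' : 10 ^ 6 * Λ ≤ N * x ^ 2 * (p₀ ^ 2 / n ^ 2) := by
      calc 10 ^ 6 * Λ = 10 ^ 6 * (1 / p₀ ^ 2) * (n ^ 2 * Λ) * (p₀ ^ 2 / n ^ 2) := by field_simp
        _ ≤ _ := by gcongr
    calc 5 * Λ ≤ N * x ^ 2 * (p₀ ^ 2 / n ^ 2) / (64 * 4 * 64) := by linarith
      _ = _ := by rw [← hxdef]; ring
  · have h : 10 ^ 6 * 1 * (1 * Λ) ≤ N * x ^ 2 := by
      refine le_trans ?_ hN2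
      gcongr
      · linarith
      · nlinarith
    have h3 : x ^ 2 / 36 ≤ min ε W ^ 2 / (2 * W) ^ 2 := by
      rw [le_div_iff₀ (by positivity)]
      linarith
    have h4 := quarter_le_one_sub_inv_pow hn
    calc 5 * Λ ≤ N * (1 / 4 * (x ^ 2 / 36) / 16) := by linarith
      _ ≤ N * ((1 - 1 / n) ^ n * (min ε W ^ 2 / (2 * W) ^ 2) / 16) := by gcongr
      _ = _ := by field_simp

end Rounds

end

end DISelfTest
theorem theoremS4 :
    ∃ c > (0 : ℝ), ∃ C > (0 : ℝ),
      -- local randomness, product distribution with marginals bounded below by `p₀`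
      (∀ p₀ > (0 : ℝ), ∃ K > (0 : ℝ),
        ∀ (n : ℕ), 2 ≤ n →
        ∀ (HA HB : Fin n → Type) [∀ l, Fintype (HA l)] [∀ l, DecidableEq (HA l)]
          [∀ l, Fintype (HB l)] [∀ l, DecidableEq (HB l)]
          (E : Experiment HA HB) (R : Embedding HA HB)
          (p : Fin n → Pauli → ℝ) (ω : (Fin n → Fin 2) → (Fin n → Pauli) → ℝ) (W ε δ : ℝ),
        (∀ l, p l ∈ stdSimplex ℝ Pauli) → (∀ l P, p₀ ≤ p l P) →
        1 < W → (∀ b P, |ω b P| ≤ W) →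
        0 < ε → ε ≤ Real.sqrt n * W → 0 < δ → δ < 1 →
        stateError E R ≤ c * (ε ^ 2 / (n ^ 2 * W ^ 2)) →
        measError E R ≤ ENNReal.ofReal (c * (ε ^ 2 / (n ^ 2 * W ^ 2))) →
        ∀ N : ℕ, K * (W ^ 4 * n ^ 5 * (Real.log (n / δ) / ε ^ 4)) ≤ N →
          1 - δ ≤ protProb (localSampling p) E N (goodEvent E R (prodDist p) ω W ε C N)) ∧
      -- shared randomness, arbitrary distribution
      (∃ K > (0 : ℝ),
        ∀ (n : ℕ), 2 ≤ n →
        ∀ (HA HB : Fin n → Type) [∀ l, Fintype (HA l)] [∀ l, DecidableEq (HA l)]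
          [∀ l, Fintype (HB l)] [∀ l, DecidableEq (HB l)]
          (E : Experiment HA HB) (R : Embedding HA HB)
          (𝒟 : (Fin n → Pauli) → ℝ) (ω : (Fin n → Fin 2) → (Fin n → Pauli) → ℝ) (W ε δ : ℝ),
        𝒟 ∈ stdSimplex ℝ (Fin n → Pauli) →
        1 < W → (∀ b P, |ω b P| ≤ W) →
        0 < ε → 0 < δ → δ < 1 →
        stateError E R ≤ c * (ε ^ 2 / (n ^ 2 * W ^ 2)) →
        measError E R ≤ ENNReal.ofReal (c * (ε ^ 2 / (n ^ 2 * W ^ 2))) →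
        ∀ N : ℕ, K * (W ^ 4 * n ^ 4 * (Real.log (n / δ) / ε ^ 4)) ≤ N →
          1 - δ ≤ protProb (sharedSampling 𝒟) E N (goodEvent E R 𝒟 ω W ε C N)) := by


  refine ⟨1 / 48, by norm_num, 2, by norm_num, fun p₀ hp₀ =>
    ⟨10 ^ 6 * (1 + 1 / p₀ + 1 / p₀ ^ 2), by positivity, ?_⟩, 10 ^ 6, by norm_num, ?_⟩
  · intro n hn HA HB _ _ _ _ E R p ω W ε δ hs hp hW hω hε hεn hδ hδ1 hS hM N hN
    exact one_sub_le_protProb_local hn hp₀ hs hp hW hω hε hεn hδ hδ1 hS hM hN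
  · intro n hn HA HB _ _ _ _ E R 𝒟 ω W ε δ h𝒟 hW hω hε hδ hδ1 hS hM N hN
    exact one_sub_le_protProb_shared hn h𝒟 hW hω hε hδ hδ1 hS hM hN
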